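/- Let $n,m\ge 0$ and let $\mathbb K$ be a field. The root system $R=A(n,m)$ is $R=R_0\sqcup R_1$ in $\mathbb Z^{n+m}=\langle \epsilon_1,\dots,\epsilon_n,\delta_1,\dots,\delta_m\rangle$, with even roots $R_0=\{\epsilon_i-\epsilon_j,\ \delta_i-\delta_j : i\ne j\}$ and odd roots $R_1=\{\pm(\epsilon_i-\delta_j)\}$. Let $\sigma_1,\dots,\sigma_{n+m}$ be any ordering of the $\epsilon$'s and $\delta$'s, let $\Pi=\{\alpha_i=\sigma_i-\sigma_{i+1}\}$ be the corresponding simple system, and let $\Gamma$ be its Dynkin graph (of type $A_{n+m-1}$, with Coxeter number $h=n+m$); the coloured graph $\Gamma_{col}$ is $\Gamma$ with vertex $i$ given the parity $p(i)\in\mathbb Z_2$ of $\alpha_i$. Let $\Omega$ be an orientation of $\Gamma$. For a vertex $i$ that is a sink or a source, $s_i\Omega$ is obtained by reversing all arrows at $i$, and $s_i\Gamma_{col}$ by changing the parity of all neighbours of $i$ if $p(i)=1$ (and $s_i\Gamma_{col}=\Gamma_{col}$ if $p(i)=0$). Let $w_0=s_{i_1}\cdots s_{i_l}$ be a reduced expression,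 adapted to $\Omega$, of the longest element of the Weyl group of $A_{n+m-1}$ (which acts on $\mathbb Z^{n+m}$ by forgetting parities); adapted means that $i_k$ is a sink of $s_{i_{k-1}}\cdots s_{i_1}\Omega$ for all $k$. A super-representation $X$ of a coloured quiver consists of finite dimensional $\mathbb Z_2$-graded $\mathbb K$-vector spaces $X(i)$ and, for each arrow $i\to j$, a homogeneous linear map $X(i)\to X(j)$ of degree $p(i)+p(j)$. Morphisms are families of linear maps commuting with the structure maps (equivalently, sums of such families consisting of homogeneous maps, of either degree); this is an abelian category $\mathrm{SRep}$. Write $P$ for the parity change. If $i$ is a sink of $\Omega$, the reflection functor $\widetilde S_i:\mathrm{SRep}(s_i\Gamma_{col},s_i\Omega)\to\mathrm{SRep}(\Gamma_{col},\Omega)$ replaces $X(i)$ by $\mathrm{coker}\big(X(i)\to\bigoplus_{k} P^{p'(i)+p'(k)}X(k)\big)$, the sum being over the neighbours $k$ of $i$ and $p'$ denoting the parity in $s_i\Gamma_{col}$, replaces $X(k)$ by $P^{p(i)}X(k)$ for the neighbours $k$ of $i$, and leaves the other spaces unchanged; the maps $X(k)\to\mathrm{coker}$ are the components of the quotient map,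 and the other maps are unchanged. For a positive root $\alpha=s_{i_1}\cdots s_{i_{j-1}}\alpha_{i_j}$ put $X_\alpha=\widetilde S_{i_1}\cdots\widetilde S_{i_{j-1}}(\mathbb S_{i_j}^{p_j})$, where $p_j$ is the parity of $i_j$ in $s_{i_{j-1}}\cdots s_{i_1}\Gamma_{col}$ and $\mathbb S_i^p$ is the simple super-representation that is one-dimensional of parity $p$ at $i$ and zero elsewhere; let $p(X_\alpha)=\sum_i p(X_\alpha(i))\in\mathbb Z_2$. Put $X_{-\alpha}=TX_\alpha$ in the orbit category $\mathcal D=D^b(\mathrm{SRep}(\Gamma_{col},\Omega))/T^2$, where $T$ is the translation functor, and $p(X_{-\alpha})=p(X_\alpha)$. Let $\varpi:\Gamma\to\mathbb Z_2$ be any function taking different values at adjacent vertices. The periodic Auslander–Reiten quiver $\widehat\Gamma$ has vertices $(i,k)\in\Gamma\times\mathbb Z_{2h}$ with $k+\varpi(i)\equiv 0 \bmod 2$ and arrows $(i,k)\to(j,k+1)$ for $i,j$ adjacent in $\Gamma$. Then: 1. Every root is positive or negative, and each positive root is $s_{i_1}\cdots s_{i_{j-1}}\alpha_{i_j}$ for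 exactly one $j$. For every root $\alpha$, $X_\alpha$ is an indecomposable object of $\mathcal D$, and for $\alpha$ positive each space $X_\alpha(i)$ is purely even or purely odd (so that $p(X_{\pm\alpha})$ makes sense). 2. There is an isomorphism of quivers from the Auslander–Reiten quiver of $\mathcal D$ (vertices: isomorphism classes of indecomposable objects; an arrow $[X]\to[Y]$ if there is an irreducible morphism $X\to Y$) to $\widehat\Gamma$ such that, if its vertices are identified with those of $\widehat\Gamma$ in this way, then: (a) $\alpha\mapsto[X_\alpha]$ is a bijection from $R$ to the set of vertices of $\widehat\Gamma$; (b) if the vertex $[X_\alpha]$ is coloured by the parity $p(X_\alpha)$, then $\alpha\in R_0$ if and only if $[X_\alpha]$ has colour $0$, and $\alpha\in R_1$ if and only if $[X_\alpha]$ has colour $1$; (c) the roots, as elements of $\mathbb Z^{n+m}$, satisfy the mesh relations of $\widehat\Gamma$: if $\rho(x)$ denotes the root corresponding to the vertex $x$, then $\rho(i,k)+\rho(i,k+2)=\sum_{j}\rho(j,k+1)$, the sum being over the vertices $j$ of $\Gamma$ adjacent to $i$. -/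

import Mathlib

open CategoryTheory CategoryTheory.Limits
open scoped DirectSum

universe u v

namespace SuperQuiver

noncomputable section

/-! ## Coloured quivers -/

/-- An orientation of a graph: each edge becomes an arrow in exactly one of its two directions. -/
structure QuiverOrientation {V : Type} (Γ : SimpleGraph V) where
  arrow : V → V → Prop
  adj_iff : ∀ i j, Γ.Adj i j ↔ arrow i j ∨ arrow j i
  asymm : ∀ i j, arrow i j → ¬ arrow j i

/-- A coloured quiver `(Γ_col, Ω)` on the graph `Γ`: an orientation of `Γ` and a parity
(`0` even, `1` odd) for each vertex. -/
structure ColouredQuiver {V : Type} (Γ : SimpleGraph V) extends QuiverOrientation Γ where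
  colour : V → ZMod 2

section Quivers

variable {V : Type} {Γ : SimpleGraph V}

/-- `i` is a sink: no arrow starts at `i`. -/
def ColouredQuiver.IsSink (D : ColouredQuiver Γ) (i : V) : Prop := ∀ j, ¬ D.arrow i j

open Classical in
/-- The coloured quiver `(s_i Γ_col, s_i Ω)`: all arrows at `i` are reversed, and if `i` is odd,
then the colours of all vertices adjacent to `i` are changed. -/
def ColouredQuiver.reflect (D : ColouredQuiver Γ) (i : V) : ColouredQuiver Γ where
  arrow j k := if j = i ∨ k = i then D.arrow k j else D.arrow j k
  adj_iff j k := by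
    by_cases h : j = i ∨ k = i
    · simp only [h, h.symm, if_true]; rw [Γ.adj_comm]; exact D.adj_iff k j
    · have h' : ¬ (k = i ∨ j = i) := fun h'' => h h''.symm
      simp only [h, h', if_false]; exact D.adj_iff j k
  asymm j k := by
    by_cases h : j = i ∨ k = i
    · simp only [h, h.symm, if_true]; exact D.asymm k j
    · have h' : ¬ (k = i ∨ j = i) := fun h'' => h h''.symm
      simp only [h, h', if_false]; exact D.asymm j k
  colour j := if Γ.Adj i j then D.colour j + D.colour i else D.colour j

/-- The word `i₁, …, i_l` is adapted to the orientation: `i_k` is a sink for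
`s_{i_{k-1}} ⋯ s_{i_1} Ω`, for every `k`. -/
def IsAdapted : ColouredQuiver Γ → List V → Prop
  | _, [] => True
  | D, i :: w => D.IsSink i ∧ IsAdapted (D.reflect i) w

end Quivers

/-! ## Super vector spaces -/

/-- A finite dimensional `ℤ/2`-graded vector space `V = V₀ ⊕ V₁`. -/
structure SVect (K : Type u) [Field K] where
  carrier : Type u
  [addCommGroup : AddCommGroup carrier]
  [module : Module K carrier]
  [finite : Module.Finite K carrier]
  gr : ZMod 2 → Submodule K carrier
  isCompl : IsCompl (gr 0) (gr 1)

namespace SVect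

variable {K : Type u} [Field K]

instance : CoeSort (SVect K) (Type u) := ⟨SVect.carrier⟩
instance (A : SVect K) : AddCommGroup A := A.addCommGroup
instance (A : SVect K) : Module K A := A.module
instance (A : SVect K) : Module.Finite K A := A.finite

/-- `f` is homogeneous of degree `d`. -/
def IsHomogeneous {A B : SVect K} (d : ZMod 2) (f : A →ₗ[K] B) : Prop :=
  ∀ q, ∀ x ∈ A.gr q, f x ∈ B.gr (q + d)

lemma exists_decomp (A : SVect K) (x : A) : ∃ y ∈ A.gr 0, ∃ z ∈ A.gr 1, y + z = x :=
  Submodule.mem_sup.1 (A.isCompl.sup_eq_top ▸ Submodule.mem_top)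

/-- The parity change functor applied `c` times, `P^c`; the underlying vector space is the same. -/
def shift (c : ZMod 2) (A : SVect K) : SVect K where
  carrier := A
  gr q := A.gr (q + c)
  isCompl := by
    fin_cases c
    · exact A.isCompl
    · exact A.isCompl.symm

/-- The zero super vector space. -/
def zero (K : Type u) [Field K] : SVect K where
  carrier := PUnit
  gr _ := ⊥
  isCompl := ⟨disjoint_bot_left, by
    rw [codisjoint_iff]; exact Subsingleton.elim _ _⟩

lemma isCompl_ite {M : Type u} [AddCommGroup M] [Module K M] (p : ZMod 2) :
    IsCompl (if (0 : ZMod 2) = p then (⊤ : Submodule K M) else ⊥)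
      (if (1 : ZMod 2) = p then (⊤ : Submodule K M) else ⊥) := by
  fin_cases p
  · exact isCompl_top_bot
  · exact isCompl_bot_top

/-- The one-dimensional super vector space of parity `p`: `K^{1|0}` or `K^{0|1}`. -/
def line (K : Type u) [Field K] (p : ZMod 2) : SVect K where
  carrier := K
  gr q := if q = p then ⊤ else ⊥
  isCompl := isCompl_ite p

/-- The direct sum of a finite family of super vector spaces. -/
def pi {ι : Type} [Finite ι] (A : ι → SVect K) : SVect K where
  carrier := ∀ i, A i
  gr q := Submodule.pi Set.univ (fun i => (A i).gr q)
  isCompl := by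
    refine ⟨?_, ?_⟩
    · rw [Submodule.disjoint_def]
      intro x h0 h1
      funext i
      exact (Submodule.disjoint_def.1 (A i).isCompl.disjoint) _ (h0 i trivial) (h1 i trivial)
    · rw [codisjoint_iff, eq_top_iff]
      intro x _
      choose y hy z hz hyz using fun i => (A i).exists_decomp (x i)
      exact Submodule.mem_sup.2 ⟨y, fun i _ => hy i, z, fun i _ => hz i, funext hyz⟩

open Classical in
/-- The inclusion of a summand. -/
def single {ι : Type} [Finite ι] (A : ι → SVect K) (i : ι) : A i →ₗ[K] pi A :=
  LinearMap.single K (fun i => ↥(A i)) i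

lemma single_even {ι : Type} [Finite ι] (A : ι → SVect K) (i : ι) (q : ZMod 2) (x : A i)
    (hx : x ∈ (A i).gr q) : single A i x ∈ (pi A).gr q := by
  classical
  rintro j -
  change Pi.single (M := fun i => ↥(A i)) i x j ∈ (A j).gr q
  by_cases h : j = i
  · subst h; rwa [Pi.single_eq_same]
  · rw [Pi.single_eq_of_ne h]; exact zero_mem _

/-- The cokernel of an even map, with the quotient grading. -/
def coker {A B : SVect K} (f : A →ₗ[K] B) (hf : IsHomogeneous 0 f) : SVect K where
  carrier := B ⧸ LinearMap.range f
  gr q := (B.gr q).map (LinearMap.range f).mkQ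
  isCompl := by
    refine ⟨?_, ?_⟩
    · rw [Submodule.disjoint_def]
      rintro _ ⟨b, hb, rfl⟩ ⟨c, hc, hbc⟩
      obtain ⟨x, hx⟩ := (Submodule.Quotient.eq _).1 hbc.symm
      obtain ⟨y, hy, z, hz, rfl⟩ := A.exists_decomp x
      have hy' := hf 0 y hy
      have hz' := hf 1 z hz
      simp only [add_zero] at hy' hz'
      have h : b - f y = f z + c := by
        rw [map_add] at hx
        rw [sub_eq_iff_eq_add, add_right_comm, ← sub_eq_iff_eq_add, ← hx, add_comm]
      have h0 : b - f y = 0 := Submodule.disjoint_def.1 B.isCompl.disjoint _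
        (sub_mem hb hy') (h ▸ add_mem hz' hc)
      exact (Submodule.Quotient.mk_eq_zero _).2 ⟨y, (sub_eq_zero.1 h0).symm⟩
    · rw [codisjoint_iff, ← Submodule.map_sup, B.isCompl.sup_eq_top, Submodule.map_top,
        Submodule.range_mkQ]

/-- The projection to the cokernel. -/
def quot {A B : SVect K} (f : A →ₗ[K] B) (hf : IsHomogeneous 0 f) : B →ₗ[K] coker f hf :=
  (LinearMap.range f).mkQ

open Classical in
/-- The parity of a purely even or purely odd space: `1` if it is odd and nonzero. -/
def parity (A : SVect K) : ZMod 2 := if A.gr 1 = ⊥ then 0 else 1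

/-- The identity between two equal super vector spaces. -/
def castEquiv {A B : SVect K} (h : A = B) : A ≃ₗ[K] B := by
  subst h; exact LinearEquiv.refl K A

lemma castEquiv_mem {A B : SVect K} (h : A = B) {q : ZMod 2} {x : A} :
    castEquiv h x ∈ B.gr q ↔ x ∈ A.gr q := by
  subst h; exact Iff.rfl

/-- The identity of the vector space underlying `A` and `P^c A`. -/
def shiftEquiv (c : ZMod 2) (A : SVect K) : A.shift c ≃ₗ[K] A := LinearEquiv.refl K A

end SVect

/-! ## Super-representations -/

variable (K : Type u) [Field K]

/-- A super-representation of a coloured quiver: a super vector space `X(i)` at each vertex and,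
for each arrow `i → j`, a homogeneous linear map `X(i) → X(j)` of degree `p(i) + p(j)`. -/
structure SRep {V : Type} {Γ : SimpleGraph V} (D : ColouredQuiver Γ) where
  obj : V → SVect K
  map : ∀ {i j : V}, D.arrow i j → (obj i →ₗ[K] obj j)
  map_degree : ∀ {i j : V} (a : D.arrow i j),
    SVect.IsHomogeneous (D.colour i + D.colour j) (map a)

section Category

variable {K} {V : Type} {Γ : SimpleGraph V} {D : ColouredQuiver Γ}

/-- Families of linear maps that commute with the structure maps. They need not be even. Every such
family is a sum of two such families consisting of homogeneous maps (its components of degree `0`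
and `1`), so this is the additive group generated by the homogeneous families. -/
def SRep.homs (X Y : SRep K D) : Submodule K (∀ i, X.obj i →ₗ[K] Y.obj i) where
  carrier := {φ | ∀ {i j : V} (a : D.arrow i j), φ j ∘ₗ X.map a = Y.map a ∘ₗ φ i}
  add_mem' := by
    intro φ ψ hφ hψ i j a
    simp only [Pi.add_apply, LinearMap.add_comp, LinearMap.comp_add, hφ a, hψ a]
  zero_mem' := by
    intro i j a
    simp
  smul_mem' := by
    intro c φ hφ i j a
    simp only [Pi.smul_apply, LinearMap.smul_comp, LinearMap.comp_smul, hφ a]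

/-- The category of super-representations. -/
instance : Category (SRep K D) where
  Hom X Y := SRep.homs X Y
  id X := ⟨fun _ => LinearMap.id, fun _ => rfl⟩
  comp φ ψ := ⟨fun i => ψ.1 i ∘ₗ φ.1 i, fun a => by
    rw [LinearMap.comp_assoc, φ.2 a, ← LinearMap.comp_assoc, ψ.2 a, LinearMap.comp_assoc]⟩

instance : Preadditive (SRep K D) where
  homGroup X Y := inferInstanceAs (AddCommGroup (SRep.homs X Y))
  add_comp _ _ _ f g h := Subtype.ext (funext fun i => LinearMap.comp_add (f.1 i) (g.1 i) (h.1 i))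
  comp_add _ _ _ f g h := Subtype.ext (funext fun i => LinearMap.add_comp (f.1 i) (h.1 i) (g.1 i))

/-- The vertex set of a coloured quiver, as a quiver in the sense of category theory. -/
def ColouredQuiver.Vertex (_ : ColouredQuiver Γ) : Type := V

instance : Quiver.{0} D.Vertex := ⟨fun i j => PLift (D.arrow i j)⟩

variable (K D) in
/-- Forgetting the gradings: super-representations to representations (functors on paths). -/
def SRep.forget : SRep K D ⥤ (Paths D.Vertex ⥤ FGModuleCat.{u} K) where
  obj X := Paths.lift
    { obj := fun i => FGModuleCat.of K (X.obj i)
      map := fun a => FGModuleCat.ofHom (X.map a.down) }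
  map {X Y} φ := Paths.liftNatTrans (fun i => FGModuleCat.ofHom (φ.1 i)) (by
    intro i j a
    rw [Paths.lift_toPath, Paths.lift_toPath]
    exact FGModuleCat.hom_ext (φ.2 a.down))
  map_id X := by
    ext i : 2
    rfl
  map_comp φ ψ := by
    ext i : 2
    rfl

instance : (SRep.forget K D).Faithful where
  map_injective h := Subtype.ext (funext fun i =>
    congrArg (fun t => (t.app i).hom.hom) h)

instance : (SRep.forget K D).Full where
  map_surjective {X Y} t := by
    refine ⟨⟨fun i => (t.app i).hom.hom, fun {i j} a => ?_⟩, ?_⟩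
    · have h := t.naturality (X := i) (Y := j)
        (Quiver.Hom.toPath (V := D.Vertex) (a := i) (b := j) ⟨a⟩)
      simp only [SRep.forget] at h
      exact congrArg (fun s => s.hom.hom) h
    · ext i : 2
      rfl

/-- A representation, graded by the colours of the vertices. -/
def SRep.ofRep (G : Paths D.Vertex ⥤ FGModuleCat.{u} K) : SRep K D where
  obj i :=
    { carrier := G.obj i
      gr := fun q => if q = D.colour i then ⊤ else ⊥
      isCompl := SVect.isCompl_ite (D.colour i) }
  map {i j} a := (G.map (Quiver.Hom.toPath (V := D.Vertex) (a := i) (b := j) ⟨a⟩)).hom.hom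
  map_degree {i j} a q x hx := by
    by_cases h : q = D.colour i
    · subst h
      have : D.colour i + (D.colour i + D.colour j) = D.colour j := by
        rw [← add_assoc, CharTwo.add_self_eq_zero, zero_add]
      simp [this]
    · simp only [h, if_false, Submodule.mem_bot] at hx
      subst hx
      rw [map_zero]
      exact zero_mem _

instance : (SRep.forget K D).EssSurj where
  mem_essImage G := ⟨SRep.ofRep G, ⟨eqToIso (Paths.lift_unique _ G rfl).symm⟩⟩

instance : (SRep.forget K D).IsEquivalence where

instance : Abelian (SRep K D) :=
  have : HasFiniteProducts (SRep K D) :=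
    ⟨fun _ => Adjunction.hasLimitsOfShape_of_equivalence (SRep.forget K D)⟩
  abelianOfEquivalence (SRep.forget K D)

instance : HasDerivedCategory.{u + 1} (SRep K D) := HasDerivedCategory.standard _

end Category
/-! ## Reflection functors on objects and the objects `X_α` -/

section Reflection

variable {K} {V : Type} {Γ : SimpleGraph V}

/-- The zero super-representation. -/
def SRep.zero (D : ColouredQuiver Γ) : SRep K D where
  obj _ := SVect.zero K
  map _ := 0
  map_degree _ _ _ _ := zero_mem _

open Classical in
variable (K) in
/-- The simple object `𝕊_i^p`: one-dimensional of parity `p` at `i`, and zero elsewhere. -/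
def SRep.simple (D : ColouredQuiver Γ) (i : V) (p : ZMod 2) : SRep K D where
  obj j := if j = i then SVect.line K p else SVect.zero K
  map _ := 0
  map_degree _ _ _ _ := zero_mem _

lemma ColouredQuiver.ne_of_arrow {D : ColouredQuiver Γ} {j k : V} (a : D.arrow j k) : j ≠ k := by
  rintro rfl; exact D.asymm j j a a

lemma ColouredQuiver.arrow_reflect_self {D : ColouredQuiver Γ} {i j k : V} (a : D.arrow j k)
    (hk : k = i) : (D.reflect i).arrow i j := by
  subst hk; simpa [ColouredQuiver.reflect] using a

lemma ColouredQuiver.arrow_reflect_of_ne {D : ColouredQuiver Γ} {i j k : V} (a : D.arrow j k)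
    (hj : j ≠ i) (hk : k ≠ i) : (D.reflect i).arrow j k := by
  simpa [ColouredQuiver.reflect, hj, hk] using a

variable [Finite V]

/-- For a super-representation `X` of `s_i D`: the summands of `⨁ X(k)`, over the arrows `i → k` of
`s_i D` (equivalently, the arrows `k → i` of `D`), where the summand `X(k)` is parity shifted by
`p(i) + p(k)`. -/
def SRep.summand {D : ColouredQuiver Γ} {i : V} (X : SRep K (D.reflect i))
    (k : {k // (D.reflect i).arrow i k}) : SVect K :=
  (X.obj k).shift ((D.reflect i).colour i + (D.reflect i).colour k)

/-- For a super-representation `X` of `s_i D`: the map `X(i) → ⨁ X(k)`, which is even by the choice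
of the parity shifts. -/
def SRep.outMap {D : ColouredQuiver Γ} {i : V} (X : SRep K (D.reflect i)) :
    X.obj i →ₗ[K] SVect.pi X.summand :=
  LinearMap.pi (fun k => X.map k.2)

lemma SRep.outMap_even {D : ColouredQuiver Γ} {i : V} (X : SRep K (D.reflect i)) :
    SVect.IsHomogeneous 0 X.outMap := by
  intro q x hx k _
  rw [add_zero]
  exact X.map_degree k.2 q x hx

open Classical in
/-- The spaces of the reflected super-representation: the cokernel of `X(i) → ⨁ X(k)` at `i`, the
parity change `P^{p(i)} X(k)` at the vertices `k` adjacent to `i`, and `X(k)` elsewhere. -/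
def SRep.reflectObj {D : ColouredQuiver Γ} {i : V} (X : SRep K (D.reflect i)) (j : V) : SVect K :=
  if j = i then SVect.coker X.outMap X.outMap_even
  else if Γ.Adj i j then (X.obj j).shift (D.colour i)
  else X.obj j

lemma SRep.reflectObj_self {D : ColouredQuiver Γ} {i : V} (X : SRep K (D.reflect i)) :
    X.reflectObj i = SVect.coker X.outMap X.outMap_even := if_pos rfl

open Classical in
/-- For `j ≠ i`, the vector space at `j` is not changed, only (possibly) its grading. -/
def SRep.reflectEquiv {D : ColouredQuiver Γ} {i : V} (X : SRep K (D.reflect i)) {j : V}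
    (hj : j ≠ i) : X.reflectObj j ≃ₗ[K] X.obj j :=
  if h : Γ.Adj i j then
    (SVect.castEquiv (by rw [SRep.reflectObj, if_neg hj, if_pos h])).trans
      (SVect.shiftEquiv (D.colour i) (X.obj j))
  else SVect.castEquiv (by rw [SRep.reflectObj, if_neg hj, if_neg h])

open Classical in
lemma SRep.reflectEquiv_mem {D : ColouredQuiver Γ} {i : V} (X : SRep K (D.reflect i)) {j : V}
    (hj : j ≠ i) {q : ZMod 2} {x : X.reflectObj j} :
    X.reflectEquiv hj x ∈ (X.obj j).gr (q + if Γ.Adj i j then D.colour i else 0) ↔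
      x ∈ (X.reflectObj j).gr q := by
  by_cases h : Γ.Adj i j
  · rw [SRep.reflectEquiv, dif_pos h, if_pos h]
    exact SVect.castEquiv_mem (B := (X.obj j).shift (D.colour i)) _
  · rw [SRep.reflectEquiv, dif_neg h, if_neg h, add_zero]
    exact SVect.castEquiv_mem _

open Classical in
/-- The reflection functor at a sink `i` of `D` (hence a source of `s_i D`), on objects; it takes
super-representations of `s_i D` to super-representations of `D = s_i (s_i D)`. The maps
`X(j) → coker` are the components of the quotient map, and the maps at the arrows away from `i` are
not changed. (No arrow of `D` starts at `i` when `i` is a sink, so the zero below is not used.) -/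
def SRep.reflection {D : ColouredQuiver Γ} (i : V) (X : SRep K (D.reflect i)) : SRep K D where
  obj := X.reflectObj
  map {j k} a :=
    if hk : k = i then
      (SVect.castEquiv (hk ▸ X.reflectObj_self :
        X.reflectObj k = SVect.coker X.outMap X.outMap_even)).symm.toLinearMap ∘ₗ
      SVect.quot X.outMap X.outMap_even ∘ₗ
      SVect.single X.summand ⟨j, ColouredQuiver.arrow_reflect_self a hk⟩ ∘ₗ
      (SVect.shiftEquiv _ (X.obj j)).symm.toLinearMap ∘ₗ
      (X.reflectEquiv (hk ▸ ColouredQuiver.ne_of_arrow a)).toLinearMap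
    else if hj : j = i then 0
    else (X.reflectEquiv hk).symm.toLinearMap ∘ₗ
      X.map (ColouredQuiver.arrow_reflect_of_ne a hj hk) ∘ₗ (X.reflectEquiv hj).toLinearMap
  map_degree {j k} a q x hx := by
    by_cases hk : k = i
    · subst hk
      have hj := ColouredQuiver.ne_of_arrow a
      have hadj : Γ.Adj k j := ((D.adj_iff j k).2 (Or.inl a)).symm
      rw [dif_pos rfl]
      have hx' := (X.reflectEquiv_mem hj).2 hx
      rw [if_pos hadj] at hx'
      rw [← SVect.castEquiv_mem X.reflectObj_self]
      simp only [LinearMap.comp_apply, LinearEquiv.coe_coe, LinearEquiv.apply_symm_apply]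
      refine ⟨_, SVect.single_even X.summand _ _ _ ?_, rfl⟩
      change X.reflectEquiv hj x ∈ (X.obj j).gr
        (q + (D.colour j + D.colour k) + ((D.reflect k).colour k + (D.reflect k).colour j))
      have e : q + (D.colour j + D.colour k) + ((D.reflect k).colour k + (D.reflect k).colour j) =
          q + D.colour k := by
        simp only [ColouredQuiver.reflect, hadj, SimpleGraph.irrefl, if_true, if_false]
        generalize D.colour j = c
        generalize D.colour k = d
        clear hx' hx
        revert q c d; decide
      rw [e]; exact hx'
    · rw [dif_neg hk]
      by_cases hj : j = i
      · rw [dif_pos hj]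
        exact zero_mem _
      · rw [dif_neg hj, ← X.reflectEquiv_mem hk]
        simp only [LinearMap.comp_apply, LinearEquiv.coe_coe, LinearEquiv.apply_symm_apply]
        have hx' := X.map_degree (ColouredQuiver.arrow_reflect_of_ne a hj hk) _ _
          ((X.reflectEquiv_mem hj).2 hx)
        convert hx' using 2
        simp only [ColouredQuiver.reflect]
        generalize D.colour j = c
        generalize D.colour k = d
        generalize D.colour i = e
        split_ifs <;> (clear hx' hx; revert q c d e; decide)

/-- The object `S̃_{i₁} S̃_{i₂} ⋯ S̃_{i_r} (𝕊_i^p)` of `SRep(D)`, where `w = (i₁, …, i_r)` and `p` is the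
parity of the vertex `i` in `s_{i_r} ⋯ s_{i_1} D`. -/
def SRep.ofWord (K : Type u) [Field K] : (D : ColouredQuiver Γ) → (w : List V) → V → SRep K D
  | D, [], i => SRep.simple K D i (D.colour i)
  | D, i₁ :: w, i => SRep.reflection i₁ (SRep.ofWord K (D.reflect i₁) w i)

/-- Every space `X(i)` is purely even or purely odd. -/
def SRep.IsPure {D : ColouredQuiver Γ} (X : SRep K D) : Prop :=
  ∀ i, (X.obj i).gr 0 = ⊥ ∨ (X.obj i).gr 1 = ⊥

/-- The parity `p(X) = ∑ p(X(i))`, meaningful when every `X(i)` is purely even or purely odd. -/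
def SRep.parity {V : Type} [Fintype V] {Γ : SimpleGraph V} {D : ColouredQuiver Γ}
    (X : SRep K D) : ZMod 2 := ∑ i, (X.obj i).parity

end Reflection

/-! ## The 2-periodic orbit category -/

section Orbit

/-- The orbit category `C/T²` of a category with a shift `T`: the objects are those of `C`. -/
structure Orbit (C : Type u) where
  as : C

variable {C : Type u} [Category.{v} C] [Preadditive C] [HasShift C ℤ]

/-- The morphisms `X → Y` of `C/T²`: the direct sum of the groups `Hom_C(X, T^{2k} Y)`, `k ∈ ℤ`. -/
abbrev Orbit.Hom (X Y : Orbit C) : Type v := ⨁ k : ℤ, ShiftedHom X.as Y.as (2 * k)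

variable [∀ n : ℤ, (shiftFunctor C n).Additive]

/-- The composition in `C/T²`: biadditive, and `(f, g) ↦ T^{2k}(g) ∘ f` for `f : X → T^{2k} Y` and
`g : Y → T^{2l} Z`. -/
def Orbit.comp {X Y Z : Orbit C} : Orbit.Hom X Y →+ Orbit.Hom Y Z →+ Orbit.Hom X Z :=
  DirectSum.toAddMonoid fun k => AddMonoidHom.flip <| DirectSum.toAddMonoid fun l =>
    AddMonoidHom.mk' (fun g => AddMonoidHom.mk' (fun f =>
      DirectSum.of (fun k : ℤ => ShiftedHom X.as Z.as (2 * k)) (l + k)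
        (ShiftedHom.comp f g (by ring)))
      (by intro f f'; rw [ShiftedHom.add_comp, map_add]))
      (by intro g g'; ext f; simp [ShiftedHom.comp_add])

lemma Orbit.comp_of {X Y Z : Orbit C} {k l : ℤ} (f : ShiftedHom X.as Y.as (2 * k))
    (g : ShiftedHom Y.as Z.as (2 * l)) {r : ℤ} (hr : l + k = r) :
    Orbit.comp (DirectSum.of (fun k : ℤ => ShiftedHom X.as Y.as (2 * k)) k f)
      (DirectSum.of (fun k : ℤ => ShiftedHom Y.as Z.as (2 * k)) l g) =
    DirectSum.of (fun k : ℤ => ShiftedHom X.as Z.as (2 * k)) r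
      (ShiftedHom.comp f g (by rw [← hr]; ring)) := by
  subst hr
  simp [Orbit.comp]

lemma Orbit.comp_add_left {X Y Z : Orbit C} (f f' : Orbit.Hom X Y) (g : Orbit.Hom Y Z) :
    Orbit.comp (f + f') g = Orbit.comp f g + Orbit.comp f' g := by
  rw [map_add, AddMonoidHom.add_apply]

lemma Orbit.comp_add_right {X Y Z : Orbit C} (f : Orbit.Hom X Y) (g g' : Orbit.Hom Y Z) :
    Orbit.comp f (g + g') = Orbit.comp f g + Orbit.comp f g' := map_add _ _ _

instance : Category (Orbit C) where
  Hom X Y := Orbit.Hom X Y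
  id X := DirectSum.of (fun k : ℤ => ShiftedHom X.as X.as (2 * k)) 0
    (ShiftedHom.mk₀ (2 * 0) (mul_zero 2) (𝟙 X.as))
  comp f g := Orbit.comp f g
  id_comp {X Y} f := by
    induction f using DirectSum.induction_on with
    | zero => simp
    | of k f => rw [Orbit.comp_of _ _ (add_zero k)]; simp
    | add f g hf hg => rw [map_add, hf, hg]
  comp_id {X Y} f := by
    induction f using DirectSum.induction_on with
    | zero => simp
    | of k f => rw [Orbit.comp_of _ _ (zero_add k)]; simp
    | add f g hf hg => rw [map_add, AddMonoidHom.add_apply, hf, hg]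
  assoc {W X Y Z} f g h := by
    induction f using DirectSum.induction_on with
    | zero => simp
    | add f f' hf hf' => simp only [map_add, AddMonoidHom.add_apply, hf, hf']
    | of k f =>
      induction g using DirectSum.induction_on with
      | zero => simp
      | add g g' hg hg' => simp only [map_add, AddMonoidHom.add_apply, hg, hg']
      | of l g =>
        induction h using DirectSum.induction_on with
        | zero => simp
        | add h h' hh hh' => simp only [map_add, hh, hh']
        | of m h =>
          rw [Orbit.comp_of f g rfl, Orbit.comp_of g h rfl, Orbit.comp_of _ _ (add_assoc m l k).symm,
            Orbit.comp_of _ _ rfl]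
          rw [ShiftedHom.comp_assoc]
          ring

instance : Preadditive (Orbit C) where
  homGroup X Y := (inferInstance : AddCommGroup (Orbit.Hom X Y))
  add_comp _ _ _ f f' g := Orbit.comp_add_left f f' g
  comp_add _ _ _ f g g' := Orbit.comp_add_right f g g'

end Orbit

/-! ## Auslander–Reiten quivers -/

section AuslanderReiten

variable {C : Type u} [Category.{v} C] [Preadditive C]

/-- `X` is indecomposable: it is nonzero, and in every decomposition `X ≅ Y ⊕ Z` one of the two
summands is zero. -/
def IsIndecomposable (X : C) : Prop :=
  ¬ IsZero X ∧ ∀ (Y Z : C) (b : BinaryBicone Y Z), b.IsBilimit → (b.pt ≅ X) → IsZero Y ∨ IsZero Z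

/-- An irreducible morphism: neither a split monomorphism nor a split epimorphism, and in every
factorization the first factor is a split monomorphism or the second is a split epimorphism. -/
def IsIrreducibleHom {X Y : C} (f : X ⟶ Y) : Prop :=
  ¬ IsSplitMono f ∧ ¬ IsSplitEpi f ∧
    ∀ (Z : C) (g : X ⟶ Z) (h : Z ⟶ Y), g ≫ h = f → IsSplitMono g ∨ IsSplitEpi h

variable (C) in
/-- Isomorphism of indecomposable objects. -/
def indecSetoid : Setoid {X : C // IsIndecomposable X} where
  r X Y := Nonempty (X.1 ≅ Y.1)
  iseqv := ⟨fun _ => ⟨Iso.refl _⟩, fun ⟨e⟩ => ⟨e.symm⟩, fun ⟨e⟩ ⟨e'⟩ => ⟨e.trans e'⟩⟩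

variable (C) in
/-- The vertices of the Auslander–Reiten quiver: isomorphism classes of indecomposable objects. -/
def ARVertex : Type _ := Quotient (indecSetoid C)

/-- The isomorphism class `[X]` of an indecomposable object. -/
def ARVertex.mk (X : C) (hX : IsIndecomposable X) : ARVertex C :=
  Quotient.mk (indecSetoid C) ⟨X, hX⟩

/-- The arrows of the Auslander–Reiten quiver: there is an arrow `[X] → [Y]` if there is an
irreducible morphism `X → Y`. -/
def ARArrow (x y : ARVertex C) : Prop :=
  ∃ (X Y : C) (hX : IsIndecomposable X) (hY : IsIndecomposable Y),
    ARVertex.mk X hX = x ∧ ARVertex.mk Y hY = y ∧ ∃ f : X ⟶ Y, IsIrreducibleHom f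

end AuslanderReiten

/-- The 2-periodic derived category `D^b(SRep(D)) / T²`. -/
abbrev RootCategory {V : Type} {Γ : SimpleGraph V} (D : ColouredQuiver Γ) : Type (u + 1) :=
  Orbit (DerivedCategory.Bounded (SRep K D))

variable {K} in
/-- A super-representation, as a complex concentrated in degree `0`. -/
def stalk {V : Type} {Γ : SimpleGraph V} {D : ColouredQuiver Γ} (X : SRep K D) :
    DerivedCategory.Bounded (SRep K D) :=
  ⟨(DerivedCategory.singleFunctor (SRep K D) 0).obj X,
    ⟨⟨0, inferInstance⟩, ⟨0, inferInstance⟩⟩⟩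

/-! ## The periodic quiver `Γ̂` -/

/-- The vertices `(i, k) ∈ Γ × ℤ/2h` of `Γ̂` with `k + ϖ(i) ≡ 0 mod 2`, where `ϖ` is a parity function
of the bipartite graph `Γ` (adjacent vertices have different parities). -/
def GammaHat {V : Type} {Γ : SimpleGraph V} (ϖ : Γ.Coloring (ZMod 2)) (h : ℕ) : Type :=
  {x : V × ZMod (2 * h) // ZMod.castHom (Dvd.intro h rfl) (ZMod 2) x.2 + ϖ x.1 = 0}

/-- The arrows `(i, k) → (j, k + 1)` of `Γ̂`, for `i` and `j` adjacent in `Γ`. -/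
def GammaHat.Arrow {V : Type} {Γ : SimpleGraph V} {ϖ : Γ.Coloring (ZMod 2)} {h : ℕ}
    (x y : GammaHat ϖ h) : Prop :=
  Γ.Adj x.1.1 y.1.1 ∧ y.1.2 = x.1.2 + 1

/-! ## The root system `A(n,m)` -/

section Roots

variable (n m : ℕ)

/-- The lattice spanned by `ε₁, …, ε_n` (`Sum.inl`) and `δ₁, …, δ_m` (`Sum.inr`). -/
abbrev Lattice : Type := Fin n ⊕ Fin m → ℤ

variable {n m}

/-- The basis vectors of the lattice: `basisVec (inl i) = ε_i` and `basisVec (inr j) = δ_j`. -/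
def basisVec (a : Fin n ⊕ Fin m) : Lattice n m := Pi.single a 1

variable (n m)

/-- The even roots `ε_i - ε_j` and `δ_i - δ_j`, `i ≠ j`. -/
def evenRoots : Set (Lattice n m) :=
  {v | ∃ i j : Fin n, i ≠ j ∧ v = basisVec (.inl i) - basisVec (.inl j)} ∪
  {v | ∃ i j : Fin m, i ≠ j ∧ v = basisVec (.inr i) - basisVec (.inr j)}

/-- The odd roots `±(ε_i - δ_j)`. -/
def oddRoots : Set (Lattice n m) :=
  {v | ∃ (i : Fin n) (j : Fin m), v = basisVec (.inl i) - basisVec (.inr j) ∨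
    v = -(basisVec (.inl i) - basisVec (.inr j))}

/-- The root system `A(n,m)`. -/
def roots : Set (Lattice n m) := evenRoots n m ∪ oddRoots n m

variable {n m}

/-- The simple system attached to an ordering `σ` of the `ε`'s and `δ`'s: `α_i` is the difference of
the `i`-th and the `(i+1)`-st of them. -/
def simpleRoot (σ : Fin (n + m) ≃ Fin n ⊕ Fin m) (i : Fin (n + m - 1)) : Lattice n m :=
  basisVec (σ ⟨i, by omega⟩) - basisVec (σ ⟨i + 1, by omega⟩)

variable (σ : Fin (n + m) ≃ Fin n ⊕ Fin m)

/-- A positive root: a root that is a combination of simple roots with coefficients in `ℕ`. -/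
def IsPositiveRoot (α : Lattice n m) : Prop :=
  α ∈ roots n m ∧ ∃ c : Fin (n + m - 1) → ℕ, α = ∑ i, c i • simpleRoot σ i

/-- The Dynkin graph: two simple roots are joined if they are not orthogonal, for the form of the
root system `A_{n+m-1}` obtained by forgetting parities. -/
def dynkinGraph : SimpleGraph (Fin (n + m - 1)) where
  Adj i j := i ≠ j ∧ simpleRoot σ i ⬝ᵥ simpleRoot σ j ≠ 0
  symm := ⟨fun i j h => ⟨h.1.symm, by rw [dotProduct_comm]; exact h.2⟩⟩
  loopless := ⟨fun _ h => h.1 rfl⟩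

open Classical in
/-- The coloured Dynkin quiver `(Γ_col, Ω)`: the vertex `i` is odd if `α_i` is an odd root. -/
def dynkinQuiver (Ω : QuiverOrientation (dynkinGraph σ)) : ColouredQuiver (dynkinGraph σ) where
  toQuiverOrientation := Ω
  colour i := if simpleRoot σ i ∈ oddRoots n m then 1 else 0

/-- The simple reflection `s_i` of the Weyl group of `A_{n+m-1}`. -/
def simpleReflection (i : Fin (n + m - 1)) : Module.End ℤ (Lattice n m) where
  toFun v := v - (v ⬝ᵥ simpleRoot σ i) • simpleRoot σ i
  map_add' v w := by rw [add_dotProduct, add_smul]; abel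
  map_smul' c v := by
    rw [smul_dotProduct, RingHom.id_apply, smul_sub, smul_assoc]

/-- The element `s_{i_1} ⋯ s_{i_l}` of the Weyl group. -/
def wordProd (w : List (Fin (n + m - 1))) : Module.End ℤ (Lattice n m) :=
  (w.map (simpleReflection σ)).prod

/-- A reduced expression of an element of the Weyl group. -/
def IsReducedWord (w : List (Fin (n + m - 1))) : Prop :=
  ∀ w', wordProd σ w' = wordProd σ w → w.length ≤ w'.length

/-- A reduced expression of the longest element `w₀` of the Weyl group. -/
def IsReducedLongestWord (w : List (Fin (n + m - 1))) : Prop :=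
  IsReducedWord σ w ∧ ∀ w', IsReducedWord σ w' → w'.length ≤ w.length

/-- The root `γ_j = s_{i_1} ⋯ s_{i_{j-1}} α_{i_j}`. -/
def gammaRoot (w : List (Fin (n + m - 1))) (j : Fin w.length) : Lattice n m :=
  wordProd σ (w.take j) (simpleRoot σ (w.get j))

variable {σ}

open Classical in
/-- For a positive root `α = γ_j`, the super-representation
`X_α = S̃_{i_1} ⋯ S̃_{i_{j-1}} (𝕊_{i_j}^{p_j})`; for a negative root `α`, the super-representation
`X_{-α}`. (The value `0` is taken if neither `α` nor `-α` is one of the `γ_j`.) -/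
def superRep (Ω : QuiverOrientation (dynkinGraph σ)) (w : List (Fin (n + m - 1)))
    (α : Lattice n m) : SRep K (dynkinQuiver σ Ω) :=
  if h : ∃ j, gammaRoot σ w j = α ∨ gammaRoot σ w j = -α then
    SRep.ofWord K (dynkinQuiver σ Ω) (w.take h.choose) (w.get h.choose)
  else SRep.zero _

open Classical in
/-- The object of `D^b(SRep)/T²` attached to a root: `X_α` if `α` is positive, and `T X_{-α}` if `α`
is negative. -/
def rootObject (Ω : QuiverOrientation (dynkinGraph σ)) (w : List (Fin (n + m - 1)))
    (α : Lattice n m) : RootCategory K (dynkinQuiver σ Ω) :=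
  if IsPositiveRoot σ α then ⟨stalk (superRep K Ω w α)⟩
  else ⟨(stalk (superRep K Ω w α))⟦(1 : ℤ)⟧⟩

end Roots

end

end SuperQuiver

open SuperQuiver

/-! Morphisms ignore the gradings, so super-representations behave like ordinary representations of
a quiver of type A with `N - 1` vertices, where `N = n + m`. Write `e_p`, `0 ≤ p < N`, for the
ordered `ε`'s and `δ`'s. The indecomposable representations are the interval modules with support
`[a, b)`, `a < b` (`finSum_interval`), and `[a, b)` corresponds to the root `e_a - e_b`. The
category is hereditary (`hom_shift_eq_zero`), so every object of the bounded derived category is a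
sum of shifts of interval modules (`finSum_stalk`). In the orbit category the indecomposables are
therefore ordered pairs `(a, b)` of different points: the interval `[a, b)` if `a < b`, and the
translate of `[b, a)` otherwise. Translation exchanges `a` and `b`, as negation does for roots.

The orientation only enters through a cyclic order on the `N` points, given by `angle`: first come,
in increasing order, the points `p` without an arrow `p - 1 → p`, then, in decreasing order, those
with such an arrow. Computing `Hom` and `Ext¹` of interval modules by scalars shows that there is a
nonzero morphism from `(a, b)` to `(c, d)` exactly if `a ≤ c < b ≤ d < a` in this cyclic order, that
all of them are then proportional, and that nonzero morphisms compose to nonzero ones whenever the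
cyclic order permits it (`homZero_rootPair`, `homLine_rootPair`, `compNonzero_rootPair`). Such a
description of `Hom` determines the irreducible morphisms (`IsHomPoset.exists_irreducible_iff`):
they are those for which one end of the arc from `a` to `b` moves by one step. The arc of length `i
+ 1` that starts at the `p`-th point of the circle becomes the vertex `(i, 2p + i + 1 + c)` of the
periodic quiver. The root of an arc is a function of its start minus the same function of its end,
and for any such difference the mesh relations are a rearrangement of four terms (`mesh_relation`).

It remains to recognize the objects `X_α`. A reflection functor acts on dimension vectors by a
simple reflection, that is, it exchanges the points `i` and `i + 1` among the ends of an interval;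
so `X_α` is the interval module `[a, b)` if `α = e_a - e_b` (`isIntervalLike_ofWord`). That every
positive root occurs exactly once is the combinatorics of reduced words in the symmetric group. The
parity shifts in the reflection functor are such that each space stays in the parity of its vertex
(`SRep.IsColoured.reflection`). As the colour of the vertex `i` is the sum of the parities of the
points `i` and `i + 1`, the parity of `X_α` telescopes to the sum of the parities of `a` and `b`,
which is `1` exactly for the odd roots. -/

namespace SuperQuiver

/-! ### Effaceability of morphisms of positive degree -/

section Effaceability

universe w

variable {C : Type u} [Category.{v} C] [Abelian C]

open DerivedCategory HomologicalComplex Category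

/-- As `K` vanishes above degree `i`, its term in degree `i` consists of cycles, so it maps onto the
homology there, which `π` identifies with `X`. The same vanishing makes the identity of this term a
morphism of complexes from the single complex to `K`. -/
lemma exists_epi_to_singleFunctor_obj {X : C} {K : CochainComplex C ℤ} {i : ℤ}
    (π : K ⟶ (single C (ComplexShape.up ℤ) i).obj X) [K.IsStrictlyLE i] [QuasiIsoAt π i] :
    ∃ (p : K.X i ⟶ X) (s : (single C (ComplexShape.up ℤ) i).obj (K.X i) ⟶ K), Epi p ∧
      s ≫ π = (single C (ComplexShape.up ℤ) i).map p := by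
  let e := K.iCyclesIso i (i + 1) (by simp)
    ((K.isZero_of_isStrictlyLE i (i + 1) (by simp)).eq_of_tgt _ _)
  let α := e.inv ≫ K.homologyπ i ≫ homologyMap π i ≫ (singleObjHomologySelfIso _ _ _).hom
  have : π.f i = α ≫ (singleObjXSelf (ComplexShape.up ℤ) i X).inv := by
    rw [← cancel_epi e.hom]
    dsimp only [α]
    rw [assoc, assoc, assoc, e.hom_inv_id_assoc, homologyπ_naturality_assoc]
    change K.iCycles i ≫ _ = _
    rw [homologyπ_singleObjHomologySelfIso_hom_assoc,
      ← singleObjCyclesSelfIso_inv_iCycles, Iso.hom_inv_id_assoc, ← cyclesMap_i]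
  have hα : Epi α := by
    dsimp only [α]
    infer_instance
  refine ⟨α, mkHomFromSingle (𝟙 _) (by
      intro k hk
      obtain rfl : i + 1 = k := hk
      apply (K.isZero_of_isStrictlyLE i (i + 1) (by simp)).eq_of_tgt), hα, ?_⟩
  apply HomologicalComplex.from_single_hom_ext
  rw [comp_f, mkHomFromSingle_f, assoc, this, id_comp, single_map_f_self]

variable [HasDerivedCategory.{w} C]

/-- Write `φ` as a roof through a complex without terms above degree `i`. On the term of this
complex in degree `i` the second leg of the roof becomes a morphism into a complex that vanishes in
degree `i`. -/
lemma exists_epi_comp_eq_zero_of_isStrictlyLE {X : C} {L : CochainComplex C ℤ} {i : ℤ}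
    (φ : Q.obj ((CochainComplex.singleFunctor C i).obj X) ⟶ Q.obj L)
    (n : ℤ) (hn : n < i) [L.IsStrictlyLE n] :
    ∃ (X' : C) (p : X' ⟶ X), Epi p ∧
      Q.map ((CochainComplex.singleFunctor C i).map p) ≫ φ = 0 := by
  obtain ⟨K, _, π, h, g, rfl⟩ := right_fac_of_isStrictlyLE φ i
  rw [isIso_Q_map_iff_quasiIso] at h
  obtain ⟨p, s, hp, hs⟩ : ∃ (p : K.X i ⟶ X)
      (s : (CochainComplex.singleFunctor C i).obj (K.X i) ⟶ K), Epi p ∧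
      s ≫ π = (CochainComplex.singleFunctor C i).map p :=
    @exists_epi_to_singleFunctor_obj _ _ _ _ _ _ π _ (h.1 i)
  refine ⟨_, p, hp, ?_⟩
  have h₂ : s ≫ g = 0 := by
    apply HomologicalComplex.from_single_hom_ext
    apply (L.isZero_of_isStrictlyLE n i hn).eq_of_tgt
  rw [← hs, Q.map_comp, assoc, IsIso.hom_inv_id_assoc, ← Q.map_comp, h₂, Q.map_zero]

/-- The shift `Y⟦n⟧` is the object `Y` placed in the negative degree `-n`. -/
lemma exists_epi_comp_eq_zero {X Y : C} {n : ℤ} (hn : 0 < n)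
    (f : (singleFunctor C 0).obj X ⟶ ((singleFunctor C 0).obj Y)⟦n⟧) :
    ∃ (X' : C) (p : X' ⟶ X), Epi p ∧ (singleFunctor C 0).map p ≫ f = 0 := by
  obtain ⟨X', p, hp, h⟩ := exists_epi_comp_eq_zero_of_isStrictlyLE
    (L := (CochainComplex.singleFunctor C (-n)).obj Y)
    (f ≫ ((singleFunctors C).shiftIso n (-n) 0 (by lia)).hom.app _) (-n) (by lia)
  refine ⟨X', p, hp, ?_⟩
  rw [← cancel_mono (((singleFunctors C).shiftIso n (-n) 0 (by lia)).hom.app _),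
    zero_comp, assoc]
  exact h

end Effaceability

end SuperQuiver

namespace SuperQuiver

noncomputable section

namespace SRep

variable {K : Type u} [Field K] {V : Type} {Γ : SimpleGraph V} {D : ColouredQuiver Γ}

/-! ### Morphisms of super-representations -/

/-- The component of a morphism at a vertex. -/
def app {X Y : SRep K D} (f : X ⟶ Y) (i : V) : X.obj i →ₗ[K] Y.obj i := f.1 i

/-- A morphism, from its components. -/
def mkHom {X Y : SRep K D} (φ : ∀ i, X.obj i →ₗ[K] Y.obj i)
    (h : ∀ {i j : V} (a : D.arrow i j), φ j ∘ₗ X.map a = Y.map a ∘ₗ φ i) : X ⟶ Y := ⟨φ, h⟩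

@[simp]
lemma app_mkHom {X Y : SRep K D} (φ : ∀ i, X.obj i →ₗ[K] Y.obj i)
    (h : ∀ {i j : V} (a : D.arrow i j), φ j ∘ₗ X.map a = Y.map a ∘ₗ φ i) (i : V) :
    app (mkHom φ h) i = φ i := rfl

lemma hom_ext {X Y : SRep K D} {f g : X ⟶ Y} (h : ∀ i, app f i = app g i) : f = g :=
  Subtype.ext (funext h)

@[simp]
lemma app_comp {X Y Z : SRep K D} (f : X ⟶ Y) (g : Y ⟶ Z) (i : V) :
    app (f ≫ g) i = app g i ∘ₗ app f i := rfl

@[simp]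
lemma app_id (X : SRep K D) (i : V) : app (𝟙 X) i = LinearMap.id := rfl

@[simp]
lemma app_zero (X Y : SRep K D) (i : V) : app (0 : X ⟶ Y) i = 0 := rfl

@[simp]
lemma app_add {X Y : SRep K D} (f g : X ⟶ Y) (i : V) : app (f + g) i = app f i + app g i := rfl

lemma app_map {X Y : SRep K D} (f : X ⟶ Y) {i j : V} (a : D.arrow i j) (x : X.obj i) :
    app f j (X.map a x) = Y.map a (app f i x) := LinearMap.congr_fun (f.2 a) x

/-- Multiplication by a scalar. -/
def scalar (X : SRep K D) (c : K) : X ⟶ X :=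
  mkHom (fun _ => c • LinearMap.id) (fun a => by ext x; simp)

lemma isIso_of_bijective {X Y : SRep K D} (f : X ⟶ Y)
    (h : ∀ i, Function.Bijective (app f i)) : IsIso f := by
  refine ⟨mkHom (fun i => (LinearEquiv.ofBijective (app f i) (h i)).symm.toLinearMap) ?_, ?_, ?_⟩
  · intro i j a
    ext y
    apply (h j).1
    refine ((LinearEquiv.ofBijective (app f j) (h j)).apply_symm_apply (Y.map a y)).trans ?_
    refine (congrArg (Y.map a)
      ((LinearEquiv.ofBijective (app f i) (h i)).apply_symm_apply y)).symm.trans ?_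
    exact (app_map f a _).symm
  · refine hom_ext fun i => ?_
    ext x
    exact (LinearEquiv.ofBijective (app f i) (h i)).symm_apply_apply x
  · refine hom_ext fun i => ?_
    ext x
    exact (LinearEquiv.ofBijective (app f i) (h i)).apply_symm_apply x

/-- The super-representation with given spaces and maps, graded by the colours of the vertices. -/
def ofMaps (M : V → Type u) [∀ i, AddCommGroup (M i)] [∀ i, Module K (M i)]
    [∀ i, Module.Finite K (M i)] (f : ∀ i j, D.arrow i j → (M i →ₗ[K] M j)) : SRep K D where
  obj i :=
    { carrier := M i
      gr := fun q => if q = D.colour i then ⊤ else ⊥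
      isCompl := SVect.isCompl_ite (D.colour i) }
  map a := f _ _ a
  map_degree {i j} a q x hx := by
    by_cases h : q = D.colour i
    · subst h
      have : D.colour i + (D.colour i + D.colour j) = D.colour j := by
        rw [← add_assoc, CharTwo.add_self_eq_zero, zero_add]
      simp [this]
    · simp only [h, if_false, Submodule.mem_bot] at hx
      subst hx
      rw [map_zero]
      exact zero_mem _

/-! ### Exactness is tested at the vertices -/

lemma mono_of_injective {X Y : SRep K D} (f : X ⟶ Y) (h : ∀ i, Function.Injective (app f i)) :
    Mono f := by
  refine ⟨fun g k hgk => hom_ext fun i => ?_⟩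
  ext x
  exact h i (LinearMap.congr_fun (congrArg (fun t => app t i) hgk) x)

lemma epi_of_surjective {X Y : SRep K D} (f : X ⟶ Y) (h : ∀ i, Function.Surjective (app f i)) :
    Epi f := by
  refine ⟨fun g k hgk => hom_ext fun i => ?_⟩
  ext y
  obtain ⟨x, rfl⟩ := h i y
  exact LinearMap.congr_fun (congrArg (fun t => app t i) hgk) x

/-- The quotient of `Y` by the image of `f : X ⟶ Y`. -/
def cokernelRep {X Y : SRep K D} (f : X ⟶ Y) : SRep K D :=
  ofMaps (fun i => Y.obj i ⧸ LinearMap.range (app f i)) (fun i j a =>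
    Submodule.mapQ _ _ (Y.map a) (by
      rintro _ ⟨x, rfl⟩
      exact ⟨X.map a x, app_map f a x⟩))

/-- The projection onto the quotient by the image of `f`. -/
def cokernelRepπ {X Y : SRep K D} (f : X ⟶ Y) : Y ⟶ cokernelRep f :=
  mkHom (fun i => (LinearMap.range (app f i)).mkQ) (fun _ => rfl)

/-- The projection onto the vertexwise cokernel is killed by the epimorphism, hence zero. -/
lemma surjective_of_epi {X Y : SRep K D} (f : X ⟶ Y) [Epi f] (i : V) :
    Function.Surjective (app f i) := by
  have h : cokernelRepπ f = 0 := by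
    rw [← cancel_epi f, comp_zero]
    refine hom_ext fun i => ?_
    ext x
    exact (Submodule.Quotient.mk_eq_zero _).2 ⟨x, rfl⟩
  intro y
  have := LinearMap.congr_fun (congrArg (fun t => app t i) h) y
  exact (Submodule.Quotient.mk_eq_zero _).1 this

/-- The kernel of `f : X ⟶ Y`. -/
def kernelRep {X Y : SRep K D} (f : X ⟶ Y) : SRep K D :=
  ofMaps (fun i => LinearMap.ker (app f i)) (fun i j a =>
    (X.map a).restrict (fun x hx => by
      rw [LinearMap.mem_ker] at hx ⊢
      rw [app_map, hx, map_zero]))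

/-- The inclusion of the kernel of `f`. -/
def kernelRepι {X Y : SRep K D} (f : X ⟶ Y) : kernelRep f ⟶ X :=
  mkHom (fun i => (LinearMap.ker (app f i)).subtype) (fun _ => rfl)

/-- The abelian structure is transported along an equivalence, so it does not come with vertexwise
kernels. The universal property of the kernel is checked by inverting the injective maps `S.f` on
their images. -/
lemma shortExact_of_pointwise (S : ShortComplex (SRep K D))
    (hf : ∀ i, Function.Injective (app S.f i)) (hg : ∀ i, Function.Surjective (app S.g i))
    (h : ∀ i, LinearMap.ker (app S.g i) ≤ LinearMap.range (app S.f i)) : S.ShortExact := by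
  have := mono_of_injective S.f hf
  have := epi_of_surjective S.g hg
  refine { exact := ?_ }
  refine ShortComplex.exact_of_f_is_kernel S (KernelFork.IsLimit.ofι' S.f S.zero ?_)
  intro W k hk
  have hr : ∀ i x, app k i x ∈ LinearMap.range (app S.f i) := fun i x =>
    h i (LinearMap.congr_fun (congrArg (fun t => app t i) hk) x)
  let φ : ∀ i, W.obj i →ₗ[K] S.X₁.obj i := fun i =>
    (LinearEquiv.ofInjective (app S.f i) (hf i)).symm.toLinearMap ∘ₗ
      (app k i).codRestrict _ (hr i)
  have hφ : ∀ i x, app S.f i (φ i x) = app k i x := fun i x =>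
    congrArg Subtype.val
      ((LinearEquiv.ofInjective (app S.f i) (hf i)).apply_symm_apply ⟨app k i x, hr i x⟩)
  refine ⟨mkHom φ ?_, ?_⟩
  · intro i j a
    ext x
    apply hf j
    refine (hφ j _).trans ((app_map k a x).trans ?_)
    refine (congrArg (S.X₂.map a) (hφ i x)).symm.trans ?_
    exact (app_map S.f a _).symm
  · refine hom_ext fun i => ?_
    ext x
    exact hφ i x

/-- The short exact sequence of the kernel of an epimorphism. -/
lemma kernelRep_shortExact {X Y : SRep K D} (f : X ⟶ Y) [Epi f] :
    (ShortComplex.mk (kernelRepι f) f (hom_ext fun i => by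
      ext x; exact x.2)).ShortExact :=
  shortExact_of_pointwise _ (fun _ => Subtype.val_injective) (surjective_of_epi f)
    (fun _ x hx => ⟨⟨x, hx⟩, rfl⟩)

/-! ### Extensions -/

/-- Families of linear maps `X(i) → Y(j)`, for the arrows `i → j`. -/
abbrev Cochain (X Y : SRep K D) : Type u := ∀ i j, D.arrow i j → (X.obj i →ₗ[K] Y.obj j)

/-- The coboundary of a family of linear maps `X(i) → Y(i)`. -/
def coboundary (X Y : SRep K D) (φ : ∀ i, X.obj i →ₗ[K] Y.obj i) : Cochain X Y :=
  fun i j a => φ j ∘ₗ X.map a - Y.map a ∘ₗ φ i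

/-- The extension of `X` by `Y` given by a cochain. -/
def extension {X Y : SRep K D} (ξ : Cochain X Y) : SRep K D :=
  ofMaps (fun i => Y.obj i × X.obj i) (fun i j a =>
    (Y.map a ∘ₗ LinearMap.fst K _ _ + ξ i j a ∘ₗ LinearMap.snd K _ _).prod
      (X.map a ∘ₗ LinearMap.snd K _ _))

/-- The inclusion into an extension. -/
def extensionInl {X Y : SRep K D} (ξ : Cochain X Y) : Y ⟶ extension ξ :=
  mkHom (fun i => LinearMap.inl K (Y.obj i) (X.obj i)) (fun a => by
    refine LinearMap.ext fun y => Prod.ext ?_ ?_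
    · change Y.map a y = Y.map a y + ξ _ _ a 0
      rw [map_zero, add_zero]
    · exact (map_zero (X.map a)).symm)

/-- The projection of an extension. -/
def extensionSnd {X Y : SRep K D} (ξ : Cochain X Y) : extension ξ ⟶ X :=
  mkHom (fun i => LinearMap.snd K (Y.obj i) (X.obj i)) (fun _ => rfl)

/-- The short complex of an extension. -/
abbrev extensionComplex {X Y : SRep K D} (ξ : Cochain X Y) : ShortComplex (SRep K D) :=
  ShortComplex.mk (extensionInl ξ) (extensionSnd ξ) (hom_ext fun _ => rfl)

lemma extensionComplex_shortExact {X Y : SRep K D} (ξ : Cochain X Y) :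
    (extensionComplex ξ).ShortExact :=
  shortExact_of_pointwise _ (fun _ => LinearMap.inl_injective)
    (fun _ => LinearMap.snd_surjective)
    (fun _ x hx => ⟨x.1, Prod.ext rfl (Eq.symm hx)⟩)

variable (K D) in
/-- Super-representations as objects of the derived category. -/
abbrev toDerived : SRep K D ⥤ DerivedCategory (SRep K D) := DerivedCategory.singleFunctor _ 0

/-- The class of an extension. -/
def extensionClass {X Y : SRep K D} (ξ : Cochain X Y) :
    (toDerived K D).obj X ⟶ ((toDerived K D).obj Y)⟦(1 : ℤ)⟧ :=
  (extensionComplex_shortExact ξ).singleδ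

/-- A family of maps on the middle terms gives an equality of extension classes. -/
lemma singleδ_comp_eq {S : ShortComplex (SRep K D)} (hS : S.ShortExact) {X Y : SRep K D}
    (ξ : Cochain X Y) (g : S.X₁ ⟶ Y) (k : S.X₃ ⟶ X)
    (u : ∀ i, S.X₂.obj i →ₗ[K] Y.obj i) (hu : ∀ i x, u i (app S.f i x) = app g i x)
    (h : ∀ i j (a : D.arrow i j) x, u j (S.X₂.map a x) =
      Y.map a (u i x) + ξ i j a (app k i (app S.g i x))) :
    hS.singleδ ≫ ((toDerived K D).map g)⟦(1 : ℤ)⟧' =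
      (toDerived K D).map k ≫ extensionClass ξ := by
  -- With `g` and `k` this is a morphism of short exact sequences; the claim is the naturality of
  -- the connecting morphism.
  let m : S.X₂ ⟶ extension ξ := mkHom (fun i => (u i).prod (app k i ∘ₗ app S.g i)) (by
    intro i j a
    refine LinearMap.ext fun x => Prod.ext ?_ ?_
    · exact h i j a x
    · change app k j (app S.g j (S.X₂.map a x)) = X.map a (app k i (app S.g i x))
      rw [app_map, app_map])
  let f : S ⟶ extensionComplex ξ :=
    { τ₁ := g
      τ₂ := m
      τ₃ := k
      comm₁₂ := hom_ext fun i => by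
        ext x
        refine Prod.ext (hu i x).symm ?_
        have : app S.g i (app S.f i x) = 0 :=
          LinearMap.congr_fun (congrArg (fun t => app t i) S.zero) x
        change 0 = app k i (app S.g i (app S.f i x))
        rw [this, map_zero]
      comm₂₃ := hom_ext fun i => rfl }
  exact (ShortComplex.ShortExact.singleTriangle.map hS (extensionComplex_shortExact ξ) f).comm₃

lemma extensionClass_comp {X Y Y' : SRep K D} (ξ : Cochain X Y) (g : Y ⟶ Y') :
    extensionClass ξ ≫ ((toDerived K D).map g)⟦(1 : ℤ)⟧' =
      extensionClass (fun i j a => app g j ∘ₗ ξ i j a) := by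
  have := singleδ_comp_eq (extensionComplex_shortExact ξ)
    (fun i j a => app g j ∘ₗ ξ i j a) g (𝟙 X) (fun i => app g i ∘ₗ LinearMap.fst K _ _)
    (fun _ _ => rfl) (fun i j a x => by
      change app g j (Y.map a x.1 + ξ i j a x.2) = Y'.map a (app g i x.1) + app g j (ξ i j a x.2)
      rw [map_add, app_map])
  rw [CategoryTheory.Functor.map_id, Category.id_comp] at this
  exact this

lemma comp_extensionClass {X X' Y : SRep K D} (ξ : Cochain X Y) (k : X' ⟶ X) :
    (toDerived K D).map k ≫ extensionClass ξ =
      extensionClass (fun i j a => ξ i j a ∘ₗ app k i) := by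
  have := singleδ_comp_eq (extensionComplex_shortExact (fun i j a => ξ i j a ∘ₗ app k i))
    ξ (𝟙 Y) k (fun i => LinearMap.fst K _ _) (fun _ _ => rfl) (fun i j a x => rfl)
  rw [CategoryTheory.Functor.map_id, CategoryTheory.Functor.map_id, Category.comp_id] at this
  exact this.symm

/-- The two extensions are identified by the shear `(y, x) ↦ (y - φ x, x)`. -/
lemma extensionClass_add_coboundary {X Y : SRep K D} (ξ : Cochain X Y)
    (φ : ∀ i, X.obj i →ₗ[K] Y.obj i) :
    extensionClass (fun i j a => ξ i j a + coboundary X Y φ i j a) = extensionClass ξ := by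
  have := singleδ_comp_eq (extensionComplex_shortExact (fun i j a => ξ i j a + coboundary X Y φ i j a))
    ξ (𝟙 Y) (𝟙 X) (fun i => LinearMap.fst K _ _ - φ i ∘ₗ LinearMap.snd K _ _)
    (fun i x => by
      change x - φ i 0 = x
      rw [map_zero, sub_zero]) (fun i j a x => by
      change (Y.map a x.1 + (ξ i j a x.2 + (φ j (X.map a x.2) - Y.map a (φ i x.2)))) -
        φ j (X.map a x.2) = Y.map a (x.1 - φ i x.2) + ξ i j a x.2
      rw [map_sub]
      abel)
  rw [CategoryTheory.Functor.map_id, CategoryTheory.Functor.map_id, CategoryTheory.Functor.map_id, Category.comp_id, Category.id_comp] at this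
  exact this

/-- If the class vanishes, then the identity of `X` lifts to the extension, and the first component
of the lift is the family `φ`. Conversely a coboundary may be subtracted, and the extension of the
zero cochain is split by `x ↦ (0, x)`. -/
lemma extensionClass_eq_zero_iff {X Y : SRep K D} (ξ : Cochain X Y) :
    extensionClass ξ = 0 ↔ ∃ φ, ξ = coboundary X Y φ := by
  have hT := (extensionComplex_shortExact ξ).singleTriangle_distinguished
  constructor
  · intro h
    obtain ⟨s, hs⟩ := Pretriangulated.Triangle.coyoneda_exact₃ _ hT
      (𝟙 ((toDerived K D).obj X)) (by
        change 𝟙 _ ≫ extensionClass ξ = 0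
        rw [h, comp_zero])
    obtain ⟨t, rfl⟩ := (toDerived K D).map_surjective s
    have ht : t ≫ extensionSnd ξ = 𝟙 X := (toDerived K D).map_injective
      ((Functor.map_comp _ _ _).trans (hs.symm.trans (CategoryTheory.Functor.map_id _ _).symm))
    have h2 : ∀ i x, (app t i x : Y.obj i × X.obj i).2 = x := fun i x =>
      LinearMap.congr_fun (congrArg (fun t => app t i) ht) x
    refine ⟨fun i => LinearMap.fst K _ _ ∘ₗ app t i, ?_⟩
    funext i j a
    ext x
    have h1 := congrArg Prod.fst (app_map t a x)
    change (app t j (X.map a x)).1 = Y.map a (app t i x).1 + ξ i j a (app t i x).2 at h1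
    rw [h2] at h1
    change ξ i j a x = (app t j (X.map a x)).1 - Y.map a (app t i x).1
    rw [h1, add_sub_cancel_left]
  · rintro ⟨φ, rfl⟩
    have h := extensionClass_add_coboundary (fun _ _ _ => 0 : Cochain X Y) φ
    simp only [zero_add] at h
    rw [h]
    let t : X ⟶ extension (fun _ _ _ => 0 : Cochain X Y) := mkHom (fun i => LinearMap.inr K _ _) (by
      intro i j a
      refine LinearMap.ext fun x => Prod.ext ?_ ?_
      · change 0 = Y.map a 0 + 0
        rw [map_zero, add_zero]
      · rfl)
    have ht : t ≫ extensionSnd (fun _ _ _ => 0 : Cochain X Y) = 𝟙 X := rfl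
    have h0 := Pretriangulated.comp_distTriang_mor_zero₂₃ _
      (extensionComplex_shortExact (fun _ _ _ => 0 : Cochain X Y)).singleTriangle_distinguished
    change (toDerived K D).map (extensionSnd (fun _ _ _ => 0 : Cochain X Y)) ≫ extensionClass _ = 0 at h0
    rw [← Category.id_comp (extensionClass _), ← CategoryTheory.Functor.map_id, ← ht, Functor.map_comp,
      Category.assoc, h0, comp_zero]

end SRep

/-! ### Heredity -/

namespace SRep

variable {K : Type u} [Field K] {V : Type} {Γ : SimpleGraph V} {D : ColouredQuiver Γ}

/-- A morphism of positive degree factors through a connecting morphism. -/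
lemma exists_eq_singleδ_comp {X Y : SRep K D} {m n : ℤ} (hn : 0 < n) (h : m + 1 = n)
    (f : (toDerived K D).obj X ⟶ ((toDerived K D).obj Y)⟦n⟧) :
    ∃ (X' : SRep K D) (p : X' ⟶ X) (_ : Epi p)
      (g : (toDerived K D).obj (kernelRep p) ⟶ ((toDerived K D).obj Y)⟦m⟧),
      f = (kernelRep_shortExact p).singleδ ≫ g⟦(1 : ℤ)⟧' ≫
        (shiftFunctorAdd' _ m 1 n h).inv.app _ := by
  obtain ⟨X', p, hp, hpf⟩ := exists_epi_comp_eq_zero hn f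
  obtain ⟨g, hg⟩ := Pretriangulated.Triangle.yoneda_exact₃ _
    (kernelRep_shortExact p).singleTriangle_distinguished f hpf
  change ((toDerived K D).obj (kernelRep p))⟦(1 : ℤ)⟧ ⟶ ((toDerived K D).obj Y)⟦n⟧ at g
  obtain ⟨g', hg'⟩ := (shiftFunctor (DerivedCategory (SRep K D)) (1 : ℤ)).map_surjective
    (g ≫ (shiftFunctorAdd' _ m 1 n h).hom.app _)
  refine ⟨X', p, hp, g', ?_⟩
  rw [hg', Category.assoc, Iso.hom_inv_id_app]
  exact hg.trans (congrArg _ (Category.comp_id g).symm)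

lemma exists_extension_of_injective {A B W : Type u} [AddCommGroup A] [Module K A]
    [AddCommGroup B] [Module K B] [AddCommGroup W] [Module K W] (ι : A →ₗ[K] B)
    (hι : Function.Injective ι) (g : A →ₗ[K] W) : ∃ u : B →ₗ[K] W, ∀ x, u (ι x) = g x := by
  obtain ⟨r, hr⟩ := ι.exists_leftInverse_of_injective (LinearMap.ker_eq_bot.2 hι)
  exact ⟨g ∘ₗ r, fun x => congrArg g (LinearMap.congr_fun hr x)⟩

/-- Every morphism of degree one is the class of an extension. -/
lemma exists_eq_extensionClass {X Y : SRep K D}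
    (f : (toDerived K D).obj X ⟶ ((toDerived K D).obj Y)⟦(1 : ℤ)⟧) :
    ∃ ξ : Cochain X Y, f = extensionClass ξ := by
  obtain ⟨X', p, hp, g, hg⟩ := exists_eq_singleδ_comp one_pos (zero_add 1) f
  obtain ⟨g', hg'⟩ := (toDerived K D).map_surjective
    (g ≫ (shiftFunctorZero (DerivedCategory (SRep K D)) ℤ).hom.app _)
  choose u hu using fun i => exists_extension_of_injective (app (kernelRepι p) i)
    Subtype.val_injective (app g' i)
  have hs := surjective_of_epi p
  choose s hs using fun i => (app p i).exists_rightInverse_of_surjective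
    (LinearMap.range_eq_top.2 (hs i))
  have hs' : ∀ i x, app p i (s i x) = x := fun i x => LinearMap.congr_fun (hs i) x
  -- Vertex by vertex, `u` extends `g'` from the kernel and `s` is a section of `p`. The cochain is
  -- the failure of `u` to commute with the structure maps; this failure vanishes on the kernel, so
  -- it can be read on `X` through `s`.
  refine ⟨fun i j a => u j ∘ₗ X'.map a ∘ₗ s i - Y.map a ∘ₗ u i ∘ₗ s i, ?_⟩
  have key := singleδ_comp_eq (kernelRep_shortExact p)
    (fun i j a => u j ∘ₗ X'.map a ∘ₗ s i - Y.map a ∘ₗ u i ∘ₗ s i) g' (𝟙 X) u hu (by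
      intro i j a x
      have hx : app p i (x - s i (app p i x)) = 0 := by
        rw [map_sub, hs', sub_self]
      obtain ⟨z, hz⟩ : ∃ z, app (kernelRepι p) i z = x - s i (app p i x) :=
        ⟨(⟨_, hx⟩ : LinearMap.ker (app p i)), rfl⟩
      have h1 : u j (X'.map a (x - s i (app p i x))) = Y.map a (u i (x - s i (app p i x))) := by
        rw [← hz, hu, ← app_map, hu, app_map]
      simp only [map_sub] at h1
      change u j (X'.map a x) = Y.map a (u i x) + (u j (X'.map a (s i (app p i x))) -
        Y.map a (u i (s i (app p i x))))
      rw [← sub_eq_iff_eq_add', ← sub_eq_zero]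
      rw [sub_eq_sub_iff_add_eq_add] at h1
      rw [sub_sub_sub_eq, sub_eq_zero]
      rw [h1])
  rw [CategoryTheory.Functor.map_id, Category.id_comp] at key
  rw [← key, hg, hg']
  congr 1
  rw [Functor.map_comp]
  congr 1
  simp [shiftFunctorAdd'_zero_add_inv_app]

/-- In degree two, dimension shifting leads to an extension class on the kernel of an epimorphism
onto `X`. Cochains are families of linear maps subject to no condition, so they extend from the
kernel to the whole source of the epimorphism, and the connecting morphism kills every class that
extends. Higher degrees follow by further dimension shifting. -/
lemma hom_shift_eq_zero_aux (k : ℕ) : ∀ {X Y : SRep K D} {n : ℤ} (_ : n = k + 2)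
    (f : (toDerived K D).obj X ⟶ ((toDerived K D).obj Y)⟦n⟧), f = 0 := by
  induction k with
  | zero =>
    intro X Y n hn f
    obtain ⟨X', p, hp, g, hg⟩ := exists_eq_singleδ_comp (m := 1) (by simp [hn]) (by simp [hn]) f
    obtain ⟨ξ, rfl⟩ := exists_eq_extensionClass g
    choose r hr using fun i => (app (kernelRepι p) i).exists_leftInverse_of_injective
      (LinearMap.ker_eq_bot.2 Subtype.val_injective)
    have h : extensionClass ξ = (toDerived K D).map (kernelRepι p) ≫
        extensionClass (fun i j a => ξ i j a ∘ₗ r i) := by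
      rw [comp_extensionClass]
      congr
      funext i j a
      rw [LinearMap.comp_assoc, hr, LinearMap.comp_id]
    have h0 := Pretriangulated.comp_distTriang_mor_zero₃₁ _
      (kernelRep_shortExact p).singleTriangle_distinguished
    change (kernelRep_shortExact p).singleδ ≫ ((toDerived K D).map (kernelRepι p))⟦(1 : ℤ)⟧' = 0
      at h0
    rw [hg, h, Functor.map_comp, Category.assoc, reassoc_of% h0, zero_comp]
  | succ k ih =>
    intro X Y n hn f
    obtain ⟨X', p, hp, g, hg⟩ := exists_eq_singleδ_comp (m := k + 2) (by omega)
      (by rw [hn]; push_cast; ring) f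
    rw [hg, ih rfl g, Functor.map_zero, zero_comp, comp_zero]

/-- The category of super-representations is hereditary. -/
lemma hom_shift_eq_zero {X Y : SRep K D} {n : ℤ} (hn : 2 ≤ n)
    (f : (toDerived K D).obj X ⟶ ((toDerived K D).obj Y)⟦n⟧) : f = 0 :=
  hom_shift_eq_zero_aux (n - 2).toNat (by omega) f

lemma hom_shift_eq_zero_of_neg {X Y : SRep K D} {n : ℤ} (hn : n < 0)
    (f : (toDerived K D).obj X ⟶ ((toDerived K D).obj Y)⟦n⟧) : f = 0 := by
  have := DerivedCategory.TStructure.t.isGE_shift ((toDerived K D).obj Y) 0 n (-n) (by omega)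
  exact DerivedCategory.TStructure.t.zero f 0 (-n) (by omega)

end SRep

/-! ### Finite direct sums -/

section FinSum

variable {C : Type*} [Category* C] [Preadditive C]

/-- `Z` is a direct sum of `X` and `Y`. -/
def IsDirectSum (Z X Y : C) : Prop :=
  ∃ (i : X ⟶ Z) (p : Z ⟶ X) (j : Y ⟶ Z) (q : Z ⟶ Y),
    i ≫ p = 𝟙 X ∧ j ≫ q = 𝟙 Y ∧ i ≫ q = 0 ∧ j ≫ p = 0 ∧ p ≫ i + q ≫ j = 𝟙 Z

lemma IsDirectSum.of_iso {Z Z' X Y : C} (h : IsDirectSum Z X Y) (e : Z ≅ Z') :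
    IsDirectSum Z' X Y := by
  obtain ⟨i, p, j, q, h1, h2, h3, h4, h5⟩ := h
  refine ⟨i ≫ e.hom, e.inv ≫ p, j ≫ e.hom, e.inv ≫ q, by simp [h1], by simp [h2], by simp [h3],
    by simp [h4], ?_⟩
  have := congrArg (fun t => e.inv ≫ t ≫ e.hom) h5
  simpa using this

lemma IsDirectSum.map {C' : Type*} [Category* C'] [Preadditive C'] (F : C ⥤ C') [F.Additive]
    {Z X Y : C} (h : IsDirectSum Z X Y) : IsDirectSum (F.obj Z) (F.obj X) (F.obj Y) := by
  obtain ⟨i, p, j, q, h1, h2, h3, h4, h5⟩ := h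
  refine ⟨F.map i, F.map p, F.map j, F.map q, ?_, ?_, ?_, ?_, ?_⟩
  · rw [← F.map_comp, h1, F.map_id]
  · rw [← F.map_comp, h2, F.map_id]
  · rw [← F.map_comp, h3, F.map_zero]
  · rw [← F.map_comp, h4, F.map_zero]
  · rw [← F.map_comp, ← F.map_comp, ← F.map_add, h5, F.map_id]

/-- `Z` is a finite direct sum of objects with the property `P`. -/
inductive FinSum (P : C → Prop) : C → Prop
  | of {X Z : C} (hX : P X) (e : X ≅ Z) : FinSum P Z
  | zero {Z : C} (h : IsZero Z) : FinSum P Z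
  | sum {Z X Y : C} (h : IsDirectSum Z X Y) (hX : FinSum P X) (hY : FinSum P Y) : FinSum P Z

lemma FinSum.of_iso {P : C → Prop} {Z Z' : C} (h : FinSum P Z) (e : Z ≅ Z') : FinSum P Z' := by
  cases h with
  | of hX e' => exact .of hX (e' ≪≫ e)
  | zero h => exact .zero (h.of_iso e.symm)
  | sum h hX hY => exact .sum (h.of_iso e) hX hY

lemma FinSum.map {C' : Type*} [Category* C'] [Preadditive C'] {P : C → Prop} {P' : C' → Prop}
    (F : C ⥤ C') [F.Additive] (hP : ∀ X, P X → FinSum P' (F.obj X)) {Z : C} (h : FinSum P Z) :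
    FinSum P' (F.obj Z) := by
  induction h with
  | of hX e => exact (hP _ hX).of_iso (F.mapIso e)
  | zero h =>
    refine .zero ((IsZero.iff_id_eq_zero _).2 ?_)
    rw [← F.map_id, (IsZero.iff_id_eq_zero _).1 h, F.map_zero]
  | sum h _ _ hX hY => exact .sum (h.map F) hX hY

/-- Morphisms into a direct sum are tested on the summands. The functor `F` is there for the shift
in the third morphism of a triangle. -/
lemma FinSum.eq_zero_of_map {C' : Type*} [Category* C'] [Preadditive C'] {P : C → Prop}
    (F : C ⥤ C') [F.Additive] {B : C'} (hP : ∀ X, P X → ∀ f : B ⟶ F.obj X, f = 0) {Z : C}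
    (h : FinSum P Z) (f : B ⟶ F.obj Z) : f = 0 := by
  induction h with
  | of hX e =>
    rw [← cancel_mono (F.map e.inv), zero_comp]
    exact hP _ hX _
  | zero h =>
    rw [← Category.comp_id f, ← F.map_id, (IsZero.iff_id_eq_zero _).1 h, F.map_zero, comp_zero]
  | sum h _ _ hX hY =>
    obtain ⟨i, p, j, q, -, -, -, -, h5⟩ := h
    rw [← Category.comp_id f, ← F.map_id, ← h5, F.map_add, F.map_comp, F.map_comp,
      Preadditive.comp_add, ← Category.assoc, ← Category.assoc, hX (f ≫ F.map p),
      hY (f ≫ F.map q), zero_comp, zero_comp, add_zero]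

end FinSum

/-! ### Splitting of bounded objects over a hereditary heart -/

section TStructure

open Pretriangulated Triangulated

variable {C : Type*} [Category* C] [Preadditive C] [HasZeroObject C] [HasShift C ℤ]
  [∀ n : ℤ, (shiftFunctor C n).Additive] [Pretriangulated C]

lemma isDirectSum_of_distTriang (T : Triangle C) (hT : T ∈ distTriang C) (h : T.mor₃ = 0) :
    IsDirectSum T.obj₂ T.obj₁ T.obj₃ := by
  obtain ⟨e, -, -⟩ := exists_iso_binaryBiproduct_of_distTriang T hT h
  refine IsDirectSum.of_iso ⟨biprod.inl, biprod.fst, biprod.inr, biprod.snd, ?_⟩ e.symm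
  simp [biprod.total]

/-- In a triangulated category with a hereditary heart, bounded objects are direct sums of
shifts of objects of the heart. -/
lemma finSum_of_hereditary [IsTriangulated C] (t : TStructure C)
    (ht : ∀ (X Y : C) (n k : ℤ), k + 2 ≤ n → t.IsLE X n → t.IsGE X n → t.IsLE Y k → t.IsGE Y k →
      ∀ f : X ⟶ Y, f = 0) (a : ℤ) (m : ℕ) (Z : C) [t.IsGE Z a] [t.IsLE Z (a + m - 1)] :
    FinSum (fun X => ∃ k, k ≤ a + m - 1 ∧ t.IsLE X k ∧ t.IsGE X k) Z := by
  induction m generalizing Z with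
  | zero => exact .zero (t.isZero Z (a + (0 : ℕ) - 1) a (by simp))
  | succ m ih =>
    have hb : a + ((m + 1 : ℕ) : ℤ) - 1 = a + m := by push_cast; ring
    have hT := t.triangleLTGE_distinguished (a + m) Z
    have hZ : t.IsLE Z (a + m) := hb ▸ inferInstance
    have h1 : t.IsGE ((t.truncLT (a + m)).obj Z) a := inferInstance
    have h2 := ih ((t.truncLT (a + m)).obj Z)
    have h3 : t.IsLE ((t.truncGE (a + m)).obj Z) (a + m) := inferInstance
    -- The source lives in degree `a + m`. The target is shifted by one, so its summands live in
    -- degrees at most `a + m - 2`, which is far enough for the vanishing hypothesis.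
    have h0 : ((t.triangleLTGE (a + m)).obj Z).mor₃ = 0 := by
      refine h2.eq_zero_of_map (shiftFunctor C (1 : ℤ)) ?_ _
      rintro X ⟨k, hk, hX, hX'⟩ f
      exact ht _ _ (a + m) (k - 1) (by omega) h3 inferInstance (t.isLE_shift X k 1 (k - 1))
        (t.isGE_shift X k 1 (k - 1)) f
    refine .sum (isDirectSum_of_distTriang _ hT h0) ?_ ?_
    · refine FinSum.map (𝟭 C) (fun X hX => ?_) h2
      obtain ⟨k, hk, hX⟩ := hX
      exact .of ⟨k, by omega, hX⟩ (Iso.refl _)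
    · exact .of ⟨a + m, hb.ge, h3, inferInstance⟩ (Iso.refl _)

end TStructure

/-! ### Objects of the bounded derived category -/

namespace SRep

variable {K : Type u} [Field K] {V : Type} {Γ : SimpleGraph V} {D : ColouredQuiver Γ}

open DerivedCategory

lemma toDerived_hom_eq_zero {X Y : SRep K D} {n k : ℤ} (h : k + 2 ≤ n)
    (f : ((toDerived K D).obj X)⟦-n⟧ ⟶ ((toDerived K D).obj Y)⟦-k⟧) : f = 0 := by
  apply (shiftFunctor (DerivedCategory (SRep K D)) n).map_injective
  rw [← cancel_epi ((shiftFunctorCompIsoId (DerivedCategory (SRep K D)) (-n) n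
    (by omega)).inv.app _), ← cancel_mono ((shiftFunctorAdd' (DerivedCategory (SRep K D))
    (-k) n (n - k) (by omega)).inv.app _)]
  exact (hom_shift_eq_zero (by omega) _).trans (by simp)

lemma exists_iso_stalk_shift (X : DerivedCategory.Bounded (SRep K D)) (n : ℤ)
    [TStructure.t.IsGE X.obj n] [TStructure.t.IsLE X.obj n] :
    ∃ Y : SRep K D, Nonempty ((stalk Y)⟦-n⟧ ≅ X) := by
  have h1 := TStructure.t.isGE_shift X.obj n n 0
  have h2 := TStructure.t.isLE_shift X.obj n n 0
  obtain ⟨Y, ⟨e⟩⟩ := exists_iso_singleFunctor_obj_of_isGE_of_isLE (X.obj⟦n⟧) 0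
  let e' : X⟦n⟧ ≅ stalk Y := TStructure.t.bounded.ι.preimageIso
    ((TStructure.t.bounded.ι.commShiftIso n).app X ≪≫ e)
  exact ⟨Y, ⟨(shiftFunctor _ (-n)).mapIso e'.symm ≪≫
    (shiftFunctorCompIsoId _ n (-n) (by omega)).app X⟩⟩

/-- Every object of the bounded derived category is a direct sum of shifts of
super-representations. -/
lemma finSum_stalk (Z : DerivedCategory.Bounded (SRep K D)) :
    FinSum (fun X => ∃ (Y : SRep K D) (n : ℤ), X = (stalk Y)⟦n⟧) Z := by
  obtain ⟨⟨a, ha⟩, ⟨b, hb⟩⟩ := Z.property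
  have hZ : TStructure.t.onBounded.IsGE Z a := ⟨ha.1⟩
  -- The number of degrees is cut off at zero, so this upper bound is at least `b`, with equality
  -- unless `b < a - 1`.
  have hZ' : TStructure.t.IsLE Z.obj (a + (b - a + 1).toNat - 1) :=
    TStructure.t.isLE_of_le Z.obj b _ (by omega)
  have hZ' : TStructure.t.onBounded.IsLE Z (a + (b - a + 1).toNat - 1) := ⟨hZ'.1⟩
  refine FinSum.map (𝟭 _) ?_ (finSum_of_hereditary TStructure.t.onBounded ?_ a (b - a + 1).toNat Z)
  · rintro X ⟨k, -, h1, h2⟩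
    have h1 : TStructure.t.IsLE X.obj k := ⟨h1.1⟩
    have h2 : TStructure.t.IsGE X.obj k := ⟨h2.1⟩
    obtain ⟨Y, ⟨e⟩⟩ := exists_iso_stalk_shift X k
    exact .of ⟨Y, -k, rfl⟩ e
  · intro X Y n k hnk hX hX' hY hY' f
    have h1 : TStructure.t.IsLE X.obj n := ⟨hX.1⟩
    have h2 : TStructure.t.IsGE X.obj n := ⟨hX'.1⟩
    have h3 : TStructure.t.IsLE Y.obj k := ⟨hY.1⟩
    have h4 : TStructure.t.IsGE Y.obj k := ⟨hY'.1⟩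
    obtain ⟨A, ⟨e⟩⟩ := exists_iso_stalk_shift X n
    obtain ⟨B, ⟨e'⟩⟩ := exists_iso_stalk_shift Y k
    rw [← cancel_epi e.hom, ← cancel_mono e'.inv]
    apply TStructure.t.bounded.ι.map_injective
    rw [← cancel_epi ((TStructure.t.bounded.ι.commShiftIso (-n)).inv.app _),
      ← cancel_mono ((TStructure.t.bounded.ι.commShiftIso (-k)).hom.app _)]
    exact (toDerived_hom_eq_zero hnk _).trans (by simp; rfl)

end SRep

/-! ### Morphisms of the orbit category and their homogeneous components -/

namespace Orbit

section

variable {C : Type*} [Category* C] [Preadditive C] [HasShift C ℤ]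
  [∀ n : ℤ, (shiftFunctor C n).Additive]

/-- A homogeneous morphism of the orbit category. -/
def homog {X Y : Orbit C} (k : ℤ) (f : X.as ⟶ Y.as⟦2 * k⟧) : X ⟶ Y :=
  DirectSum.of (fun k : ℤ => ShiftedHom X.as Y.as (2 * k)) k f

lemma homog_comp {X Y Z : Orbit C} {k l r : ℤ} (f : X.as ⟶ Y.as⟦2 * k⟧)
    (g : Y.as ⟶ Z.as⟦2 * l⟧) (h : l + k = r) :
    homog k f ≫ homog l g =
      homog r (ShiftedHom.comp f g (show 2 * l + 2 * k = 2 * r by rw [← h]; ring)) :=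
  Orbit.comp_of f g h

lemma homog_add {X Y : Orbit C} (k : ℤ) (f g : X.as ⟶ Y.as⟦2 * k⟧) :
    homog k (f + g) = homog k f + homog k g := map_add _ _ _

lemma homog_zero (X Y : Orbit C) (k : ℤ) :
    (homog k (0 : X.as ⟶ Y.as⟦2 * k⟧) : X ⟶ Y) = 0 := map_zero _

/-- A homogeneous component of a morphism of the orbit category. -/
def coeff {X Y : Orbit C} (k : ℤ) : (X ⟶ Y) →+ (X.as ⟶ Y.as⟦2 * k⟧) :=
  DFinsupp.evalAddMonoidHom (β := fun k : ℤ => ShiftedHom X.as Y.as (2 * k)) k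

lemma coeff_homog {X Y : Orbit C} (k : ℤ) (f : X.as ⟶ Y.as⟦2 * k⟧) :
    coeff k (homog k f : X ⟶ Y) = f :=
  DirectSum.of_eq_same (β := fun k : ℤ => ShiftedHom X.as Y.as (2 * k)) k f

lemma coeff_homog_of_ne {X Y : Orbit C} {k l : ℤ} (h : l ≠ k) (f : X.as ⟶ Y.as⟦2 * k⟧) :
    coeff l (homog k f : X ⟶ Y) = 0 :=
  DirectSum.of_eq_of_ne (β := fun k : ℤ => ShiftedHom X.as Y.as (2 * k)) _ _ f h

lemma hom_ext {X Y : Orbit C} {f g : X ⟶ Y} (h : ∀ k, coeff k f = coeff k g) : f = g :=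
  DFinsupp.ext h

lemma homog_injective {X Y : Orbit C} (k : ℤ) :
    Function.Injective (homog (X := X) (Y := Y) k) := fun f g h => by
  rw [← coeff_homog (X := X) k f, h, coeff_homog]

lemma hom_induction {X Y : Orbit C} {P : (X ⟶ Y) → Prop} (f : X ⟶ Y) (h0 : P 0)
    (hadd : ∀ f g, P f → P g → P (f + g)) (hof : ∀ k f, P (homog k f)) : P f :=
  DirectSum.induction_on f h0 hof hadd

/-- If only one degree contributes, every morphism is homogeneous of that degree. -/
lemma exists_eq_homog {X Y : Orbit C} (k : ℤ)
    (h : ∀ l, l ≠ k → ∀ f : X.as ⟶ Y.as⟦2 * l⟧, f = 0) (f : X ⟶ Y) : ∃ g, f = homog k g := by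
  induction f using hom_induction with
  | h0 => exact ⟨0, (homog_zero _ _ _).symm⟩
  | hadd f g hf hg =>
    obtain ⟨f', rfl⟩ := hf
    obtain ⟨g', rfl⟩ := hg
    exact ⟨f' + g', (homog_add _ _ _).symm⟩
  | hof l f =>
    by_cases hl : l = k
    · subst hl
      exact ⟨f, rfl⟩
    · exact ⟨0, by rw [h l hl f, homog_zero, homog_zero]⟩

lemma eq_zero_of_forall {X Y : Orbit C}
    (h : ∀ l : ℤ, ∀ f : X.as ⟶ Y.as⟦2 * l⟧, f = 0) (f : X ⟶ Y) : f = 0 := by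
  obtain ⟨g, rfl⟩ := exists_eq_homog 0 (fun l _ => h l) f
  rw [h 0 g, homog_zero]

lemma id_eq_homog (X : Orbit C) : 𝟙 X = homog 0 (ShiftedHom.mk₀ (2 * 0) (mul_zero 2) (𝟙 X.as)) :=
  rfl

/-- The inverse of `f` has the opposite degree; it is found by pulling `f⁻¹` back along the shift,
which is full. Checking one side is enough, because `g` is again an isomorphism of the original
category and has a right inverse of its own. -/
lemma exists_rightInverse_homog {X Y : Orbit C} {k l : ℤ} (h : l + k = 0)
    (f : X.as ⟶ Y.as⟦2 * k⟧) [IsIso f] :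
    ∃ g : Y.as ⟶ X.as⟦2 * l⟧, IsIso g ∧ (homog k f : X ⟶ Y) ≫ homog l g = 𝟙 X := by
  have h2 : 2 * l + 2 * k = 2 * 0 := by rw [← mul_add, h]
  obtain ⟨g, hg⟩ := (shiftFunctor C (2 * k)).map_surjective
    (inv f ≫ ShiftedHom.mk₀ (2 * 0) (mul_zero 2) (𝟙 X.as) ≫
      (shiftFunctorAdd' C (2 * l) (2 * k) (2 * 0) h2).hom.app X.as)
  refine ⟨g, ?_, ?_⟩
  · have : IsIso ((shiftFunctor C (2 * k)).map g) := by
      rw [hg]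
      unfold ShiftedHom.mk₀
      infer_instance
    exact isIso_of_reflects_iso g (shiftFunctor C (2 * k))
  · rw [homog_comp _ _ h, id_eq_homog, ShiftedHom.comp, hg]
    simp

lemma isIso_homog {X Y : Orbit C} (k : ℤ) (f : X.as ⟶ Y.as⟦2 * k⟧) [IsIso f] :
    IsIso (homog k f : X ⟶ Y) := by
  obtain ⟨g, hg, h⟩ := exists_rightInverse_homog (neg_add_cancel k) f
  -- A right inverse of the right inverse has to be the morphism itself.
  obtain ⟨f', hf', h'⟩ := exists_rightInverse_homog (X := Y) (Y := X) (add_neg_cancel k) g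
  refine ⟨homog _ g, h, ?_⟩
  have : (homog k f : X ⟶ Y) = homog k f' := by
    rw [← Category.comp_id (homog k f), ← h', reassoc_of% h]
  rw [this, h']

/-- Objects that differ by an even shift are isomorphic in the orbit category. -/
def isoOfShift {X Y : C} (k : ℤ) (e : X ≅ Y⟦2 * k⟧) : (Orbit.mk X) ≅ Orbit.mk Y :=
  have := isIso_homog (X := Orbit.mk X) (Y := Orbit.mk Y) k e.hom
  asIso (homog (X := Orbit.mk X) (Y := Orbit.mk Y) k e.hom)

variable (C) in
/-- The functor to the orbit category. -/
def proj : C ⥤ Orbit C where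
  obj X := ⟨X⟩
  map f := homog 0 (ShiftedHom.mk₀ (2 * 0) (mul_zero 2) f)
  map_comp f g := by
    rw [homog_comp _ _ (add_zero 0)]
    simp

instance : (proj C).Additive where
  map_add {X Y f g} := by
    change homog 0 _ = homog 0 _ + homog 0 _
    rw [ShiftedHom.mk₀_add, homog_add]
    rfl

end

/-! ### Functors between orbit categories -/

section Functoriality

variable {C C' : Type*} [Category* C] [Preadditive C] [HasShift C ℤ]
  [∀ n : ℤ, (shiftFunctor C n).Additive] [Category* C'] [Preadditive C'] [HasShift C' ℤ]
  [∀ n : ℤ, (shiftFunctor C' n).Additive] (F : C ⥤ C') [F.CommShift ℤ] [F.Additive]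

/-- The action on morphisms of a functor that commutes with the shift. -/
def mapHom (X Y : Orbit C) : (X ⟶ Y) →+ ((Orbit.mk (F.obj X.as)) ⟶ Orbit.mk (F.obj Y.as)) :=
  DirectSum.toAddMonoid fun k => AddMonoidHom.mk'
    (fun f : ShiftedHom X.as Y.as (2 * k) =>
      homog (X := Orbit.mk (F.obj X.as)) (Y := Orbit.mk (F.obj Y.as)) k (ShiftedHom.map f F))
    (fun f g => by rw [ShiftedHom.map_add, homog_add])

lemma mapHom_homog {X Y : Orbit C} (k : ℤ) (f : X.as ⟶ Y.as⟦2 * k⟧) :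
    mapHom F X Y (homog k f) = homog k (ShiftedHom.map f F) := by
  refine (DirectSum.toAddMonoid_of _ _ _).trans rfl

/-- The functor between orbit categories given by a functor that commutes with the shift. -/
def map : Orbit C ⥤ Orbit C' where
  obj X := ⟨F.obj X.as⟩
  map f := mapHom F _ _ f
  map_id X := by
    rw [id_eq_homog, mapHom_homog, ShiftedHom.map_mk₀, F.map_id]
    rfl
  map_comp {X Y Z} f g := by
    induction f using hom_induction with
    | h0 => simp
    | hadd f f' hf hf' => rw [Preadditive.add_comp, map_add, hf, hf', map_add, Preadditive.add_comp]
    | hof k f =>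
      induction g using hom_induction with
      | h0 => simp
      | hadd g g' hg hg' =>
        rw [Preadditive.comp_add, map_add, hg, hg', map_add, Preadditive.comp_add]
      | hof l g =>
        rw [homog_comp f g rfl, mapHom_homog, mapHom_homog, mapHom_homog, homog_comp _ _ rfl,
          ShiftedHom.map_comp]

lemma map_map_homog {X Y : Orbit C} (k : ℤ) (f : X.as ⟶ Y.as⟦2 * k⟧) :
    (map F).map (homog k f : X ⟶ Y) = homog k (ShiftedHom.map f F) := mapHom_homog F k f

instance : (map F).Additive where
  map_add {X Y f g} := map_add (mapHom F X Y) f g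

instance [F.Full] : (map F).Full where
  map_surjective {X Y} f := by
    induction f using hom_induction with
    | h0 => exact ⟨0, (map F).map_zero _ _⟩
    | hadd f g hf hg =>
      obtain ⟨f', rfl⟩ := hf
      obtain ⟨g', rfl⟩ := hg
      exact ⟨f' + g', (map F).map_add⟩
    | hof k f =>
      change F.obj X.as ⟶ (F.obj Y.as)⟦2 * k⟧ at f
      obtain ⟨g, hg⟩ := F.map_surjective (f ≫ (F.commShiftIso (2 * k)).inv.app Y.as)
      refine ⟨homog k g, ?_⟩
      have h : ShiftedHom.map g F = f := by
        rw [ShiftedHom.map, hg, Category.assoc, Iso.inv_hom_id_app]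
        exact Category.comp_id f
      rw [map_map_homog, h]
      rfl

/-- The functor acts on each degree separately, so faithfulness passes from `F` to the orbit
categories. -/
lemma coeff_mapHom (X Y : Orbit C) (f : X ⟶ Y) (k : ℤ) :
    coeff k (mapHom F X Y f) = ShiftedHom.map (coeff k f) F := by
  induction f using hom_induction with
  | h0 => rw [map_zero, map_zero, map_zero, ShiftedHom.map_zero]
  | hadd f g hf hg => rw [map_add, map_add, map_add, hf, hg, ← ShiftedHom.map_add]
  | hof l f =>
    rw [mapHom_homog]
    by_cases h : k = l
    · subst h
      rw [coeff_homog, coeff_homog]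
    · rw [coeff_homog_of_ne h, coeff_homog_of_ne h, ShiftedHom.map_zero]

instance [F.Faithful] : (map F).Faithful where
  map_injective {X Y} f g h := by
    refine hom_ext fun k => ?_
    have h' : coeff k (mapHom F X Y f) = coeff k (mapHom F X Y g) := congrArg _ h
    rw [coeff_mapHom, coeff_mapHom] at h'
    unfold ShiftedHom.map at h'
    rw [cancel_mono] at h'
    exact F.map_injective h'

end Functoriality

/-! ### The translation functor of the orbit category -/

section Translation

variable (C : Type*) [Category* C] [Preadditive C] [HasShift C ℤ]
  [∀ n : ℤ, (shiftFunctor C n).Additive]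

/-- The translation functor commutes with the shifts. -/
@[reducible]
def translationCommShift : (shiftFunctor C (1 : ℤ)).CommShift ℤ where
  commShiftIso a := (shiftFunctorComm C 1 a).symm
  commShiftIso_zero := by
    refine Iso.symm_eq_iff.1 ?_
    ext X
    simp [shiftFunctorComm_zero_hom_app]
  commShiftIso_add a b := by
    refine Iso.symm_eq_iff.1 ?_
    ext X
    have := shiftFunctorComm_hom_app_comp_shift_shiftFunctorAdd_hom_app (1 : ℤ) a b X
    rw [← cancel_mono (((shiftFunctorAdd C a b).hom.app X)⟦(1 : ℤ)⟧')]
    simpa [← Functor.map_comp] using this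

/-- The translation functor of the orbit category. -/
def translation : Orbit C ⥤ Orbit C :=
  letI := translationCommShift C
  map (shiftFunctor C (1 : ℤ))

instance : (translation C).Additive :=
  letI := translationCommShift C
  inferInstanceAs (map (shiftFunctor C (1 : ℤ))).Additive

instance : (translation C).Full :=
  letI := translationCommShift C
  inferInstanceAs (map (shiftFunctor C (1 : ℤ))).Full

instance : (translation C).Faithful :=
  letI := translationCommShift C
  inferInstanceAs (map (shiftFunctor C (1 : ℤ))).Faithful

variable {C}

/-- The square of the translation functor is the identity on objects. -/
def translationTranslationIso (X : Orbit C) : (translation C).obj ((translation C).obj X) ≅ X :=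
  isoOfShift 1 ((shiftFunctorAdd' C (1 : ℤ) 1 (2 * 1) (by norm_num)).symm.app X.as)

end Translation

end Orbit

/-! ### Linear algebra -/

section LinearAlgebra

variable {K : Type*} [Field K] {E F : Type*} [AddCommGroup E] [Module K E] [AddCommGroup F]
  [Module K F]

lemma exists_functional_comp_eq (g : E →ₗ[K] F) (l : E →ₗ[K] K) (h : LinearMap.ker g ≤ LinearMap.ker l) :
    ∃ m : F →ₗ[K] K, m ∘ₗ g = l := by
  have : l ∈ LinearMap.range g.dualMap := by
    rw [LinearMap.range_dualMap_eq_dualAnnihilator_ker, Submodule.mem_dualAnnihilator]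
    exact fun w hw => h hw
  exact this

lemma exists_functional_eq_one {B : Submodule K E} {x : E} (hx : x ∉ B) :
    ∃ l : E →ₗ[K] K, l x = 1 ∧ ∀ v ∈ B, l v = 0 := by
  obtain ⟨f, hf, hB⟩ := Submodule.exists_dual_map_eq_bot_of_notMem hx inferInstance
  refine ⟨(f x)⁻¹ • f, by simp [hf], fun v hv => ?_⟩
  have : f v ∈ B.map f := ⟨v, hv, rfl⟩
  rw [hB, Submodule.mem_bot] at this
  simp [this]

end LinearAlgebra

namespace SRep

variable {K : Type u} [Field K]

/-! ### Thin super-representations -/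

section Thin

/-- `K` if `P` holds and `0` otherwise. -/
def box (K : Type u) [Field K] (P : Prop) : Submodule K K where
  carrier := {v | ¬P → v = 0}
  add_mem' ha hb h := by rw [ha h, hb h, add_zero]
  zero_mem' _ := rfl
  smul_mem' c x hx h := by rw [hx h, smul_zero]

/-- An element of a box. -/
def boxMk {P : Prop} (h : P) (v : K) : box K P := ⟨v, fun h' => absurd h h'⟩

lemma box_eq_zero {P : Prop} (h : ¬P) (v : box K P) : v = 0 := Subtype.ext (v.2 h)

open Classical in
/-- Multiplication by a scalar, as a map between boxes. -/
def boxMap (P Q : Prop) (c : K) : box K P →ₗ[K] box K Q where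
  toFun v := ⟨if Q then c * v else 0, fun h => if_neg h⟩
  map_add' v w := by ext; by_cases h : Q <;> simp [h, mul_add]
  map_smul' r v := by ext; by_cases h : Q <;> simp [h, mul_left_comm]

lemma boxMap_apply {P Q : Prop} (c : K) (h : Q) (v : box K P) : (boxMap P Q c v : K) = c * v :=
  if_pos h

open Classical in
/-- The scalar by which a map between boxes multiplies. -/
def boxCoeff {P Q : Prop} (φ : box K P →ₗ[K] box K Q) : K := if h : P then φ (boxMk h 1) else 0

lemma boxCoeff_mul {P Q : Prop} (φ : box K P →ₗ[K] box K Q) (v : box K P) :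
    (φ v : K) = boxCoeff φ * v := by
  by_cases h : P
  · have : v = (v : K) • boxMk h 1 := by ext; simp [boxMk]
    conv_lhs => rw [this]
    rw [map_smul, boxCoeff, dif_pos h, Submodule.coe_smul, smul_eq_mul, mul_comm]
  · rw [box_eq_zero h v, map_zero, Submodule.coe_zero, Submodule.coe_zero, mul_zero]

lemma boxCoeff_eq_zero {P Q : Prop} (φ : box K P →ₗ[K] box K Q) (h : ¬(P ∧ Q)) :
    boxCoeff φ = 0 := by
  by_cases hP : P
  · rw [boxCoeff, dif_pos hP]
    exact (φ _).2 fun hQ => h ⟨hP, hQ⟩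
  · rw [boxCoeff, dif_neg hP]

lemma box_hom_ext {P Q : Prop} {φ ψ : box K P →ₗ[K] box K Q} (h : boxCoeff φ = boxCoeff ψ) :
    φ = ψ := by
  ext v
  rw [boxCoeff_mul, boxCoeff_mul, h]

lemma boxCoeff_boxMap {P Q : Prop} (hP : P) (hQ : Q) (c : K) : boxCoeff (boxMap P Q c) = c := by
  rw [boxCoeff, dif_pos hP, boxMap_apply c hQ, boxMk, mul_one]

lemma boxCoeff_comp {P Q R : Prop} (φ : box K P →ₗ[K] box K Q) (ψ : box K Q →ₗ[K] box K R) :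
    boxCoeff (ψ ∘ₗ φ) = boxCoeff ψ * boxCoeff φ := by
  by_cases h : P
  · rw [boxCoeff, dif_pos h, LinearMap.comp_apply, boxCoeff_mul, boxCoeff_mul, boxMk, mul_one]
  · rw [boxCoeff_eq_zero (ψ ∘ₗ φ) (fun h' => h h'.1), boxCoeff_eq_zero φ (fun h' => h h'.1),
      mul_zero]

lemma boxCoeff_sub {P Q : Prop} (φ ψ : box K P →ₗ[K] box K Q) :
    boxCoeff (φ - ψ) = boxCoeff φ - boxCoeff ψ := by
  by_cases h : P
  · simp [boxCoeff, h]
  · simp [boxCoeff, h]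

lemma boxCoeff_add {P Q : Prop} (φ ψ : box K P →ₗ[K] box K Q) :
    boxCoeff (φ + ψ) = boxCoeff φ + boxCoeff ψ := by
  by_cases h : P
  · simp [boxCoeff, h]
  · simp [boxCoeff, h]

lemma boxCoeff_smul {P Q : Prop} (c : K) (φ : box K P →ₗ[K] box K Q) :
    boxCoeff (c • φ) = c * boxCoeff φ := by
  by_cases h : P
  · simp [boxCoeff, h]
  · simp [boxCoeff, h]

lemma boxCoeff_id {P : Prop} (h : P) : boxCoeff (LinearMap.id : box K P →ₗ[K] box K P) = 1 := by
  rw [boxCoeff, dif_pos h]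
  rfl

lemma boxCoeff_zero {P Q : Prop} : boxCoeff (0 : box K P →ₗ[K] box K Q) = 0 := by
  simp [boxCoeff]

variable {V : Type} {Γ : SimpleGraph V}

variable (K) in
/-- The super-representation that is `K` at the vertices in `S`, with identity maps between them. -/
def thin (D : ColouredQuiver Γ) (S : V → Prop) : SRep K D :=
  ofMaps (fun i => box K (S i)) (fun i j _ => boxMap (S i) (S j) 1)

end Thin

/-! ### Representations of a line -/

section Line

variable {ℓ : ℕ} {Γ : SimpleGraph (Fin ℓ)} {D : ColouredQuiver Γ}

/-- Compatible families of vectors and of functionals on the interval `[a, b)`, as seen from the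
vertices `≥ a`. -/
structure IsChain (X : SRep K D) (a b : ℕ) (x : ∀ i, X.obj i) (l : ∀ i, X.obj i →ₗ[K] K) :
    Prop where
  lt : a < b
  le : b ≤ ℓ
  apply_eq_one : ∀ i : Fin ℓ, a ≤ i → i < b → l i (x i) = 1
  vec_eq_zero : ∀ i : Fin ℓ, ¬(a ≤ i ∧ i < b) → x i = 0
  fun_eq_zero : ∀ i : Fin ℓ, ¬(a ≤ i ∧ i < b) → l i = 0
  map_vec : ∀ (i k : Fin ℓ) (h : D.arrow i k), a ≤ i → a ≤ k → i < b → X.map h (x i) = x k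
  comp_map : ∀ (i k : Fin ℓ) (h : D.arrow i k), a ≤ i → a ≤ k → k < b →
    ∀ v, l k (X.map h v) = l i v

variable (hΓ : ∀ i j : Fin ℓ, Γ.Adj i j ↔ i.val + 1 = j.val ∨ j.val + 1 = i.val)

include hΓ in
lemma arrow_cases {i j : Fin ℓ} (h : D.arrow i j) : i.val + 1 = j.val ∨ j.val + 1 = i.val :=
  (hΓ i j).1 ((D.adj_iff i j).2 (Or.inl h))

include hΓ in
-- The conditions on a chain are not symmetric. A vector that leaves the interval on the right has
-- to die, and a functional has to kill what enters from the right; the arrows to the left of the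
-- starting vertex are not tested at all.
lemma isChain_single (X : SRep K D) (j : Fin ℓ) (x : X.obj j) (l : X.obj j →ₗ[K] K)
    (hx : l x = 1) (h1 : ∀ (k : Fin ℓ) (h : D.arrow j k), j.val + 1 = k → X.map h x = 0)
    (h2 : ∀ (k : Fin ℓ) (h : D.arrow k j), j.val + 1 = k → ∀ v, l (X.map h v) = 0) :
    IsChain X j (j + 1) (Pi.single j x) (Pi.single j l) where
  lt := by omega
  le := by omega
  apply_eq_one i h h' := by
    obtain rfl : i = j := Fin.ext (by omega)
    simpa using hx
  vec_eq_zero i h := Pi.single_eq_of_ne (fun h' => h (by subst h'; omega)) _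
  fun_eq_zero i h := Pi.single_eq_of_ne (fun h' => h (by subst h'; omega)) _
  map_vec i k h hi hk hib := by
    obtain rfl : i = j := Fin.ext (by omega)
    have := arrow_cases hΓ h
    rw [Pi.single_eq_same, Pi.single_eq_of_ne (fun h' => by subst h'; omega)]
    exact h1 k h (by omega)
  comp_map i k h hi hk hkb v := by
    obtain rfl : k = j := Fin.ext (by omega)
    have := arrow_cases hΓ h
    rw [Pi.single_eq_same, Pi.single_eq_of_ne (fun h' => by subst h'; omega)]
    exact h2 i h (by omega) v

include hΓ in
lemma IsChain.cons {X : SRep K D} {j j' : Fin ℓ} (hj : j.val + 1 = j') {b : ℕ}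
    {x : ∀ i, X.obj i} {l : ∀ i, X.obj i →ₗ[K] K} (hc : IsChain X j' b x l)
    (x₀ : X.obj j) (l₀ : X.obj j →ₗ[K] K) (hx : l₀ x₀ = 1)
    (h1 : ∀ h : D.arrow j j', X.map h x₀ = x j')
    (h1' : ∀ h : D.arrow j' j, X.map h (x j') = x₀)
    (h2 : ∀ h : D.arrow j j', ∀ v, l j' (X.map h v) = l₀ v)
    (h2' : ∀ h : D.arrow j' j, ∀ v, l₀ (X.map h v) = l j' v) :
    IsChain X j b (Function.update x j x₀) (Function.update l j l₀) where
  lt := by have := hc.lt; omega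
  le := hc.le
  apply_eq_one i h h' := by
    by_cases hi : i = j
    · subst hi; simpa using hx
    · have : i.val ≠ j := fun h => hi (Fin.ext h)
      rw [Function.update_of_ne hi, Function.update_of_ne hi]
      exact hc.apply_eq_one i (by omega) h'
  vec_eq_zero i h := by
    have := hc.lt
    rw [Function.update_of_ne (fun h' => h (by subst h'; omega))]
    exact hc.vec_eq_zero i (by omega)
  fun_eq_zero i h := by
    have := hc.lt
    rw [Function.update_of_ne (fun h' => h (by subst h'; omega))]
    exact hc.fun_eq_zero i (by omega)
  map_vec i k h hi hk hib := by
    have := arrow_cases hΓ h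
    by_cases hij : i = j
    · subst hij
      obtain rfl : k = j' := Fin.ext (by omega)
      rw [Function.update_self, Function.update_of_ne (fun h' => by subst h'; omega)]
      exact h1 h
    · rw [Function.update_of_ne hij]
      have : i.val ≠ j := fun h => hij (Fin.ext h)
      by_cases hkj : k = j
      · subst hkj
        obtain rfl : i = j' := Fin.ext (by omega)
        rw [Function.update_self]
        exact h1' h
      · have : k.val ≠ j := fun h => hkj (Fin.ext h)
        rw [Function.update_of_ne hkj]
        exact hc.map_vec i k h (by omega) (by omega) hib
  comp_map i k h hi hk hkb v := by
    have := arrow_cases hΓ h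
    by_cases hij : i = j
    · subst hij
      obtain rfl : k = j' := Fin.ext (by omega)
      rw [Function.update_self, Function.update_of_ne (fun h' => by subst h'; omega)]
      exact h2 h v
    · rw [Function.update_of_ne hij]
      have : i.val ≠ j := fun h => hij (Fin.ext h)
      by_cases hkj : k = j
      · subst hkj
        obtain rfl : i = j' := Fin.ext (by omega)
        rw [Function.update_self]
        exact h2' h v
      · have : k.val ≠ j := fun h => hkj (Fin.ext h)
        rw [Function.update_of_ne hkj]
        exact hc.comp_map i k h (by omega) (by omega) hkb v

include hΓ in
-- Induction from the right end, for a proper inclusion of `B` in `A`. Along an arrow `j → j'`,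
-- either some vector of `A` outside `B` dies, and the chain stops there, or the images of `A` and
-- `B` are still different. Along an arrow `j' → j`, either `A` is not contained in the sum of `B`
-- and the image, and the chain stops, or the preimages of `A` and `B` are still different. Keeping
-- `x j` in `A` and `l j` zero on `B` is what allows the chain found at `j'` to be prolonged to `j`.
lemma exists_isChain_aux (X : SRep K D) (d : ℕ) : ∀ (j : Fin ℓ) (_ : j.val + d + 1 = ℓ)
    (A B : Submodule K (X.obj j)) (_ : B ≤ A) (_ : ¬ A ≤ B),
    ∃ b x l, IsChain X j b x l ∧ x j ∈ A ∧ ∀ v ∈ B, l j v = 0 := by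
  induction d with
  | zero =>
    intro j hj A B hBA hAB
    obtain ⟨x, hxA, hxB⟩ := SetLike.not_le_iff_exists.1 hAB
    obtain ⟨l, hl, hlB⟩ := exists_functional_eq_one hxB
    refine ⟨j + 1, _, _, isChain_single hΓ X j x l hl (fun k => by omega) (fun k => by omega), ?_, ?_⟩
    · rwa [Pi.single_eq_same]
    · rwa [Pi.single_eq_same]
  | succ d ih =>
    intro j hj A B hBA hAB
    obtain ⟨j', hj'⟩ : ∃ j' : Fin ℓ, j.val + 1 = j' := ⟨⟨j + 1, by omega⟩, rfl⟩
    have huniq : ∀ k : Fin ℓ, j.val + 1 = k → k = j' := fun k hk => Fin.ext (by omega)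
    have hne : j ≠ j' := fun h => by subst h; omega
    rcases (D.adj_iff j j').1 ((hΓ j j').2 (Or.inl hj')) with h | h
    · have hno := D.asymm _ _ h
      by_cases hA : A ⊓ LinearMap.ker (X.map h) ≤ B
      · have hAB' : ¬ A.map (X.map h) ≤ B.map (X.map h) := by
          intro hle
          refine hAB fun v hv => ?_
          obtain ⟨w, hw, hwv⟩ := hle ⟨v, hv, rfl⟩
          have hvw : v - w ∈ A ⊓ LinearMap.ker (X.map h) :=
            Submodule.mem_inf.2 ⟨sub_mem hv (hBA hw), LinearMap.mem_ker.2 (by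
              rw [map_sub, hwv, sub_self])⟩
          simpa using add_mem (hA hvw) hw
        obtain ⟨b, x, l, hc, hx, hl⟩ := ih j' (by omega) _ _ (Submodule.map_mono hBA) hAB'
        obtain ⟨x₀, hx₀, hx₀'⟩ := hx
        refine ⟨b, _, _, hc.cons hΓ hj' x₀ (l j' ∘ₗ X.map h) ?_ (fun _ => hx₀')
          (fun h' => absurd h' hno) (fun _ _ => rfl) (fun h' => absurd h' hno), ?_, ?_⟩
        · rw [LinearMap.comp_apply, hx₀']
          exact hc.apply_eq_one j' le_rfl hc.lt
        · rwa [Function.update_self]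
        · rw [Function.update_self]
          exact fun v hv => hl _ ⟨v, hv, rfl⟩
      · obtain ⟨x, hxA, hxB⟩ := SetLike.not_le_iff_exists.1 hA
        obtain ⟨l, hl, hlB⟩ := exists_functional_eq_one hxB
        refine ⟨j + 1, _, _, isChain_single hΓ X j x l hl (fun k hk hjk => ?_)
          (fun k hk hjk => ?_), ?_, ?_⟩
        · obtain rfl := huniq k hjk
          exact hxA.2
        · obtain rfl := huniq k hjk
          exact absurd hk hno
        · rw [Pi.single_eq_same]; exact hxA.1
        · rwa [Pi.single_eq_same]
    · have hno := D.asymm _ _ h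
      by_cases hA : A ≤ B ⊔ LinearMap.range (X.map h)
      · have hAB' : ¬ A.comap (X.map h) ≤ B.comap (X.map h) := by
          intro hle
          refine hAB fun v hv => ?_
          obtain ⟨w, hw, _, ⟨y, rfl⟩, rfl⟩ := Submodule.mem_sup.1 (hA hv)
          have hy : y ∈ A.comap (X.map h) := by
            have := sub_mem hv (hBA hw)
            rwa [add_sub_cancel_left] at this
          exact add_mem hw (hle hy)
        obtain ⟨b, x, l, hc, hx, hl⟩ := ih j' (by omega) _ _
          (Submodule.comap_mono hBA) hAB'
        -- The functional at `j'` vanishes on the preimage of `B`, so it factors through the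
        -- quotient by `B`.
        obtain ⟨m, hm⟩ := exists_functional_comp_eq (B.mkQ ∘ₗ X.map h) (l j') (fun v hv => by
          refine hl v ?_
          rwa [LinearMap.mem_ker, LinearMap.comp_apply, Submodule.mkQ_apply,
            Submodule.Quotient.mk_eq_zero] at hv)
        refine ⟨b, _, _, hc.cons hΓ hj' (X.map h (x j')) (m ∘ₗ B.mkQ) ?_
          (fun h' => absurd h' hno) (fun _ => rfl) (fun h' => absurd h' hno)
          (fun _ v => LinearMap.congr_fun hm v), ?_, ?_⟩
        · exact (LinearMap.congr_fun hm _).trans (hc.apply_eq_one j' le_rfl hc.lt)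
        · rw [Function.update_self]
          exact hx
        · rw [Function.update_self]
          intro v hv
          rw [LinearMap.comp_apply, Submodule.mkQ_apply, (Submodule.Quotient.mk_eq_zero B).2 hv,
            map_zero]
      · obtain ⟨x, hxA, hxB⟩ := SetLike.not_le_iff_exists.1 hA
        obtain ⟨l, hl, hlB⟩ := exists_functional_eq_one hxB
        refine ⟨j + 1, _, _, isChain_single hΓ X j x l hl (fun k hk hjk => ?_)
          (fun k hk hjk v => ?_), ?_, ?_⟩
        · obtain rfl := huniq k hjk
          exact absurd hk hno
        · obtain rfl := huniq k hjk
          exact hlB _ (Submodule.mem_sup_right ⟨v, rfl⟩)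
        · rwa [Pi.single_eq_same]
        · rw [Pi.single_eq_same]
          exact fun v hv => hlB v (Submodule.mem_sup_left hv)

variable (K D) in
/-- The interval module with support `[a, b)`. -/
abbrev interval (a b : ℕ) : SRep K D := thin K D (fun i : Fin ℓ => a ≤ i.val ∧ i.val < b)

include hΓ in
/-- A nonzero super-representation has a chain that splits off. -/
lemma exists_isChain (X : SRep K D) (hX : ∃ i, Nontrivial (X.obj i)) :
    ∃ (a : Fin ℓ) (b : ℕ) (x : ∀ i, X.obj i) (l : ∀ i, X.obj i →ₗ[K] K), IsChain X a b x l ∧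
      ∀ i : Fin ℓ, i < a → Subsingleton (X.obj i) := by
  classical
  have hX' : ∃ i : ℕ, ∃ h : i < ℓ, Nontrivial (X.obj ⟨i, h⟩) :=
    let ⟨i, hi⟩ := hX; ⟨i, i.2, hi⟩
  obtain ⟨ha, hn⟩ := Nat.find_spec hX'
  -- At the first vertex where `X` is nonzero the whole space and zero may be taken: nothing to the
  -- left can obstruct the splitting.
  obtain ⟨b, x, l, hc, -, -⟩ := exists_isChain_aux hΓ X (ℓ - 1 - Nat.find hX') ⟨Nat.find hX', ha⟩
    (by simp only; omega) ⊤ ⊥ bot_le (by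
      rw [top_le_iff]
      exact bot_ne_top)
  refine ⟨⟨Nat.find hX', ha⟩, b, x, l, hc, fun i hi => ?_⟩
  have := Nat.find_min hX' (Fin.lt_def.1 hi)
  push Not at this
  exact not_nontrivial_iff_subsingleton.1 (fun h => absurd h (not_nontrivial_iff_subsingleton.2 (this i.2)))

section Split

variable {X : SRep K D} {a : Fin ℓ} {b : ℕ} {x : ∀ i, X.obj i} {l : ∀ i, X.obj i →ₗ[K] K}

/-- The inclusion of an interval module given by a chain. -/
def IsChain.incl (hc : IsChain X a b x l) (ha : ∀ i : Fin ℓ, i < a → Subsingleton (X.obj i)) :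
    interval K D a b ⟶ X :=
  mkHom (fun i => (LinearMap.toSpanSingleton K _ (x i)) ∘ₗ (Submodule.subtype _)) (by
    intro i j h
    refine LinearMap.ext fun v => ?_
    change box K (a.val ≤ i.val ∧ i.val < b) at v
    change (boxMap _ _ (1 : K) v : K) • x j = X.map h ((v : K) • x i)
    by_cases hi : a.val ≤ i.val ∧ i.val < b
    · by_cases hj : a.val ≤ j.val ∧ j.val < b
      · rw [boxMap_apply _ hj, one_mul, map_smul, hc.map_vec i j h hi.1 hj.1 hi.2]
      · rw [hc.vec_eq_zero j hj, smul_zero, map_smul]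
        by_cases haj : a.val ≤ j.val
        · rw [hc.map_vec i j h hi.1 haj hi.2, hc.vec_eq_zero j hj, smul_zero]
        · have := ha j (Fin.lt_def.2 (by omega))
          exact Subsingleton.elim _ _
    · rw [box_eq_zero hi v]
      simp)

/-- The functionals of a chain, as maps to an interval module. -/
def IsChain.projMap (hc : IsChain X a b x l) (i : Fin ℓ) :
    X.obj i →ₗ[K] box K (a.val ≤ i.val ∧ i.val < b) :=
  (l i).codRestrict _ (fun v => show ¬_ → l i v = 0 from fun hi => by
    rw [hc.fun_eq_zero i hi]; rfl)

/-- The projection to an interval module given by a chain. -/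
def IsChain.proj (hc : IsChain X a b x l) (ha : ∀ i : Fin ℓ, i < a → Subsingleton (X.obj i)) :
    X ⟶ interval K D a b :=
  mkHom (fun i => hc.projMap i) (by
    intro i j h
    refine LinearMap.ext fun v => Subtype.ext ?_
    change l j (X.map h v) = (boxMap (a.val ≤ i.val ∧ i.val < b) (a.val ≤ j.val ∧ j.val < b) 1
      (hc.projMap i v) : K)
    by_cases hj : a.val ≤ j.val ∧ j.val < b
    · rw [boxMap_apply _ hj, one_mul]
      change _ = l i v
      by_cases hai : a.val ≤ i.val
      · exact hc.comp_map i j h hai hj.1 hj.2 v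
      · have := ha i (Fin.lt_def.2 (by omega))
        rw [Subsingleton.elim v 0, map_zero, map_zero, map_zero]
    · rw [hc.fun_eq_zero j hj, box_eq_zero hj (boxMap _ _ _ _)]
      rfl)

lemma IsChain.incl_proj (hc : IsChain X a b x l)
    (ha : ∀ i : Fin ℓ, i < a → Subsingleton (X.obj i)) : hc.incl ha ≫ hc.proj ha = 𝟙 _ := by
  refine hom_ext fun i => LinearMap.ext fun v => Subtype.ext ?_
  change box K (a.val ≤ i.val ∧ i.val < b) at v
  change l i ((v : K) • x i) = v
  by_cases hi : a.val ≤ i.val ∧ i.val < b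
  · rw [map_smul, hc.apply_eq_one i hi.1 hi.2, smul_eq_mul, mul_one]
  · rw [box_eq_zero hi v]
    simp

end Split

/-- A split monomorphism gives a direct sum decomposition. -/
lemma isDirectSum_kernelRep {V : Type} {Γ : SimpleGraph V} {D : ColouredQuiver Γ} {X M : SRep K D}
    (i : M ⟶ X) (p : X ⟶ M) (h : i ≫ p = 𝟙 M) : IsDirectSum X M (kernelRep p) := by
  have h' : ∀ k v, app p k (app i k v) = v := fun k v =>
    LinearMap.congr_fun (congrArg (fun t => app t k) h) v
  let q' : ∀ k, X.obj k →ₗ[K] (kernelRep p).obj k := fun k =>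
    (LinearMap.id - app i k ∘ₗ app p k).codRestrict (LinearMap.ker (app p k)) (fun v => by
      change app p k (v - app i k (app p k v)) = 0
      rw [map_sub, h', sub_self])
  let q : X ⟶ kernelRep p := mkHom q' (by
    intro k k' a
    refine LinearMap.ext fun v => Subtype.ext ?_
    change X.map a v - app i k' (app p k' (X.map a v)) = X.map a (v - app i k (app p k v))
    rw [map_sub, app_map, app_map])
  refine ⟨i, p, kernelRepι p, q, h, ?_, ?_, ?_, ?_⟩
  · refine hom_ext fun k => LinearMap.ext fun v => Subtype.ext ?_
    change v.1 - app i k (app p k v.1) = v.1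
    rw [show app p k v.1 = 0 from v.2, map_zero, sub_zero]
  · refine hom_ext fun k => LinearMap.ext fun v => Subtype.ext ?_
    change app i k v - app i k (app p k (app i k v)) = 0
    rw [h', sub_self]
  · exact hom_ext fun k => LinearMap.ext fun v => v.2
  · refine hom_ext fun k => LinearMap.ext fun v => ?_
    change app i k (app p k v) + (v - app i k (app p k v)) = v
    abel

lemma isZero_of_subsingleton {V : Type} {Γ : SimpleGraph V} {D : ColouredQuiver Γ} (X : SRep K D)
    (h : ∀ i, Subsingleton (X.obj i)) : IsZero X := by
  rw [IsZero.iff_id_eq_zero]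
  exact hom_ext fun i => LinearMap.ext fun v => (h i).elim _ _

include hΓ in
-- Induction on the total dimension: the complement of the interval module that splits off is
-- strictly smaller at the vertex `a`.
lemma finSum_interval_aux (N : ℕ) : ∀ (X : SRep K D) (_ : ∑ i, Module.finrank K (X.obj i) = N),
    FinSum (fun M => ∃ a b, a < b ∧ b ≤ ℓ ∧ M = interval K D a b) X := by
  induction N using Nat.strong_induction_on with
  | _ N ih =>
    intro X hN
    by_cases hX : ∃ i, Nontrivial (X.obj i)
    · obtain ⟨a, b, x, l, hc, ha⟩ := exists_isChain hΓ X hX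
      refine .sum (isDirectSum_kernelRep _ _ (hc.incl_proj ha))
        (.of ⟨a, b, hc.lt, hc.le, rfl⟩ (Iso.refl _)) (ih _ ?_ _ rfl)
      rw [← hN]
      have hle : ∀ i, Module.finrank K ((kernelRep (hc.proj ha)).obj i) ≤
          Module.finrank K (X.obj i) := fun i => Submodule.finrank_le (LinearMap.ker _)
      refine Finset.sum_lt_sum (fun i _ => hle i) ⟨a, Finset.mem_univ _, ?_⟩
      refine Submodule.finrank_lt (s := LinearMap.ker (app (hc.proj ha) a)) (fun h => ?_)
      have h1 : x a ∈ LinearMap.ker (app (hc.proj ha) a) := h ▸ Submodule.mem_top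
      have h2 : l a (x a) = 0 := congrArg Subtype.val h1
      rw [hc.apply_eq_one a le_rfl hc.lt] at h2
      exact one_ne_zero h2
    · push Not at hX
      exact .zero (isZero_of_subsingleton X (fun i => not_nontrivial_iff_subsingleton.1
        (fun h => absurd h (not_nontrivial_iff_subsingleton.2 (hX i)))))

include hΓ in
/-- Every super-representation of a line is a direct sum of interval modules. -/
lemma finSum_interval (X : SRep K D) :
    FinSum (fun M => ∃ a b, a < b ∧ b ≤ ℓ ∧ M = interval K D a b) X :=
  finSum_interval_aux hΓ _ X rfl

/-- `X` is one-dimensional on `[a, b)` with injective maps there, and zero elsewhere. -/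
structure IsIntervalLike (X : SRep K D) (a b : ℕ) : Prop where
  lt : a < b
  le : b ≤ ℓ
  finrank_eq : ∀ i : Fin ℓ, Module.finrank K (X.obj i) = if a ≤ i.val ∧ i.val < b then 1 else 0
  injective : ∀ (i j : Fin ℓ) (h : D.arrow i j), (a ≤ i.val ∧ i.val < b) →
    (a ≤ j.val ∧ j.val < b) → Function.Injective (X.map h)

include hΓ in
-- Some interval module splits off, and its support lies in `[a, b)`. It starts at `a`, the first
-- vertex where `X` is nonzero, and injectivity of the maps inside `[a, b)` does not let it stop
-- before `b`. Since the spaces have dimension at most one, the split inclusion is then bijective.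
lemma IsIntervalLike.nonempty_iso {X : SRep K D} {a b : ℕ} (h : IsIntervalLike X a b) :
    Nonempty (X ≅ interval K D a b) := by
  have hnt : ∀ i : Fin ℓ, Nontrivial (X.obj i) ↔ a ≤ i.val ∧ i.val < b := by
    intro i
    rw [← Module.finrank_pos_iff (R := K), h.finrank_eq]
    split_ifs with h' <;> simp [h']
  have hlt := h.lt
  have hle := h.le
  obtain ⟨a', b', x, l, hc, ha⟩ := exists_isChain hΓ X ⟨⟨a, by omega⟩, (hnt _).2 ⟨le_rfl, hlt⟩⟩
  have hx : ∀ i : Fin ℓ, a'.val ≤ i → i.val < b' → a ≤ i.val ∧ i.val < b := fun i h1 h2 =>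
    (hnt i).1 ⟨x i, 0, fun h0 => by
      have := hc.apply_eq_one i h1 h2
      rw [h0, map_zero] at this
      exact zero_ne_one this⟩
  have hlt' := hc.lt
  have hle' := hc.le
  have h1 := hx a' le_rfl hlt'
  have ha' : a'.val = a := by
    by_contra hne
    have h2 := ha ⟨a, by omega⟩ (Fin.lt_def.2 (by simp only; omega))
    exact not_nontrivial_iff_subsingleton.2 h2 ((hnt _).2 ⟨le_rfl, hlt⟩)
  have hb' : b' = b := by
    have h2 := hx ⟨b' - 1, by omega⟩ (by simp only; omega) (by simp only; omega)
    simp only at h2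
    by_contra hne
    obtain ⟨i, hi⟩ : ∃ i : Fin ℓ, i.val = b' - 1 := ⟨⟨b' - 1, by omega⟩, rfl⟩
    obtain ⟨j, hj⟩ : ∃ j : Fin ℓ, j.val = b' := ⟨⟨b', by omega⟩, rfl⟩
    have hii : a ≤ i.val ∧ i.val < b := by omega
    have hjj : a ≤ j.val ∧ j.val < b := by omega
    have hli := hc.apply_eq_one i (by omega) (by omega)
    -- If the chain stopped at `b' < b`, then, according to the direction of the arrow between `b' -
    -- 1` and `b'`, either the vector at `b' - 1` would be killed by an injective map, or the
    -- functional there would vanish on the image of an injective map, which is the whole line.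
    rcases (D.adj_iff i j).1 ((hΓ i j).2 (Or.inl (by omega))) with har | har
    · have h3 := hc.map_vec i j har (by omega) (by omega) (by omega)
      rw [hc.vec_eq_zero j (by omega)] at h3
      rw [h.injective i j har hii hjj (h3.trans (map_zero _).symm), map_zero] at hli
      exact zero_ne_one hli
    · obtain ⟨v, hv⟩ := @exists_ne _ ((hnt j).2 hjj) (0 : X.obj j)
      have h3 := hc.comp_map j i har (by omega) (by omega) (by omega) v
      rw [hc.fun_eq_zero j (by omega)] at h3
      have h4 : X.map har v ≠ 0 := fun h0 =>
        hv (h.injective j i har hjj hii (h0.trans (map_zero _).symm))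
      have h5 : Module.finrank K (X.obj i) = 1 := by rw [h.finrank_eq, if_pos hii]
      obtain ⟨c, hc'⟩ := (finrank_eq_one_iff_of_nonzero' _ h4).1 h5 (x i)
      rw [← hc', map_smul, h3] at hli
      simp at hli
  subst hb' ha'
  have hinj : ∀ i, Function.Injective (app (hc.incl ha) i) := fun i =>
    Function.LeftInverse.injective (g := app (hc.proj ha) i) (fun v =>
      LinearMap.congr_fun (congrArg (fun t => app t i) (hc.incl_proj ha)) v)
  have : IsIso (hc.incl ha) := by
    refine isIso_of_bijective _ fun i => ⟨hinj i, ?_⟩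
    by_cases hi : a'.val ≤ i.val ∧ i.val < b'
    · intro v
      have hx0 : x i ≠ 0 := fun h0 => by
        have := hc.apply_eq_one i hi.1 hi.2
        rw [h0, map_zero] at this
        exact zero_ne_one this
      obtain ⟨c, hc'⟩ := (finrank_eq_one_iff_of_nonzero' _ hx0).1
        (by rw [h.finrank_eq, if_pos hi]) v
      exact ⟨boxMk hi c, hc'⟩
    · have : Subsingleton (X.obj i) := not_nontrivial_iff_subsingleton.1 (fun h => hi ((hnt i).1 h))
      exact fun v => ⟨0, Subsingleton.elim _ _⟩
  exact ⟨(asIso (hc.incl ha)).symm⟩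

end Line

end SRep

namespace SRep

variable {K : Type u} [Field K]

/-! ### Morphisms and cochains of thin super-representations as families of scalars -/

section Thin

variable {V : Type} {Γ : SimpleGraph V} {D : ColouredQuiver Γ} {S S' S'' : V → Prop}

/-- The scalar by which a morphism between thin super-representations acts at a vertex. -/
def thinCoeff (f : thin K D S ⟶ thin K D S') (i : V) : K :=
  boxCoeff (P := S i) (Q := S' i) (app f i)

lemma thinCoeff_eq_zero (f : thin K D S ⟶ thin K D S') {i : V} (h : ¬(S i ∧ S' i)) :
    thinCoeff f i = 0 := boxCoeff_eq_zero _ h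

lemma thin_hom_ext {f g : thin K D S ⟶ thin K D S'} (h : ∀ i, thinCoeff f i = thinCoeff g i) :
    f = g := hom_ext fun i => box_hom_ext (P := S i) (Q := S' i) (h i)

lemma thinCoeff_zero (i : V) : thinCoeff (0 : thin K D S ⟶ thin K D S') i = 0 :=
  boxCoeff_zero (P := S i) (Q := S' i)

lemma thinCoeff_comp (f : thin K D S ⟶ thin K D S') (g : thin K D S' ⟶ thin K D S'') (i : V) :
    thinCoeff (f ≫ g) i = thinCoeff g i * thinCoeff f i :=
  boxCoeff_comp (P := S i) (Q := S' i) (R := S'' i) _ _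

lemma thinCoeff_scalar (c : K) {i : V} (h : S i) : thinCoeff (scalar (thin K D S) c) i = c := by
  refine (boxCoeff_smul (P := S i) (Q := S i) c LinearMap.id).trans ?_
  rw [boxCoeff_id h, mul_one]

lemma thinCoeff_scalar_comp (c : K) (f : thin K D S ⟶ thin K D S') (i : V) :
    thinCoeff (scalar _ c ≫ f) i = c * thinCoeff f i := by
  rw [thinCoeff_comp]
  by_cases h : S i
  · rw [thinCoeff_scalar c h, mul_comm]
  · rw [thinCoeff_eq_zero f (fun h' => h h'.1), zero_mul, mul_zero]

lemma boxCoeff_mul_boxMap {P Q R : Prop} (φ : box K Q →ₗ[K] box K R) (hP : P) :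
    boxCoeff φ * boxCoeff (boxMap P Q (1 : K)) = boxCoeff φ := by
  by_cases h : Q
  · rw [boxCoeff_boxMap hP h, mul_one]
  · rw [boxCoeff_eq_zero φ (fun h' => h h'.1), zero_mul]

lemma boxMap_mul_boxCoeff {P Q R : Prop} (φ : box K P →ₗ[K] box K Q) (hR : R) :
    boxCoeff (boxMap Q R (1 : K)) * boxCoeff φ = boxCoeff φ := by
  by_cases h : Q
  · rw [boxCoeff_boxMap h hR, one_mul]
  · rw [boxCoeff_eq_zero φ (fun h' => h h'.2), mul_zero]

/-- Neither `S j` nor `S' i` is assumed. If one of them fails, then one of the two scalars vanishes,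
and so does the other one; all the conditions at the ends of intervals come from this. -/
lemma thinCoeff_eq (f : thin K D S ⟶ thin K D S') {i j : V} (a : D.arrow i j) (hi : S i)
    (hj : S' j) : thinCoeff f i = thinCoeff f j := by
  have h : boxCoeff (P := S i) (Q := S' j) (app f j ∘ₗ boxMap (S i) (S j) 1) =
    boxCoeff (P := S i) (Q := S' j) (boxMap (S' i) (S' j) 1 ∘ₗ app f i) := congrArg _ (f.2 a)
  refine Eq.trans ?_ (h.symm.trans ?_)
  · exact ((boxCoeff_comp (P := S i) (Q := S' i) (R := S' j) _ _).trans
      (boxMap_mul_boxCoeff (P := S i) (Q := S' i) _ hj)).symm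
  · exact (boxCoeff_comp (P := S i) (Q := S j) (R := S' j) _ _).trans
      (boxCoeff_mul_boxMap (Q := S j) (R := S' j) _ hi)

open Classical in
/-- A morphism between thin super-representations, from its scalars. -/
def thinHom (S S' : V → Prop) (c : V → K)
    (h : ∀ i j, D.arrow i j → S i → S' j → (if S i ∧ S' i then c i else 0) =
      if S j ∧ S' j then c j else 0) : thin K D S ⟶ thin K D S' :=
  mkHom (fun i => boxMap (S i) (S' i) (if S i ∧ S' i then c i else 0)) (by
    intro i j a
    refine box_hom_ext (P := S i) (Q := S' j) ?_
    refine (boxCoeff_comp (P := S i) (Q := S j) (R := S' j) _ _).trans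
      (Eq.trans ?_ (boxCoeff_comp (P := S i) (Q := S' i) (R := S' j) _ _).symm)
    by_cases hi : S i
    · by_cases hj : S' j
      · refine (boxCoeff_mul_boxMap _ hi).trans (Eq.trans ?_ (boxMap_mul_boxCoeff _ hj).symm)
        have hc : ∀ k, boxCoeff (boxMap (S k) (S' k) (if S k ∧ S' k then c k else 0)) =
            if S k ∧ S' k then c k else 0 := by
          intro k
          by_cases hk : S k ∧ S' k
          · rw [boxCoeff_boxMap hk.1 hk.2]
          · rw [boxCoeff_eq_zero _ hk, if_neg hk]
        rw [hc, hc]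
        exact (h i j a hi hj).symm
      · rw [boxCoeff_eq_zero (boxMap (S j) (S' j) _) (fun h' => hj h'.2), zero_mul]
        refine (mul_eq_zero_of_left ?_ _).symm
        exact boxCoeff_eq_zero (P := S' i) (Q := S' j) _ (fun h' => hj h'.2)
    · rw [boxCoeff_eq_zero (boxMap (S i) (S' i) _) (fun h' => hi h'.1), mul_zero]
      refine mul_eq_zero_of_right _ ?_
      exact boxCoeff_eq_zero (P := S i) (Q := S j) _ (fun h' => hi h'.1))

open Classical in
lemma thinCoeff_thinHom (c : V → K)
    (h : ∀ i j, D.arrow i j → S i → S' j → (if S i ∧ S' i then c i else 0) =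
      if S j ∧ S' j then c j else 0) {i : V} (hi : S i ∧ S' i) :
    thinCoeff (thinHom S S' c h) i = c i := by
  refine (boxCoeff_boxMap (P := S i) (Q := S' i) hi.1 hi.2 _).trans ?_
  rw [if_pos hi]

/-- The scalars of a cochain. -/
def cochainCoeff (ξ : Cochain (thin K D S) (thin K D S')) (i j : V) (a : D.arrow i j) : K :=
  boxCoeff (P := S i) (Q := S' j) (ξ i j a)

lemma cochain_ext {ξ ξ' : Cochain (thin K D S) (thin K D S')}
    (h : ∀ i j a, S i → S' j → cochainCoeff ξ i j a = cochainCoeff ξ' i j a) : ξ = ξ' := by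
  funext i j a
  refine box_hom_ext (P := S i) (Q := S' j) ?_
  by_cases hij : S i ∧ S' j
  · exact h i j a hij.1 hij.2
  · exact (boxCoeff_eq_zero (P := S i) (Q := S' j) _ hij).trans
      (boxCoeff_eq_zero (P := S i) (Q := S' j) _ hij).symm

variable (K D) in
/-- A cochain, from its scalars. -/
def mkCochain (S S' : V → Prop) (c : V → V → K) : Cochain (thin K D S) (thin K D S') :=
  fun i j _ => boxMap (S i) (S' j) (c i j)

lemma cochainCoeff_mkCochain (c : V → V → K) {i j : V} (a : D.arrow i j) (hi : S i)
    (hj : S' j) : cochainCoeff (mkCochain K D S S' c) i j a = c i j :=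
  boxCoeff_boxMap (P := S i) (Q := S' j) hi hj _

lemma cochainCoeff_coboundary
    (φ : ∀ i, (thin K D S).obj i →ₗ[K] (thin K D S').obj i) {i j : V} (a : D.arrow i j)
    (hi : S i) (hj : S' j) : cochainCoeff (coboundary _ _ φ) i j a =
      boxCoeff (P := S j) (Q := S' j) (φ j) - boxCoeff (P := S i) (Q := S' i) (φ i) := by
  refine (boxCoeff_sub (P := S i) (Q := S' j) _ _).trans (congrArg₂ _ ?_ ?_)
  · exact (boxCoeff_comp (P := S i) (Q := S j) (R := S' j) _ _).trans
      (boxCoeff_mul_boxMap (Q := S j) (R := S' j) _ hi)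
  · exact (boxCoeff_comp (P := S i) (Q := S' i) (R := S' j) _ _).trans
      (boxMap_mul_boxCoeff (P := S i) (Q := S' i) _ hj)

lemma cochainCoeff_add (ξ ξ' : Cochain (thin K D S) (thin K D S')) (i j : V) (a : D.arrow i j) :
    cochainCoeff (fun i j a => ξ i j a + ξ' i j a) i j a =
      cochainCoeff ξ i j a + cochainCoeff ξ' i j a :=
  boxCoeff_add (P := S i) (Q := S' j) _ _

lemma cochainCoeff_comp (ξ : Cochain (thin K D S) (thin K D S'))
    (g : thin K D S' ⟶ thin K D S'') (i j : V) (a : D.arrow i j) :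
    cochainCoeff (fun i j a => app g j ∘ₗ ξ i j a) i j a =
      thinCoeff g j * cochainCoeff ξ i j a :=
  boxCoeff_comp (P := S i) (Q := S' j) (R := S'' j) _ _

lemma cochainCoeff_precomp (ξ : Cochain (thin K D S') (thin K D S''))
    (g : thin K D S ⟶ thin K D S') (i j : V) (a : D.arrow i j) :
    cochainCoeff (fun i j a => ξ i j a ∘ₗ app g i) i j a =
      cochainCoeff ξ i j a * thinCoeff g i :=
  boxCoeff_comp (P := S i) (Q := S' i) (R := S'' j) _ _

end Thin

end SRep

/-! ### The cyclic order -/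

/-- The points `x ≤ y < z ≤ w < x` are in this cyclic order. -/
def Cyc (x y z w : ℕ) : Prop :=
  (x ≤ y ∧ y < z ∧ z ≤ w) ∨ (y < z ∧ z ≤ w ∧ w < x) ∨ (z ≤ w ∧ w < x ∧ x ≤ y) ∨
    (w < x ∧ x ≤ y ∧ y < z)

section Line

variable {ℓ : ℕ} {Γ : SimpleGraph (Fin ℓ)} {D : ColouredQuiver Γ}

/-- There is an arrow from the vertex `p - 1` to the vertex `p`. -/
def Ascends (D : ColouredQuiver Γ) (p : ℕ) : Prop :=
  ∃ i j : Fin ℓ, D.arrow i j ∧ i.val + 1 = j.val ∧ j.val = p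

open Classical in
/-- The position of the point `p` on the circle. -/
def angle (D : ColouredQuiver Γ) (p : ℕ) : ℕ := if Ascends D p then 2 * (ℓ + 1) - p else p

lemma Ascends.pos {p : ℕ} (h : Ascends D p) : 0 < p ∧ p < ℓ := by
  obtain ⟨i, j, -, h1, h2⟩ := h
  omega

lemma angle_cases (D : ColouredQuiver Γ) (p : ℕ) :
    (Ascends D p ∧ angle D p + p = 2 * (ℓ + 1) ∧ 0 < p ∧ p < ℓ) ∨
      (¬Ascends D p ∧ angle D p = p) := by
  by_cases h : Ascends D p
  · have := h.pos
    exact .inl ⟨h, by rw [angle, if_pos h]; omega, this⟩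
  · exact .inr ⟨h, if_neg h⟩

lemma ascends_of_arrow {i j : Fin ℓ} (a : D.arrow i j) (h : i.val + 1 = j.val) :
    Ascends D j := ⟨i, j, a, h, rfl⟩

lemma not_ascends_of_arrow {i j : Fin ℓ} (a : D.arrow i j) (h : j.val + 1 = i.val) :
    ¬Ascends D i := by
  rintro ⟨i', j', a', h1, h2⟩
  obtain rfl : i' = j := Fin.ext (by omega)
  obtain rfl : j' = i := Fin.ext h2
  exact D.asymm _ _ a a'

/-- Both points and both intervals are compared at the left ends. -/
def LeftHom (D : ColouredQuiver Γ) (a c : ℕ) : Prop :=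
  a = c ∨ (a < c ∧ ¬Ascends D c) ∨ (c < a ∧ Ascends D a)

/-- The condition on the right ends for a morphism between intervals. -/
def RightHom (D : ColouredQuiver Γ) (b d : ℕ) : Prop :=
  b = d ∨ (d < b ∧ Ascends D d) ∨ (b < d ∧ ¬Ascends D b)

set_option maxHeartbeats 1600000 in
-- For a nonzero morphism the common part of the supports has to be a quotient of `[a, b)` and a
-- submodule of `[c, d)`; at each end this prescribes the direction of one arrow, as `LeftHom` and
-- `RightHom` do. Both relations are linear orders on the points up to `ℓ`: `RightHom` compares the
-- angles, and `LeftHom` does the same with the ascending points at `-p` instead of `2 * (ℓ + 1) -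
-- p`. Modulo `2 * (ℓ + 1)` this is one cyclic order, cut open at two places.
lemma cyc_hom_iff {a b c d : ℕ} (hab : a < b) (hcd : c < d) (hb : b ≤ ℓ) (hd : d ≤ ℓ) :
    Cyc (angle D a) (angle D c) (angle D b) (angle D d) ↔
      a < d ∧ c < b ∧ LeftHom D a c ∧ RightHom D b d := by
  have hac : a = c → angle D a = angle D c := fun h => congrArg _ h
  have hbd : b = d → angle D b = angle D d := fun h => congrArg _ h
  unfold LeftHom RightHom Cyc
  rcases angle_cases D a with ⟨oa, ea, ha⟩ | ⟨oa, ea⟩ <;>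
    rcases angle_cases D b with ⟨ob, eb, hb'⟩ | ⟨ob, eb⟩ <;>
    rcases angle_cases D c with ⟨oc, ec, hc⟩ | ⟨oc, ec⟩ <;>
    rcases angle_cases D d with ⟨od, ed, hd'⟩ | ⟨od, ed⟩ <;>
    simp only [oa, ob, oc, od, not_true_eq_false, not_false_eq_true, and_true, and_false,
      or_false, false_or] <;>
    generalize angle D a = x at * <;> generalize angle D b = z at * <;>
    generalize angle D c = y at * <;> generalize angle D d = w at * <;>
    constructor <;> intro h <;>
    first
      | (rcases h with h | h | h | h <;> omega)
      | omega

set_option maxHeartbeats 1600000 in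
-- An extension of `[a, b)` by `[c, d)` is a morphism into the translate of `[c, d)`, which is the
-- pair `(d, c)`. In terms of intervals the same cyclic condition says that both end conditions for
-- morphisms fail; intervals that only touch are allowed.
lemma cyc_ext_iff {a b c d : ℕ} (hab : a < b) (hcd : c < d) (hb : b ≤ ℓ) (hd : d ≤ ℓ) :
    Cyc (angle D a) (angle D d) (angle D b) (angle D c) ↔
      a ≤ d ∧ c ≤ b ∧ ¬LeftHom D a c ∧ ¬RightHom D b d := by
  have hac : a = c → angle D a = angle D c := fun h => congrArg _ h
  have hbd : b = d → angle D b = angle D d := fun h => congrArg _ h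
  unfold LeftHom RightHom Cyc
  rcases angle_cases D a with ⟨oa, ea, ha⟩ | ⟨oa, ea⟩ <;>
    rcases angle_cases D b with ⟨ob, eb, hb'⟩ | ⟨ob, eb⟩ <;>
    rcases angle_cases D c with ⟨oc, ec, hc⟩ | ⟨oc, ec⟩ <;>
    rcases angle_cases D d with ⟨od, ed, hd'⟩ | ⟨od, ed⟩ <;>
    simp only [oa, ob, oc, od, not_true_eq_false, not_false_eq_true, and_true, and_false,
      or_false, false_or] <;>
    generalize angle D a = x at * <;> generalize angle D b = z at * <;>
    generalize angle D c = y at * <;> generalize angle D d = w at * <;>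
    constructor <;> intro h <;>
    first
      | (rcases h with h | h | h | h <;> omega)
      | omega

end Line

namespace SRep

variable {K : Type u} [Field K] {ℓ : ℕ} {Γ : SimpleGraph (Fin ℓ)} {D : ColouredQuiver Γ}
  (hΓ : ∀ i j : Fin ℓ, Γ.Adj i j ↔ i.val + 1 = j.val ∨ j.val + 1 = i.val)

include hΓ in
lemma exists_arrow {p : ℕ} (h0 : 0 < p) (hp : p < ℓ) : ∃ i j : Fin ℓ, D.arrow i j ∧
    ((i.val + 1 = j.val ∧ j.val = p ∧ Ascends D p) ∨
      (j.val + 1 = i.val ∧ i.val = p ∧ ¬Ascends D p)) := by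
  have h : Γ.Adj ⟨p - 1, by omega⟩ ⟨p, hp⟩ := (hΓ _ _).2 (Or.inl (by simp only; omega))
  have h1 : p - 1 + 1 = p := by omega
  rcases (D.adj_iff _ _).1 h with a | a
  · exact ⟨_, _, a, .inl ⟨h1, rfl, ascends_of_arrow a h1⟩⟩
  · exact ⟨_, _, a, .inr ⟨h1, rfl, not_ascends_of_arrow a h1⟩⟩

include hΓ in
-- The larger of its two vertices serves as the name of an edge from here on.
lemma arrow_unique {i j i' j' : Fin ℓ} (ar : D.arrow i j) (ar' : D.arrow i' j')
    (h : max i'.val j'.val = max i.val j.val) : i' = i ∧ j' = j := by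
  have h1 := arrow_cases hΓ ar'
  have h1' := arrow_cases hΓ ar
  by_cases h2 : i' = i
  · exact ⟨h2, Fin.ext (by subst h2; omega)⟩
  · have h3 : i'.val ≠ i.val := fun h => h2 (Fin.ext h)
    obtain rfl : i' = j := Fin.ext (by omega)
    obtain rfl : j' = i := Fin.ext (by omega)
    exact absurd ar (D.asymm _ _ ar')

/-! ### Morphisms between interval modules -/

section Hom

variable {a b c d : ℕ}

include hΓ in
lemma thinCoeff_interval_eq (f : interval K D a b ⟶ interval K D c d) {i j : Fin ℓ}
    (hi : (a ≤ i.val ∧ i.val < b) ∧ (c ≤ i.val ∧ i.val < d))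
    (hj : (a ≤ j.val ∧ j.val < b) ∧ (c ≤ j.val ∧ j.val < d)) (hij : i ≤ j) :
    thinCoeff f i = thinCoeff f j := by
  obtain ⟨n, hn⟩ : ∃ n, i.val + n = j.val := ⟨j.val - i.val, by have := Fin.le_def.1 hij; omega⟩
  clear hij
  induction n generalizing j with
  | zero => rw [Fin.ext (show i.val = j.val by omega)]
  | succ n ih =>
    obtain ⟨k, hk⟩ : ∃ k : Fin ℓ, k.val + 1 = j.val := ⟨⟨j.val - 1, by omega⟩, by simp only; omega⟩
    refine (ih (j := k) (by omega) (by omega)).trans ?_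
    rcases (D.adj_iff k j).1 ((hΓ k j).2 (.inl hk)) with h | h
    · exact thinCoeff_eq f h (by omega) (by omega)
    · exact (thinCoeff_eq f h (by omega) (by omega)).symm

include hΓ in
lemma thinCoeff_ne_zero {f : interval K D a b ⟶ interval K D c d} (hf : f ≠ 0) {i : Fin ℓ}
    (hi : (a ≤ i.val ∧ i.val < b) ∧ (c ≤ i.val ∧ i.val < d)) : thinCoeff f i ≠ 0 := by
  intro h0
  refine hf (thin_hom_ext fun j => ?_)
  rw [thinCoeff_zero]
  by_cases hj : (a ≤ j.val ∧ j.val < b) ∧ (c ≤ j.val ∧ j.val < d)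
  · rcases le_total i j with h | h
    · rw [← thinCoeff_interval_eq hΓ f hi hj h, h0]
    · rw [thinCoeff_interval_eq hΓ f hj hi h, h0]
  · exact thinCoeff_eq_zero f hj

include hΓ in
-- A morphism acts by one and the same scalar on the whole common part of the supports, and by zero
-- elsewhere.
lemma exists_scalar_comp {f g : interval K D a b ⟶ interval K D c d} (hf : f ≠ 0) (hg : g ≠ 0) :
    ∃ r : K, r ≠ 0 ∧ g = scalar _ r ≫ f := by
  have key := fun (f : interval K D a b ⟶ interval K D c d) (hf : f ≠ 0) i =>
    thinCoeff_ne_zero hΓ hf (i := i)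
  obtain ⟨i, hi⟩ : ∃ i : Fin ℓ, (a ≤ i.val ∧ i.val < b) ∧ (c ≤ i.val ∧ i.val < d) := by
    by_contra! h
    refine hf (thin_hom_ext fun j => ?_)
    rw [thinCoeff_zero]
    exact thinCoeff_eq_zero f fun hj => (h j hj.1 hj.2.1).not_gt hj.2.2
  refine ⟨thinCoeff g i * (thinCoeff f i)⁻¹, mul_ne_zero (key g hg i hi) (inv_ne_zero (key f hf i hi)),
    thin_hom_ext fun j => ?_⟩
  rw [thinCoeff_scalar_comp]
  by_cases hj : (a ≤ j.val ∧ j.val < b) ∧ (c ≤ j.val ∧ j.val < d)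
  · have h : ∀ f : interval K D a b ⟶ interval K D c d, thinCoeff f j = thinCoeff f i := by
      intro f
      rcases le_total i j with h | h
      · exact (thinCoeff_interval_eq hΓ f hi hj h).symm
      · exact thinCoeff_interval_eq hΓ f hj hi h
    rw [h, h, mul_assoc, inv_mul_cancel₀ (key f hf i hi), mul_one]
  · rw [thinCoeff_eq_zero f hj, thinCoeff_eq_zero g hj, mul_zero]

include hΓ in
-- If an end condition fails, then the arrow across this end of the common part goes the wrong way:
-- by `thinCoeff_eq` the scalar inside equals the scalar outside, which is zero.
lemma interval_hom_eq_zero (hab : a < b) (hcd : c < d) (hb : b ≤ ℓ) (hd : d ≤ ℓ)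
    (h : ¬(a < d ∧ c < b ∧ LeftHom D a c ∧ RightHom D b d))
    (f : interval K D a b ⟶ interval K D c d) : f = 0 := by
  by_contra hf
  have key := fun i => thinCoeff_ne_zero hΓ hf (i := i)
  have hne : a < d ∧ c < b := by
    by_contra hne
    refine hf (thin_hom_ext fun j => ?_)
    rw [thinCoeff_zero]
    exact thinCoeff_eq_zero f (by omega)
  refine h ⟨hne.1, hne.2, ?_, ?_⟩
  · by_contra hL
    unfold LeftHom at hL
    push Not at hL
    obtain ⟨h1, h2, h3⟩ := hL
    rcases lt_or_gt_of_ne h1 with hac | hac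
    · obtain ⟨i, j, ar, h | h⟩ := exists_arrow hΓ (D := D) (p := c) (by omega) (by omega)
      · refine key j (by omega) ?_
        rw [← thinCoeff_eq f ar (by omega) (by omega)]
        exact thinCoeff_eq_zero f (by omega)
      · exact h.2.2 (h2 hac)
    · obtain ⟨i, j, ar, h | h⟩ := exists_arrow hΓ (D := D) (p := a) (by omega) (by omega)
      · exact h3 hac h.2.2
      · refine key i (by omega) ?_
        rw [thinCoeff_eq f ar (by omega) (by omega)]
        exact thinCoeff_eq_zero f (by omega)
  · by_contra hL
    unfold RightHom at hL
    push Not at hL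
    obtain ⟨h1, h2, h3⟩ := hL
    rcases lt_or_gt_of_ne h1 with hac | hac
    · obtain ⟨i, j, ar, h | h⟩ := exists_arrow hΓ (D := D) (p := b) (by omega) (by omega)
      · refine key i (by omega) ?_
        rw [thinCoeff_eq f ar (by omega) (by omega)]
        exact thinCoeff_eq_zero f (by omega)
      · exact h.2.2 (h3 hac)
    · obtain ⟨i, j, ar, h | h⟩ := exists_arrow hΓ (D := D) (p := d) (by omega) (by omega)
      · exact h2 hac h.2.2
      · refine key j (by omega) ?_
        rw [← thinCoeff_eq f ar (by omega) (by omega)]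
        exact thinCoeff_eq_zero f (by omega)

include hΓ in
lemma exists_interval_hom (hL : LeftHom D a c) (hR : RightHom D b d) :
    ∃ f : interval K D a b ⟶ interval K D c d, ∀ i : Fin ℓ,
      ((a ≤ i.val ∧ i.val < b) ∧ (c ≤ i.val ∧ i.val < d)) → thinCoeff f i = 1 := by
  refine ⟨thinHom _ _ (fun _ => 1) ?_, fun i hi => thinCoeff_thinHom _ _ hi⟩
  intro i j ar hi hj
  -- No arrow that starts in `[a, b)` and ends in `[c, d)` crosses the border of the common part.
  have : ((a ≤ i.val ∧ i.val < b) ∧ (c ≤ i.val ∧ i.val < d)) ↔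
      ((a ≤ j.val ∧ j.val < b) ∧ (c ≤ j.val ∧ j.val < d)) := by
    unfold LeftHom at hL
    unfold RightHom at hR
    rcases arrow_cases hΓ ar with h | h
    · have ho := ascends_of_arrow ar h
      have h1 : ¬(j.val = c ∧ a < c) := by
        rintro ⟨rfl, hac⟩
        simp only [ho, not_true_eq_false, and_false, false_or] at hL
        omega
      have h2 : ¬(j.val = b ∧ b < d) := by
        rintro ⟨rfl, hac⟩
        simp only [ho, not_true_eq_false, and_false, or_false] at hR
        omega
      omega
    · have ho := not_ascends_of_arrow ar h
      have h1 : ¬(i.val = a ∧ c < a) := by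
        rintro ⟨rfl, hac⟩
        simp only [ho, and_false, or_false] at hL
        omega
      have h2 : ¬(i.val = d ∧ d < b) := by
        rintro ⟨rfl, hac⟩
        simp only [ho, and_false, false_or] at hR
        omega
      omega
  split_ifs <;> tauto

end Hom

/-! ### Extensions of interval modules -/

section Ext

variable {a b c d : ℕ}

include hΓ in
-- When both end conditions fail, every edge from `max a c` to `min b d`, the two extreme ones
-- included, carries a component of the cochains. There is one more of these edges than there are
-- vertices in the common part, on which the coboundaries depend; hence `Ext¹` is a line.
lemma mem_of_arrow (hab : a < b) (hcd : c < d) (hL : ¬LeftHom D a c) (hR : ¬RightHom D b d)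
    {i j : Fin ℓ} (ar : D.arrow i j) (h1 : max a c ≤ max i.val j.val)
    (h2 : max i.val j.val ≤ min b d) : (a ≤ i.val ∧ i.val < b) ∧ (c ≤ j.val ∧ j.val < d) := by
  unfold LeftHom at hL
  unfold RightHom at hR
  push Not at hL hR
  obtain ⟨hL0, hL1, hL2⟩ := hL
  obtain ⟨hR0, hR1, hR2⟩ := hR
  rcases arrow_cases hΓ ar with h | h
  · have ho := ascends_of_arrow ar h
    have h3 : ¬(j.val = a ∧ c < a) := by rintro ⟨rfl, h'⟩; exact hL2 h' ho
    have h4 : ¬(j.val = d ∧ d < b) := by rintro ⟨rfl, h'⟩; exact hR1 h' ho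
    omega
  · have ho := not_ascends_of_arrow ar h
    have h3 : ¬(i.val = c ∧ a < c) := by rintro ⟨rfl, h'⟩; exact ho (hL1 h')
    have h4 : ¬(i.val = b ∧ b < d) := by rintro ⟨rfl, h'⟩; exact ho (hR2 h')
    omega

lemma cochainCoeff_coboundary_interval
    (φ : ∀ i, (interval K D a b).obj i →ₗ[K] (interval K D c d).obj i) {i j : Fin ℓ}
    (ar : D.arrow i j) (hi : a ≤ i.val ∧ i.val < b) (hj : c ≤ j.val ∧ j.val < d) :
    cochainCoeff (coboundary _ _ φ) i j ar =
      boxCoeff (P := a ≤ j.val ∧ j.val < b) (Q := c ≤ j.val ∧ j.val < d) (φ j) -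
      boxCoeff (P := a ≤ i.val ∧ i.val < b) (Q := c ≤ i.val ∧ i.val < d) (φ i) :=
  cochainCoeff_coboundary (S := fun i : Fin ℓ => a ≤ i.val ∧ i.val < b)
    (S' := fun i : Fin ℓ => c ≤ i.val ∧ i.val < d) φ ar hi hj

lemma bounds_of_not_hom (hb : b ≤ ℓ) (hd : d ≤ ℓ) (hL : ¬LeftHom D a c)
    (hR : ¬RightHom D b d) : 0 < max a c ∧ min b d < ℓ := by
  unfold LeftHom at hL
  unfold RightHom at hR
  push Not at hL hR
  omega

include hΓ in
-- If a cochain with only one nonzero scalar were the coboundary of `φ`, then `φ` would be constant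
-- on either side of the distinguished edge; as it vanishes outside the common part, it would be
-- zero on both sides.
lemma extensionClass_ne_zero (hab : a < b) (hcd : c < d) (hb : b ≤ ℓ) (hd : d ≤ ℓ)
    (hL : ¬LeftHom D a c) (hR : ¬RightHom D b d)
    (ξ : Cochain (interval K D a b) (interval K D c d)) {i₀ j₀ : Fin ℓ} (a₀ : D.arrow i₀ j₀)
    (hi₀ : a ≤ i₀.val ∧ i₀.val < b) (hj₀ : c ≤ j₀.val ∧ j₀.val < d)
    (h₀ : cochainCoeff ξ i₀ j₀ a₀ ≠ 0)
    (h : ∀ i j (ar : D.arrow i j), (a ≤ i.val ∧ i.val < b) → (c ≤ j.val ∧ j.val < d) →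
      max i.val j.val ≠ max i₀.val j₀.val → cochainCoeff ξ i j ar = 0) :
    extensionClass ξ ≠ 0 := by
  rw [Ne, extensionClass_eq_zero_iff]
  rintro ⟨φ, rfl⟩
  obtain ⟨hm, hM⟩ := bounds_of_not_hom hb hd hL hR
  let u : Fin ℓ → K := fun k => boxCoeff (P := a ≤ k.val ∧ k.val < b) (Q := c ≤ k.val ∧ k.val < d)
    (φ k)
  have hu0 : ∀ k : Fin ℓ, ¬((a ≤ k.val ∧ k.val < b) ∧ (c ≤ k.val ∧ k.val < d)) → u k = 0 :=
    fun k hk => boxCoeff_eq_zero _ hk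
  have hne : ∀ {i j : Fin ℓ} (ar : D.arrow i j), max a c ≤ max i.val j.val →
      max i.val j.val ≤ min b d → max i.val j.val ≠ max i₀.val j₀.val → u i = u j := by
    intro i j ar h1 h2 h3
    obtain ⟨h4, h5⟩ := mem_of_arrow hΓ hab hcd hL hR ar h1 h2
    have h6 := h i j ar h4 h5 h3
    rw [cochainCoeff_coboundary_interval _ _ h4 h5] at h6
    exact (sub_eq_zero.1 h6).symm
  have hstep : ∀ k k' : Fin ℓ, k.val + 1 = k'.val → max a c ≤ k'.val → k'.val ≤ min b d →
      k'.val ≠ max i₀.val j₀.val → u k = u k' := by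
    intro k k' hk h1 h2 h3
    have h4 : max k.val k'.val = k'.val := by omega
    rcases (D.adj_iff k k').1 ((hΓ k k').2 (.inl hk)) with ar | ar
    · exact hne ar (by omega) (by omega) (by omega)
    · exact (hne ar (by omega) (by omega) (by omega)).symm
  have hlow : ∀ (n : ℕ) (k : Fin ℓ), k.val = n → n < max i₀.val j₀.val → u k = 0 := by
    intro n
    induction n with
    | zero => exact fun k hk _ => hu0 k (by omega)
    | succ n ih =>
      intro k hk hn
      by_cases hmem : (a ≤ k.val ∧ k.val < b) ∧ (c ≤ k.val ∧ k.val < d)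
      · rw [← hstep ⟨n, by omega⟩ k hk.symm (by omega) (by omega) (by omega)]
        exact ih _ rfl (by omega)
      · exact hu0 k hmem
  have hhigh : ∀ (n : ℕ) (k : Fin ℓ), k.val + n + 1 = ℓ → max i₀.val j₀.val ≤ k.val → u k = 0 := by
    intro n
    induction n with
    | zero => exact fun k hk _ => hu0 k (by omega)
    | succ n ih =>
      intro k hk hn
      by_cases hmem : (a ≤ k.val ∧ k.val < b) ∧ (c ≤ k.val ∧ k.val < d)
      · rw [hstep k ⟨k.val + 1, by omega⟩ rfl (by simp only; omega) (by simp only; omega)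
          (by simp only; omega)]
        exact ih _ (by simp only; omega) (by simp only; omega)
      · exact hu0 k hmem
  rw [cochainCoeff_coboundary_interval _ _ hi₀ hj₀] at h₀
  refine h₀ ?_
  change u j₀ - u i₀ = 0
  rcases arrow_cases hΓ a₀ with h' | h'
  · rw [hlow _ i₀ rfl (by omega), hhigh (ℓ - 1 - j₀.val) j₀ (by omega) (by omega), sub_zero]
  · rw [hlow _ j₀ rfl (by omega), hhigh (ℓ - 1 - i₀.val) i₀ (by omega) (by omega), sub_zero]

include hΓ in
/-- Every cochain is cohomologous to one that is concentrated at the last possible arrow. -/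
lemma exists_normalized (f : (toDerived K D).obj (interval K D a b) ⟶
      ((toDerived K D).obj (interval K D c d))⟦(1 : ℤ)⟧) :
    ∃ ξ : Cochain (interval K D a b) (interval K D c d), f = extensionClass ξ ∧
      ∀ i j (ar : D.arrow i j), (a ≤ i.val ∧ i.val < b) → (c ≤ j.val ∧ j.val < d) →
        max i.val j.val ≠ min b d → cochainCoeff ξ i j ar = 0 := by
  classical
  obtain ⟨ξ, rfl⟩ := exists_eq_extensionClass f
  -- The scalar at the edge `p + 1` with a sign: a coboundary is the value at the target minus the
  -- value at the source, so the sign depends on the direction of the arrow.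
  have he : ∀ p : ℕ, ∃ e : K, ∀ i j (ar : D.arrow i j), max i.val j.val = p + 1 →
      (i.val + 1 = j.val → e = -cochainCoeff ξ i j ar) ∧
        (j.val + 1 = i.val → e = cochainCoeff ξ i j ar) := by
    intro p
    by_cases hp : p + 1 < ℓ
    · obtain ⟨i, j, ar, h⟩ := exists_arrow hΓ (D := D) (Nat.succ_pos p) hp
      have huniq : ∀ i' j' (ar' : D.arrow i' j'), max i'.val j'.val = p + 1 → i' = i ∧ j' = j :=
        fun i' j' ar' hm => arrow_unique hΓ ar ar' (by omega)
      rcases h with h | h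
      · refine ⟨-cochainCoeff ξ i j ar, fun i' j' ar' hm => ?_⟩
        obtain ⟨rfl, rfl⟩ := huniq i' j' ar' hm
        exact ⟨fun _ => rfl, fun _ => by omega⟩
      · refine ⟨cochainCoeff ξ i j ar, fun i' j' ar' hm => ?_⟩
        obtain ⟨rfl, rfl⟩ := huniq i' j' ar' hm
        exact ⟨fun _ => by omega, fun _ => rfl⟩
    · exact ⟨0, fun i j ar hm => by omega⟩
  choose e he using he
  let P : ℕ → Prop := fun k => (a ≤ k ∧ k < b) ∧ (c ≤ k ∧ k < d)
  -- Solving from left to right clears one edge after the other. Only the edge `min b d` is left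
  -- over, since its right vertex is outside the common part.
  obtain ⟨u, hu⟩ : ∃ u : ℕ → K, ∀ p, u (p + 1) = (if P p then u p else 0) + e p :=
    ⟨fun n => Nat.rec 0 (fun p x => (if P p then x else 0) + e p) n, fun p => rfl⟩
  let φ : ∀ i : Fin ℓ, (interval K D a b).obj i →ₗ[K] (interval K D c d).obj i := fun i =>
    boxMap (a ≤ i.val ∧ i.val < b) (c ≤ i.val ∧ i.val < d) (u i)
  have hφ : ∀ i : Fin ℓ, boxCoeff (P := a ≤ i.val ∧ i.val < b) (Q := c ≤ i.val ∧ i.val < d) (φ i) =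
      if P i then u i else 0 := by
    intro i
    by_cases hi : P i
    · rw [if_pos hi]
      exact boxCoeff_boxMap hi.1 hi.2 _
    · rw [if_neg hi]
      exact boxCoeff_eq_zero _ hi
  refine ⟨_, (extensionClass_add_coboundary ξ φ).symm, fun i j ar hi hj hm => ?_⟩
  rw [cochainCoeff_add, cochainCoeff_coboundary_interval _ ar hi hj, hφ, hφ]
  rcases arrow_cases hΓ ar with h | h
  · have hP : P j := by
      change (_ ∧ _) ∧ (_ ∧ _)
      omega
    rw [if_pos hP, ← h, hu, (he i.val i j ar (by omega)).1 h]
    ring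
  · have hP : P i := by
      change (_ ∧ _) ∧ (_ ∧ _)
      omega
    rw [if_pos hP, ← h, hu, (he j.val i j ar (by omega)).2 h]
    ring

lemma cochain_eq_zero {S S' : Fin ℓ → Prop} {ξ : Cochain (thin K D S) (thin K D S')}
    (h : ∀ i j a, S i → S' j → cochainCoeff ξ i j a = 0) : extensionClass ξ = 0 := by
  refine (extensionClass_eq_zero_iff ξ).2 ⟨fun _ => 0, cochain_ext fun i j a hi hj => ?_⟩
  rw [h i j a hi hj, cochainCoeff_coboundary _ a hi hj]
  exact ((congrArg₂ _ boxCoeff_zero boxCoeff_zero).trans (sub_zero _)).symm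

include hΓ in
-- A normalized cochain of nonzero class consists of one nonzero scalar, at the same edge for both
-- classes.
lemma exists_scalar_comp_ext {f g : (toDerived K D).obj (interval K D a b) ⟶
    ((toDerived K D).obj (interval K D c d))⟦(1 : ℤ)⟧} (hf : f ≠ 0) (hg : g ≠ 0) :
    ∃ r : K, r ≠ 0 ∧ g = (toDerived K D).map (scalar _ r) ≫ f := by
  obtain ⟨ξ, rfl, hξ⟩ := exists_normalized hΓ f
  obtain ⟨ξ', rfl, hξ'⟩ := exists_normalized hΓ g
  have key : ∀ {ξ : Cochain (interval K D a b) (interval K D c d)}, extensionClass ξ ≠ 0 →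
      (∀ i j (ar : D.arrow i j), (a ≤ i.val ∧ i.val < b) → (c ≤ j.val ∧ j.val < d) →
        max i.val j.val ≠ min b d → cochainCoeff ξ i j ar = 0) →
      ∃ i j, ∃ ar : D.arrow i j, (a ≤ i.val ∧ i.val < b) ∧ (c ≤ j.val ∧ j.val < d) ∧
        max i.val j.val = min b d ∧ cochainCoeff ξ i j ar ≠ 0 := by
    intro ξ hne hξ
    by_contra! hcon
    refine hne (cochain_eq_zero fun i j ar hi hj => ?_)
    by_cases hm : max i.val j.val = min b d
    · exact hcon i j ar hi hj hm
    · exact hξ i j ar hi hj hm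
  obtain ⟨i, j, ar, hi, hj, hm, h0⟩ := key hf hξ
  obtain ⟨i', j', ar', hi', hj', hm', h0'⟩ := key hg hξ'
  have huniq : ∀ i' j' (ar' : D.arrow i' j'), max i'.val j'.val = min b d → i' = i ∧ j' = j :=
    fun i' j' ar' hm' => arrow_unique hΓ ar ar' (hm'.trans hm.symm)
  obtain ⟨rfl, rfl⟩ := huniq i' j' ar' hm'
  refine ⟨cochainCoeff ξ' i' j' ar' * (cochainCoeff ξ i' j' ar)⁻¹,
    mul_ne_zero h0' (inv_ne_zero h0), ?_⟩
  rw [comp_extensionClass]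
  refine congrArg _ (cochain_ext fun k l br hk hl => ?_)
  rw [cochainCoeff_precomp,
    thinCoeff_scalar (S := fun i : Fin ℓ => a ≤ i.val ∧ i.val < b) _ hk]
  by_cases hm2 : max k.val l.val = min b d
  · obtain ⟨rfl, rfl⟩ := huniq k l br hm2
    rw [mul_comm, mul_assoc, inv_mul_cancel₀ h0, mul_one]
  · rw [hξ k l br hk hl hm2, hξ' k l br hk hl hm2, zero_mul]

include hΓ in
-- After normalization only the edge `min b d` can carry a scalar. If it does, then the right end
-- condition fails, so the left one holds, and the edge `max a c` carries nothing. A family that is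
-- constant on the common part then has its coboundary at the last edge only, where it cancels the
-- scalar.
lemma interval_ext_eq_zero (hab : a < b) (hcd : c < d) (hb : b ≤ ℓ)
    (h : ¬(a ≤ d ∧ c ≤ b ∧ ¬LeftHom D a c ∧ ¬RightHom D b d))
    (f : (toDerived K D).obj (interval K D a b) ⟶
      ((toDerived K D).obj (interval K D c d))⟦(1 : ℤ)⟧) : f = 0 := by
  obtain ⟨ξ, rfl, hξ⟩ := exists_normalized hΓ f
  by_cases hex : ∃ (i j : Fin ℓ) (_ : D.arrow i j), (a ≤ i.val ∧ i.val < b) ∧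
      (c ≤ j.val ∧ j.val < d) ∧ max i.val j.val = min b d
  swap
  · exact cochain_eq_zero fun i j ar hi hj =>
      hξ i j ar hi hj fun hm => hex ⟨i, j, ar, hi, hj, hm⟩
  obtain ⟨i₀, j₀, a₀, hi₀, hj₀, hm₀⟩ := hex
  have h0 := arrow_cases hΓ a₀
  have hR : ¬RightHom D b d := by
    rintro (h1 | ⟨h1, h2⟩ | ⟨h1, h2⟩)
    · omega
    · obtain ⟨i, j, ar, h3, h4⟩ := h2
      obtain ⟨rfl, rfl⟩ := arrow_unique hΓ a₀ ar (by omega)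
      omega
    · rcases h0 with h0 | h0
      · have := ascends_of_arrow a₀ h0
        obtain rfl : j₀.val = b := by omega
        exact h2 this
      · omega
  have hL : LeftHom D a c := by
    by_contra hL
    exact h ⟨by omega, by omega, hL, hR⟩
  have hne : ∀ i j (ar : D.arrow i j), (a ≤ i.val ∧ i.val < b) → (c ≤ j.val ∧ j.val < d) →
      max i.val j.val ≠ max a c := by
    intro i j ar hi hj hm
    rcases hL with h1 | ⟨h1, h2⟩ | ⟨h1, h2⟩
    · have := arrow_cases hΓ ar
      omega
    · rcases arrow_cases hΓ ar with h3 | h3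
      · have := ascends_of_arrow ar h3
        obtain rfl : j.val = c := by omega
        exact h2 this
      · omega
    · obtain ⟨i', j', ar', h3, h4⟩ := h2
      obtain ⟨rfl, rfl⟩ := arrow_unique hΓ ar' ar (by omega)
      omega
  have hne₀ := hne _ _ a₀ hi₀ hj₀
  obtain ⟨e, he⟩ : ∃ e : K, (i₀.val + 1 = j₀.val → e = -cochainCoeff ξ i₀ j₀ a₀) ∧
      (j₀.val + 1 = i₀.val → e = cochainCoeff ξ i₀ j₀ a₀) := by
    rcases h0 with h0 | h0
    · exact ⟨_, fun _ => rfl, fun _ => by omega⟩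
    · exact ⟨_, fun _ => by omega, fun _ => rfl⟩
  let φ : ∀ i : Fin ℓ, (interval K D a b).obj i →ₗ[K] (interval K D c d).obj i := fun i =>
    boxMap (a ≤ i.val ∧ i.val < b) (c ≤ i.val ∧ i.val < d) e
  have hφ : ∀ i : Fin ℓ, ((a ≤ i.val ∧ i.val < b) ∧ (c ≤ i.val ∧ i.val < d)) →
      boxCoeff (P := a ≤ i.val ∧ i.val < b) (Q := c ≤ i.val ∧ i.val < d) (φ i) = e :=
    fun i hi => boxCoeff_boxMap hi.1 hi.2 e
  have hφ' : ∀ i : Fin ℓ, ¬((a ≤ i.val ∧ i.val < b) ∧ (c ≤ i.val ∧ i.val < d)) →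
      boxCoeff (P := a ≤ i.val ∧ i.val < b) (Q := c ≤ i.val ∧ i.val < d) (φ i) = 0 :=
    fun i hi => boxCoeff_eq_zero _ hi
  refine (extensionClass_eq_zero_iff ξ).2 ⟨φ, cochain_ext fun i j ar hi hj => ?_⟩
  rw [cochainCoeff_coboundary_interval φ ar hi hj]
  have h1 := arrow_cases hΓ ar
  have h2 := hne i j ar hi hj
  by_cases hm : max i.val j.val = min b d
  · obtain ⟨rfl, rfl⟩ := arrow_unique hΓ a₀ ar (by omega)
    rcases h0 with h0 | h0
    · rw [hφ i (by omega), hφ' j (by omega), he.1 h0, zero_sub, neg_neg]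
    · rw [hφ j (by omega), hφ' i (by omega), he.2 h0, sub_zero]
  · rw [hξ i j ar hi hj hm, hφ i (by omega), hφ j (by omega), sub_self]

include hΓ in
-- Any edge between the extreme ones can carry a generator; the freedom to choose `p` is what
-- compositions need.
lemma exists_extensionClass (hab : a < b) (hcd : c < d) (hb : b ≤ ℓ) (hd : d ≤ ℓ)
    (hL : ¬LeftHom D a c) (hR : ¬RightHom D b d) {p : ℕ} (h1 : max a c ≤ p)
    (h2 : p ≤ min b d) : ∃ ξ : Cochain (interval K D a b) (interval K D c d),
    extensionClass ξ ≠ 0 ∧ ∀ i j (ar : D.arrow i j), (a ≤ i.val ∧ i.val < b) →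
      (c ≤ j.val ∧ j.val < d) → cochainCoeff ξ i j ar = if max i.val j.val = p then 1 else 0 := by
  obtain ⟨hm, hM⟩ := bounds_of_not_hom hb hd hL hR
  obtain ⟨i, j, ar, h⟩ := exists_arrow hΓ (D := D) (p := p) (by omega) (by omega)
  obtain ⟨hi, hj⟩ := mem_of_arrow hΓ hab hcd hL hR ar (by omega) (by omega)
  have hc : ∀ i j (ar : D.arrow i j), (a ≤ i.val ∧ i.val < b) → (c ≤ j.val ∧ j.val < d) →
      cochainCoeff (mkCochain K D (fun i : Fin ℓ => a ≤ i.val ∧ i.val < b)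
        (fun i : Fin ℓ => c ≤ i.val ∧ i.val < d)
        (fun i j => if max i.val j.val = p then 1 else 0)) i j ar =
      if max i.val j.val = p then 1 else 0 :=
    fun i j ar hi hj => cochainCoeff_mkCochain _ ar hi hj
  refine ⟨mkCochain K D _ _ (fun i j => if max i.val j.val = p then 1 else 0), ?_, hc⟩
  refine extensionClass_ne_zero hΓ hab hcd hb hd hL hR _ ar hi hj ?_ ?_
  · rw [hc i j ar hi hj, if_pos (by omega)]
    exact one_ne_zero
  · intro i' j' ar' hi' hj' hm'
    rw [hc i' j' ar' hi' hj', if_neg (by omega)]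

end Ext

/-! ### Compositions -/

section Comp

variable {a b c d e f : ℕ}

include hΓ in
lemma exists_hom_comp_hom (hf : f ≤ ℓ) (hab : a < b) (hcd : c < d) (hef : e < f)
    (hIJ : a < d ∧ c < b ∧ LeftHom D a c ∧ RightHom D b d)
    (hJL : c < f ∧ e < d ∧ LeftHom D c e ∧ RightHom D d f) (hIL : a < f ∧ e < b) :
    ∃ (g : interval K D a b ⟶ interval K D c d) (h : interval K D c d ⟶ interval K D e f),
      g ≫ h ≠ 0 := by
  obtain ⟨g, hg⟩ := exists_interval_hom (K := K) hΓ hIJ.2.2.1 hIJ.2.2.2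
  obtain ⟨h, hh⟩ := exists_interval_hom (K := K) hΓ hJL.2.2.1 hJL.2.2.2
  -- The largest of the left ends is a vertex in all three supports.
  obtain ⟨i, hi⟩ : ∃ i : Fin ℓ, i.val = max (max a c) e := ⟨⟨max (max a c) e, by omega⟩, rfl⟩
  refine ⟨g, h, fun h0 => ?_⟩
  have h1 : thinCoeff (g ≫ h) i = 0 := by rw [h0, thinCoeff_zero]
  rw [thinCoeff_comp, hg i (by omega), hh i (by omega), one_mul] at h1
  exact one_ne_zero h1

include hΓ in
-- The edge at the largest of the three left ends carries cochains to `[e, f)` both from `[c, d)`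
-- and from `[a, b)`. A cochain supported at this edge keeps its support, and its scalar there, when
-- it is composed with a morphism of scalar `1`.
lemma exists_hom_comp_ext (hb : b ≤ ℓ) (hd : d ≤ ℓ) (hf : f ≤ ℓ) (hab : a < b) (hcd : c < d)
    (hef : e < f) (hIJ : a < d ∧ c < b ∧ LeftHom D a c ∧ RightHom D b d)
    (hJL : c ≤ f ∧ e ≤ d ∧ ¬LeftHom D c e ∧ ¬RightHom D d f)
    (hIL : a ≤ f ∧ e ≤ b ∧ ¬LeftHom D a e ∧ ¬RightHom D b f) :
    ∃ (g : interval K D a b ⟶ interval K D c d) (h : (toDerived K D).obj (interval K D c d) ⟶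
      ((toDerived K D).obj (interval K D e f))⟦(1 : ℤ)⟧), (toDerived K D).map g ≫ h ≠ 0 := by
  obtain ⟨g, hg⟩ := exists_interval_hom (K := K) hΓ hIJ.2.2.1 hIJ.2.2.2
  obtain ⟨ξ, -, hξ⟩ := exists_extensionClass (K := K) hΓ hcd hef hd hf hJL.2.2.1 hJL.2.2.2
    (p := max (max a c) e) (by omega) (by omega)
  obtain ⟨hm, hM⟩ := bounds_of_not_hom hb hf hIL.2.2.1 hIL.2.2.2
  obtain ⟨i, j, ar, hp⟩ := exists_arrow hΓ (D := D) (p := max (max a c) e) (by omega) (by omega)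
  obtain ⟨hi, hj⟩ := mem_of_arrow hΓ hab hef hIL.2.2.1 hIL.2.2.2 ar (by omega) (by omega)
  obtain ⟨hi', -⟩ := mem_of_arrow hΓ hcd hef hJL.2.2.1 hJL.2.2.2 ar (by omega) (by omega)
  refine ⟨g, extensionClass ξ, ?_⟩
  rw [comp_extensionClass]
  have hc : ∀ k l (br : D.arrow k l), (a ≤ k.val ∧ k.val < b) → (e ≤ l.val ∧ l.val < f) →
      cochainCoeff (S := fun i : Fin ℓ => a ≤ i.val ∧ i.val < b)
        (S' := fun i : Fin ℓ => e ≤ i.val ∧ i.val < f)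
        (fun i j a => ξ i j a ∘ₗ app g i) k l br = cochainCoeff ξ k l br * thinCoeff g k :=
    fun k l br _ _ => cochainCoeff_precomp ξ g k l br
  refine extensionClass_ne_zero hΓ hab hef hb hf hIL.2.2.1 hIL.2.2.2 _ ar hi hj ?_ ?_
  · rw [hc i j ar hi hj, hg i (by omega), hξ i j ar hi' hj, if_pos (by omega), one_mul]
    exact one_ne_zero
  · intro k l br hk hl hm'
    rw [hc k l br hk hl]
    by_cases hk' : c ≤ k.val ∧ k.val < d
    · rw [hξ k l br hk' hl, if_neg (by omega), zero_mul]
    · rw [thinCoeff_eq_zero g (by omega), mul_zero]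

include hΓ in
-- The edge at the largest left end works again; now it is the target of the arrow that has to lie
-- in both `[c, d)` and `[e, f)`.
lemma exists_ext_comp_hom (hb : b ≤ ℓ) (hd : d ≤ ℓ) (hf : f ≤ ℓ) (hab : a < b) (hcd : c < d)
    (hef : e < f) (hIJ : a ≤ d ∧ c ≤ b ∧ ¬LeftHom D a c ∧ ¬RightHom D b d)
    (hJL : c < f ∧ e < d ∧ LeftHom D c e ∧ RightHom D d f)
    (hIL : a ≤ f ∧ e ≤ b ∧ ¬LeftHom D a e ∧ ¬RightHom D b f) :
    ∃ (g : (toDerived K D).obj (interval K D a b) ⟶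
      ((toDerived K D).obj (interval K D c d))⟦(1 : ℤ)⟧)
      (h : interval K D c d ⟶ interval K D e f),
      g ≫ ((toDerived K D).map h)⟦(1 : ℤ)⟧' ≠ 0 := by
  obtain ⟨h, hh⟩ := exists_interval_hom (K := K) hΓ hJL.2.2.1 hJL.2.2.2
  obtain ⟨ξ, -, hξ⟩ := exists_extensionClass (K := K) hΓ hab hcd hb hd hIJ.2.2.1 hIJ.2.2.2
    (p := max (max a c) e) (by omega) (by omega)
  obtain ⟨hm, hM⟩ := bounds_of_not_hom hb hf hIL.2.2.1 hIL.2.2.2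
  obtain ⟨i, j, ar, hp⟩ := exists_arrow hΓ (D := D) (p := max (max a c) e) (by omega) (by omega)
  obtain ⟨hi, hj⟩ := mem_of_arrow hΓ hab hef hIL.2.2.1 hIL.2.2.2 ar (by omega) (by omega)
  obtain ⟨-, hj'⟩ := mem_of_arrow hΓ hab hcd hIJ.2.2.1 hIJ.2.2.2 ar (by omega) (by omega)
  refine ⟨extensionClass ξ, h, ?_⟩
  rw [extensionClass_comp]
  have hc : ∀ k l (br : D.arrow k l), (a ≤ k.val ∧ k.val < b) → (e ≤ l.val ∧ l.val < f) →
      cochainCoeff (S := fun i : Fin ℓ => a ≤ i.val ∧ i.val < b)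
        (S' := fun i : Fin ℓ => e ≤ i.val ∧ i.val < f)
        (fun i j a => app h j ∘ₗ ξ i j a) k l br = thinCoeff h l * cochainCoeff ξ k l br :=
    fun k l br _ _ => cochainCoeff_comp ξ h k l br
  refine extensionClass_ne_zero hΓ hab hef hb hf hIL.2.2.1 hIL.2.2.2 _ ar hi hj ?_ ?_
  · rw [hc i j ar hi hj, hh j (by omega), hξ i j ar hi hj', if_pos (by omega), one_mul]
    exact one_ne_zero
  · intro k l br hk hl hm'
    rw [hc k l br hk hl]
    by_cases hl' : c ≤ l.val ∧ l.val < d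
    · rw [hξ k l br hk hl', if_neg (by omega), mul_zero]
    · rw [thinCoeff_eq_zero h (by omega), zero_mul]

end Comp

end SRep

/-! ### Properties of morphisms in terms of full subcategories -/

section HomLine

variable {C : Type*} [Category* C] [Preadditive C]

/-- There are no nonzero morphisms from `X` to `Y`. -/
def HomZero (X Y : C) : Prop := ∀ f : X ⟶ Y, f = 0

/-- There are nonzero morphisms from `X` to `Y`, and all of them are in one orbit of `Aut X`. -/
def HomLine (X Y : C) : Prop :=
  (∃ f : X ⟶ Y, f ≠ 0) ∧ ∀ f g : X ⟶ Y, f ≠ 0 → g ≠ 0 → ∃ e : X ≅ X, g = e.hom ≫ f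

/-- There are morphisms `X ⟶ Y ⟶ Z` with nonzero composition. -/
def CompNonzero (X Y Z : C) : Prop := ∃ (f : X ⟶ Y) (g : Y ⟶ Z), f ≫ g ≠ 0

lemma HomZero.of_iso {X Y X' Y' : C} (h : HomZero X Y) (e : X ≅ X') (e' : Y ≅ Y') :
    HomZero X' Y' := fun f => by
  rw [← cancel_epi e.hom, ← cancel_mono e'.inv, Category.assoc, h (e.hom ≫ f ≫ e'.inv)]
  simp

lemma HomLine.of_iso {X Y X' Y' : C} (h : HomLine X Y) (e : X ≅ X') (e' : Y ≅ Y') :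
    HomLine X' Y' := by
  have key : ∀ f : X' ⟶ Y', f ≠ 0 → e.hom ≫ f ≫ e'.inv ≠ 0 := fun f hf h0 => hf (by
    rw [← cancel_epi e.hom, ← cancel_mono e'.inv, Category.assoc, h0]
    simp)
  obtain ⟨⟨f, hf⟩, h⟩ := h
  refine ⟨⟨e.inv ≫ f ≫ e'.hom, fun h0 => hf ?_⟩, fun f g hf hg => ?_⟩
  · rw [← cancel_epi e.inv, ← cancel_mono e'.hom, Category.assoc, h0]
    simp
  · obtain ⟨u, hu⟩ := h _ _ (key f hf) (key g hg)
    refine ⟨e.symm ≪≫ u ≪≫ e, ?_⟩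
    rw [← cancel_epi e.hom, ← cancel_mono e'.inv, Category.assoc, hu]
    simp

lemma CompNonzero.of_iso {X Y Z X' Y' Z' : C} (h : CompNonzero X Y Z) (e : X ≅ X') (e' : Y ≅ Y')
    (e'' : Z ≅ Z') : CompNonzero X' Y' Z' := by
  obtain ⟨f, g, h⟩ := h
  refine ⟨e.inv ≫ f ≫ e'.hom, e'.inv ≫ g ≫ e''.hom, fun h0 => h ?_⟩
  rw [← cancel_epi e.inv, ← cancel_mono e''.hom]
  simpa using h0

variable {C' : Type*} [Category* C'] [Preadditive C'] (F : C ⥤ C') [F.Additive]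

lemma HomZero.of_map [F.Faithful] {X Y : C} (h : HomZero (F.obj X) (F.obj Y)) : HomZero X Y := fun f =>
  F.map_injective (by rw [h (F.map f), F.map_zero])

lemma HomLine.of_map [F.Full] [F.Faithful] {X Y : C} (h : HomLine (F.obj X) (F.obj Y)) : HomLine X Y := by
  have key : ∀ {f : X ⟶ Y}, f ≠ 0 → F.map f ≠ 0 := fun hf h0 => hf (F.map_injective (by
    rw [h0, F.map_zero]))
  obtain ⟨⟨f, hf⟩, h⟩ := h
  obtain ⟨f, rfl⟩ := F.map_surjective f
  refine ⟨⟨f, fun h0 => hf (by rw [h0, F.map_zero])⟩, fun f g hf hg => ?_⟩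
  obtain ⟨u, hu⟩ := h _ _ (key hf) (key hg)
  refine ⟨F.preimageIso u, F.map_injective ?_⟩
  rw [hu, F.map_comp, F.preimageIso_hom, F.map_preimage]

lemma CompNonzero.of_map [F.Full] {X Y Z : C} (h : CompNonzero (F.obj X) (F.obj Y) (F.obj Z)) :
    CompNonzero X Y Z := by
  obtain ⟨f, g, h⟩ := h
  obtain ⟨f, rfl⟩ := F.map_surjective f
  obtain ⟨g, rfl⟩ := F.map_surjective g
  exact ⟨f, g, fun h0 => h (by rw [← F.map_comp, h0, F.map_zero])⟩

end HomLine

/-! ### Comparison of the derived category with its orbit category -/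

namespace Orbit

variable {C : Type*} [Category* C] [Preadditive C] [HasShift C ℤ]
  [∀ n : ℤ, (shiftFunctor C n).Additive]

instance : (proj C).Faithful where
  map_injective {X Y} f g h := by
    have h' := homog_injective (X := ⟨X⟩) (Y := ⟨Y⟩) 0 h
    exact (ShiftedHom.homEquiv (2 * 0 : ℤ) (mul_zero 2)).injective h'

/-- If only degree zero contributes, every morphism comes from the original category. -/
lemma exists_eq_proj_map {X Y : C} (h : ∀ l : ℤ, l ≠ 0 → ∀ f : X ⟶ Y⟦2 * l⟧, f = 0)
    (f : (proj C).obj X ⟶ (proj C).obj Y) : ∃ g : X ⟶ Y, f = (proj C).map g := by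
  obtain ⟨g, rfl⟩ := exists_eq_homog 0 h f
  obtain ⟨g, rfl⟩ := (ShiftedHom.homEquiv (2 * 0 : ℤ) (mul_zero 2)).surjective g
  exact ⟨g, rfl⟩

end Orbit

namespace SRep

variable {K : Type u} [Field K] {V : Type} {Γ : SimpleGraph V} {D : ColouredQuiver Γ}

/-- Between unshifted objects only the degrees zero and one can be nonzero, and the orbit category
collects the even ones. -/
lemma exists_eq_proj_map_hom {X Y : SRep K D} (f : (Orbit.proj _).obj ((toDerived K D).obj X) ⟶
    (Orbit.proj _).obj ((toDerived K D).obj Y)) :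
    ∃ g : X ⟶ Y, f = (Orbit.proj _).map ((toDerived K D).map g) := by
  obtain ⟨g, rfl⟩ := Orbit.exists_eq_proj_map (fun l hl f => by
    rcases lt_or_gt_of_ne hl with h | h
    · exact hom_shift_eq_zero_of_neg (by omega) f
    · exact hom_shift_eq_zero (by omega) f) f
  obtain ⟨g, rfl⟩ := (toDerived K D).map_surjective g
  exact ⟨g, rfl⟩

lemma exists_eq_proj_map_ext {X Y : SRep K D} (f : (Orbit.proj _).obj ((toDerived K D).obj X) ⟶
    (Orbit.proj _).obj (((toDerived K D).obj Y)⟦(1 : ℤ)⟧)) :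
    ∃ g, f = (Orbit.proj _).map g := by
  refine Orbit.exists_eq_proj_map (fun l hl f => ?_) f
  rw [← cancel_mono ((shiftFunctorAdd' (DerivedCategory (SRep K D)) 1 (2 * l) (1 + 2 * l)
    rfl).inv.app _), zero_comp]
  rcases lt_or_gt_of_ne hl with h | h
  · exact hom_shift_eq_zero_of_neg (by omega) _
  · exact hom_shift_eq_zero (by omega) _

lemma scalar_comp_scalar (X : SRep K D) {r s : K} (h : r * s = 1) :
    scalar X r ≫ scalar X s = 𝟙 X := hom_ext fun i => by
  ext x
  change s • r • x = x
  rw [smul_smul, mul_comm, h, one_smul]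

/-- Multiplication by a nonzero scalar. -/
@[simps]
def scalarIso (X : SRep K D) {r : K} (hr : r ≠ 0) : X ≅ X where
  hom := scalar X r
  inv := scalar X r⁻¹
  hom_inv_id := scalar_comp_scalar X (mul_inv_cancel₀ hr)
  inv_hom_id := scalar_comp_scalar X (inv_mul_cancel₀ hr)

/-! ### Objects attached to ordered pairs of points -/

section Line

variable {ℓ : ℕ} {Γ : SimpleGraph (Fin ℓ)} {D : ColouredQuiver Γ}

open Classical in
variable (K D) in
/-- The object of the orbit category attached to a pair of different points. -/
def pairObj (a b : ℕ) : Orbit (DerivedCategory (SRep K D)) :=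
  if a < b then (Orbit.proj _).obj ((toDerived K D).obj (interval K D a b))
  else (Orbit.proj _).obj (((toDerived K D).obj (interval K D b a))⟦(1 : ℤ)⟧)

/-- Since `T²` is trivial in the orbit category, translation exchanges the two points; this reduces
statements on ordered pairs to the case `a < b`. -/
lemma nonempty_translation_pairObj {a b : ℕ} (h : a ≠ b) :
    Nonempty ((Orbit.translation _).obj (pairObj K D a b) ≅ pairObj K D b a) := by
  rcases lt_or_gt_of_ne h with h | h
  · rw [pairObj, if_pos h, pairObj, if_neg h.not_gt]
    exact ⟨Iso.refl _⟩
  · rw [pairObj, if_neg h.not_gt, pairObj, if_pos h]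
    exact ⟨Orbit.translationTranslationIso (Orbit.mk ((toDerived K D).obj (interval K D b a)))⟩

variable (hΓ : ∀ i j : Fin ℓ, Γ.Adj i j ↔ i.val + 1 = j.val ∨ j.val + 1 = i.val)

include hΓ in
-- For `c < d` the morphisms are those of interval modules, for `d < c` they are extension classes.
-- The automorphisms `scalarIso` express proportionality without a linear structure on the orbit
-- category.
lemma homLine_pairObj_of_lt {a b c d : ℕ} (hab : a < b) (hcd : c ≠ d) (hb : b ≤ ℓ) (hc : c ≤ ℓ)
    (hd : d ≤ ℓ) (h : Cyc (angle D a) (angle D c) (angle D b) (angle D d)) :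
    HomLine (pairObj K D a b) (pairObj K D c d) := by
  rw [pairObj, if_pos hab]
  rcases lt_or_gt_of_ne hcd with hcd | hcd
  · rw [pairObj, if_pos hcd]
    rw [cyc_hom_iff hab hcd hb hd] at h
    refine ⟨?_, fun f g hf hg => ?_⟩
    · obtain ⟨f, hf⟩ := exists_interval_hom (K := K) hΓ h.2.2.1 h.2.2.2
      refine ⟨(Orbit.proj _).map ((toDerived K D).map f), fun h0 => ?_⟩
      have h1 : f = 0 := (toDerived K D).map_injective ((Orbit.proj _).map_injective
        (h0.trans (by rw [Functor.map_zero, Functor.map_zero])))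
      have h2 := hf ⟨max a c, by omega⟩ (by simp only; omega)
      rw [h1, thinCoeff_zero] at h2
      exact zero_ne_one h2
    · obtain ⟨f, rfl⟩ := exists_eq_proj_map_hom f
      obtain ⟨g, rfl⟩ := exists_eq_proj_map_hom g
      obtain ⟨r, hr, rfl⟩ := exists_scalar_comp hΓ (f := f) (g := g)
        (fun h0 => hf (by rw [h0, Functor.map_zero, Functor.map_zero]))
        (fun h0 => hg (by rw [h0, Functor.map_zero, Functor.map_zero]))
      refine ⟨(Orbit.proj _).mapIso ((toDerived K D).mapIso (scalarIso _ hr)), ?_⟩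
      rw [Functor.map_comp, Functor.map_comp]
      rfl
  · rw [pairObj, if_neg hcd.not_gt]
    rw [cyc_ext_iff hab hcd hb hc] at h
    refine ⟨?_, fun f g hf hg => ?_⟩
    · obtain ⟨ξ, hξ, -⟩ := exists_extensionClass (K := K) hΓ hab hcd hb hc h.2.2.1 h.2.2.2
        (p := max a d) le_rfl (by omega)
      exact ⟨(Orbit.proj _).map (extensionClass ξ), fun h0 => hξ ((Orbit.proj _).map_injective
        (h0.trans (Functor.map_zero _ _ _).symm))⟩
    · obtain ⟨f, rfl⟩ := exists_eq_proj_map_ext f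
      obtain ⟨g, rfl⟩ := exists_eq_proj_map_ext g
      obtain ⟨r, hr, rfl⟩ := exists_scalar_comp_ext hΓ (f := f) (g := g)
        (fun h0 => hf (by rw [h0, Functor.map_zero])) (fun h0 => hg (by rw [h0, Functor.map_zero]))
      refine ⟨(Orbit.proj _).mapIso ((toDerived K D).mapIso (scalarIso _ hr)), ?_⟩
      rw [Functor.map_comp]
      rfl

include hΓ in
lemma homZero_pairObj_of_lt {a b c d : ℕ} (hab : a < b) (hcd : c ≠ d) (hb : b ≤ ℓ) (hc : c ≤ ℓ)
    (hd : d ≤ ℓ) (h : ¬Cyc (angle D a) (angle D c) (angle D b) (angle D d)) :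
    HomZero (pairObj K D a b) (pairObj K D c d) := by
  rw [pairObj, if_pos hab]
  rcases lt_or_gt_of_ne hcd with hcd | hcd
  · rw [pairObj, if_pos hcd]
    rw [cyc_hom_iff hab hcd hb hd] at h
    intro f
    obtain ⟨f, rfl⟩ := exists_eq_proj_map_hom f
    rw [interval_hom_eq_zero hΓ hab hcd hb hd h f, Functor.map_zero, Functor.map_zero]
  · rw [pairObj, if_neg hcd.not_gt]
    rw [cyc_ext_iff hab hcd hb hc] at h
    intro f
    obtain ⟨f, rfl⟩ := exists_eq_proj_map_ext f
    rw [interval_ext_eq_zero hΓ hab hcd hb h f, Functor.map_zero]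

include hΓ in
lemma compNonzero_pairObj_of_lt {a b c d e f : ℕ} (hab : a < b) (hcd : c ≠ d) (hef : e ≠ f)
    (hb : b ≤ ℓ) (hc : c ≤ ℓ) (hd : d ≤ ℓ) (he : e ≤ ℓ) (hf : f ≤ ℓ)
    (h1 : Cyc (angle D a) (angle D c) (angle D b) (angle D d))
    (h2 : Cyc (angle D c) (angle D e) (angle D d) (angle D f))
    (h3 : Cyc (angle D a) (angle D e) (angle D b) (angle D f)) :
    CompNonzero (pairObj K D a b) (pairObj K D c d) (pairObj K D e f) := by
  rw [pairObj, if_pos hab]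
  rcases lt_or_gt_of_ne hcd with hcd | hcd
  · rw [pairObj, if_pos hcd]
    rcases lt_or_gt_of_ne hef with hef | hef
    · rw [pairObj, if_pos hef]
      rw [cyc_hom_iff ‹_› ‹_› ‹_› ‹_›] at h1 h2 h3
      obtain ⟨g, h, hgh⟩ := exists_hom_comp_hom (K := K) hΓ hf hab hcd hef h1 h2 ⟨h3.1, h3.2.1⟩
      refine ⟨(Orbit.proj _).map ((toDerived K D).map g),
        (Orbit.proj _).map ((toDerived K D).map h), fun h0 => hgh ?_⟩
      rw [← Functor.map_comp, ← Functor.map_comp] at h0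
      exact (toDerived K D).map_injective ((Orbit.proj _).map_injective
        (h0.trans (by rw [Functor.map_zero, Functor.map_zero])))
    · rw [pairObj, if_neg hef.not_gt]
      rw [cyc_hom_iff ‹_› ‹_› ‹_› ‹_›] at h1
      rw [cyc_ext_iff ‹_› ‹_› ‹_› ‹_›] at h2 h3
      obtain ⟨g, h, hgh⟩ := exists_hom_comp_ext (K := K) hΓ hb hd he hab hcd hef h1 h2 h3
      refine ⟨(Orbit.proj _).map ((toDerived K D).map g), (Orbit.proj _).map h, fun h0 => hgh ?_⟩
      rw [← Functor.map_comp] at h0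
      exact (Orbit.proj _).map_injective (h0.trans (Functor.map_zero _ _ _).symm)
  · rw [pairObj, if_neg hcd.not_gt]
    rw [cyc_ext_iff ‹_› ‹_› ‹_› ‹_›] at h1
    rcases lt_or_gt_of_ne hef with hef | hef
    -- Two extension classes in a row would have degree two. The cyclic conditions exclude this: the
    -- left ends would satisfy incompatible inequalities in the linear order `LeftHom`.
    · exfalso
      have h2' : Cyc (angle D d) (angle D f) (angle D c) (angle D e) := by
        unfold Cyc at h2 ⊢
        omega
      rw [cyc_hom_iff ‹_› ‹_› ‹_› ‹_›] at h3
      rw [cyc_ext_iff ‹_› ‹_› ‹_› ‹_›] at h2'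
      obtain ⟨-, -, h1, -⟩ := h1
      obtain ⟨-, -, h2, -⟩ := h2'
      obtain ⟨-, -, h3, -⟩ := h3
      clear * - h1 h2 h3
      unfold LeftHom at h1 h2 h3
      push Not at h1 h2
      obtain ⟨h1, h1', h1''⟩ := h1
      obtain ⟨h2, h2', h2''⟩ := h2
      rcases h3 with rfl | ⟨h3, h4⟩ | ⟨h3, h4⟩
      · rcases lt_or_gt_of_ne h1 with h5 | h5
        · exact h2'' h5 (h1' h5)
        · exact h1'' h5 (h2' h5)
      · rcases lt_or_gt_of_ne h2 with h5 | h5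
        · exact h4 (h2' h5)
        · exact h2'' h5 (h1' (h3.trans h5))
      · rcases lt_or_gt_of_ne h1 with h5 | h5
        · exact h2'' (h3.trans h5) (h1' h5)
        · exact h1'' h5 h4
    · rw [pairObj, if_neg hef.not_gt]
      have h2' : Cyc (angle D d) (angle D f) (angle D c) (angle D e) := by
        unfold Cyc at h2 ⊢
        omega
      rw [cyc_ext_iff ‹_› ‹_› ‹_› ‹_›] at h3
      rw [cyc_hom_iff ‹_› ‹_› ‹_› ‹_›] at h2'
      obtain ⟨g, h, hgh⟩ := exists_ext_comp_hom (K := K) hΓ hb hc he hab hcd hef h1 h2' h3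
      refine ⟨(Orbit.proj _).map g, (Orbit.proj _).map (((toDerived K D).map h)⟦(1 : ℤ)⟧'),
        fun h0 => hgh ?_⟩
      rw [← Functor.map_comp] at h0
      exact (Orbit.proj _).map_injective (h0.trans (Functor.map_zero _ _ _).symm)

lemma cyc_rotate {x y z w : ℕ} : Cyc x y z w ↔ Cyc z w x y := by
  unfold Cyc
  omega

include hΓ in
lemma homLine_pairObj {a b c d : ℕ} (hab : a ≠ b) (hcd : c ≠ d) (ha : a ≤ ℓ) (hb : b ≤ ℓ)
    (hc : c ≤ ℓ) (hd : d ≤ ℓ) (h : Cyc (angle D a) (angle D c) (angle D b) (angle D d)) :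
    HomLine (pairObj K D a b) (pairObj K D c d) := by
  rcases lt_or_gt_of_ne hab with h' | h'
  · exact homLine_pairObj_of_lt hΓ h' hcd hb hc hd h
  · obtain ⟨e⟩ := nonempty_translation_pairObj (K := K) (D := D) hab
    obtain ⟨e'⟩ := nonempty_translation_pairObj (K := K) (D := D) hcd
    exact HomLine.of_map (Orbit.translation _)
      ((homLine_pairObj_of_lt hΓ h' hcd.symm ha hd hc (cyc_rotate.1 h)).of_iso e.symm e'.symm)

include hΓ in
lemma homZero_pairObj {a b c d : ℕ} (hab : a ≠ b) (hcd : c ≠ d) (ha : a ≤ ℓ) (hb : b ≤ ℓ)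
    (hc : c ≤ ℓ) (hd : d ≤ ℓ) (h : ¬Cyc (angle D a) (angle D c) (angle D b) (angle D d)) :
    HomZero (pairObj K D a b) (pairObj K D c d) := by
  rcases lt_or_gt_of_ne hab with h' | h'
  · exact homZero_pairObj_of_lt hΓ h' hcd hb hc hd h
  · obtain ⟨e⟩ := nonempty_translation_pairObj (K := K) (D := D) hab
    obtain ⟨e'⟩ := nonempty_translation_pairObj (K := K) (D := D) hcd
    exact HomZero.of_map (Orbit.translation _)
      ((homZero_pairObj_of_lt hΓ h' hcd.symm ha hd hc (mt cyc_rotate.2 h)).of_iso e.symm e'.symm)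

include hΓ in
lemma compNonzero_pairObj {a b c d e f : ℕ} (hab : a ≠ b) (hcd : c ≠ d) (hef : e ≠ f)
    (ha : a ≤ ℓ) (hb : b ≤ ℓ) (hc : c ≤ ℓ) (hd : d ≤ ℓ) (he : e ≤ ℓ) (hf : f ≤ ℓ)
    (h1 : Cyc (angle D a) (angle D c) (angle D b) (angle D d))
    (h2 : Cyc (angle D c) (angle D e) (angle D d) (angle D f))
    (h3 : Cyc (angle D a) (angle D e) (angle D b) (angle D f)) :
    CompNonzero (pairObj K D a b) (pairObj K D c d) (pairObj K D e f) := by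
  rcases lt_or_gt_of_ne hab with h' | h'
  · exact compNonzero_pairObj_of_lt hΓ h' hcd hef hb hc hd he hf h1 h2 h3
  · obtain ⟨i⟩ := nonempty_translation_pairObj (K := K) (D := D) hab
    obtain ⟨i'⟩ := nonempty_translation_pairObj (K := K) (D := D) hcd
    obtain ⟨i''⟩ := nonempty_translation_pairObj (K := K) (D := D) hef
    exact CompNonzero.of_map (Orbit.translation _)
      ((compNonzero_pairObj_of_lt hΓ h' hcd.symm hef.symm ha hd hc hf he (cyc_rotate.1 h1)
        (cyc_rotate.1 h2) (cyc_rotate.1 h3)).of_iso i.symm i'.symm i''.symm)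

open Classical in
variable (K D) in
/-- The object of the root category attached to a pair of different points. -/
def rootPair (a b : ℕ) : RootCategory K D :=
  if a < b then ⟨stalk (interval K D a b)⟩ else ⟨(stalk (interval K D b a))⟦(1 : ℤ)⟧⟩

variable (K D) in
/-- The inclusion of the root category in the orbit category of the derived category. -/
abbrev rootCategoryι : RootCategory K D ⥤ Orbit (DerivedCategory (SRep K D)) :=
  Orbit.map (DerivedCategory.Bounded.ι (C := SRep K D))

lemma nonempty_rootPair_iso (a b : ℕ) :
    Nonempty ((rootCategoryι K D).obj (rootPair K D a b) ≅ pairObj K D a b) := by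
  by_cases h : a < b
  · rw [rootPair, if_pos h, pairObj, if_pos h]
    exact ⟨Iso.refl _⟩
  · rw [rootPair, if_neg h, pairObj, if_neg h]
    exact ⟨(Orbit.proj _).mapIso (((DerivedCategory.Bounded.ι (C := SRep K D)).commShiftIso
      (1 : ℤ)).app (stalk (interval K D b a)))⟩

include hΓ in
lemma homLine_rootPair {a b c d : ℕ} (hab : a ≠ b) (hcd : c ≠ d) (ha : a ≤ ℓ) (hb : b ≤ ℓ)
    (hc : c ≤ ℓ) (hd : d ≤ ℓ) (h : Cyc (angle D a) (angle D c) (angle D b) (angle D d)) :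
    HomLine (rootPair K D a b) (rootPair K D c d) := by
  obtain ⟨e⟩ := nonempty_rootPair_iso (K := K) (D := D) a b
  obtain ⟨e'⟩ := nonempty_rootPair_iso (K := K) (D := D) c d
  exact HomLine.of_map (rootCategoryι K D)
    ((homLine_pairObj hΓ hab hcd ha hb hc hd h).of_iso e.symm e'.symm)

include hΓ in
lemma homZero_rootPair {a b c d : ℕ} (hab : a ≠ b) (hcd : c ≠ d) (ha : a ≤ ℓ) (hb : b ≤ ℓ)
    (hc : c ≤ ℓ) (hd : d ≤ ℓ) (h : ¬Cyc (angle D a) (angle D c) (angle D b) (angle D d)) :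
    HomZero (rootPair K D a b) (rootPair K D c d) := by
  obtain ⟨e⟩ := nonempty_rootPair_iso (K := K) (D := D) a b
  obtain ⟨e'⟩ := nonempty_rootPair_iso (K := K) (D := D) c d
  exact HomZero.of_map (rootCategoryι K D)
    ((homZero_pairObj hΓ hab hcd ha hb hc hd h).of_iso e.symm e'.symm)

include hΓ in
lemma compNonzero_rootPair {a b c d e f : ℕ} (hab : a ≠ b) (hcd : c ≠ d) (hef : e ≠ f)
    (ha : a ≤ ℓ) (hb : b ≤ ℓ) (hc : c ≤ ℓ) (hd : d ≤ ℓ) (he : e ≤ ℓ) (hf : f ≤ ℓ)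
    (h1 : Cyc (angle D a) (angle D c) (angle D b) (angle D d))
    (h2 : Cyc (angle D c) (angle D e) (angle D d) (angle D f))
    (h3 : Cyc (angle D a) (angle D e) (angle D b) (angle D f)) :
    CompNonzero (rootPair K D a b) (rootPair K D c d) (rootPair K D e f) := by
  obtain ⟨i⟩ := nonempty_rootPair_iso (K := K) (D := D) a b
  obtain ⟨i'⟩ := nonempty_rootPair_iso (K := K) (D := D) c d
  obtain ⟨i''⟩ := nonempty_rootPair_iso (K := K) (D := D) e f
  exact CompNonzero.of_map (rootCategoryι K D)
    ((compNonzero_pairObj hΓ hab hcd hef ha hb hc hd he hf h1 h2 h3).of_iso i.symm i'.symm i''.symm)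

include hΓ in
/-- Every object of the root category is a direct sum of the objects attached to pairs of points. -/
lemma finSum_rootPair (Z : RootCategory K D) :
    FinSum (fun X => ∃ a b, a ≠ b ∧ a ≤ ℓ ∧ b ≤ ℓ ∧ X = rootPair K D a b) Z := by
  refine FinSum.map (Orbit.proj _) ?_ (finSum_stalk Z.as)
  rintro _ ⟨Y, n, rfl⟩
  let F : SRep K D ⥤ DerivedCategory.Bounded (SRep K D) :=
    ObjectProperty.lift _ (toDerived K D) (fun X => (stalk X).property)
  have : F.Additive := ⟨fun {X Y f g} => (DerivedCategory.Bounded.ι (C := SRep K D)).map_injective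
    ((toDerived K D).map_add.trans
      (Functor.map_add (DerivedCategory.Bounded.ι (C := SRep K D)) (f := F.map f)
        (g := F.map g)).symm)⟩
  refine FinSum.map (F ⋙ shiftFunctor _ n ⋙ Orbit.proj _) ?_ (finSum_interval hΓ Y)
  rintro _ ⟨a, b, hab, hb, rfl⟩
  -- An even shift is trivial in the orbit category, an odd one exchanges the two points.
  rcases Int.even_or_odd' n with ⟨k, rfl | rfl⟩
  · refine .of ⟨a, b, hab.ne, by omega, hb, rfl⟩ ?_
    rw [rootPair, if_pos hab]
    exact (Orbit.isoOfShift k (Iso.refl _)).symm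
  · refine .of ⟨b, a, hab.ne', hb, by omega, rfl⟩ ?_
    rw [rootPair, if_neg hab.not_gt]
    exact (Orbit.isoOfShift k ((shiftFunctorAdd' _ 1 (2 * k) (2 * k + 1)
      (add_comm _ _)).app (stalk (interval K D a b)))).symm

end Line

end SRep

/-! ### Irreducible morphisms from a combinatorial description of `Hom` -/

section AuslanderReiten

lemma IsIrreducibleHom.of_iso {C : Type*} [Category* C] {X Y X' Y' : C} {f : X ⟶ Y} (h : IsIrreducibleHom f) (e : X' ≅ X)
    (e' : Y ≅ Y') : IsIrreducibleHom (e.hom ≫ f ≫ e'.hom) := by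
  obtain ⟨h1, h2, h3⟩ := h
  refine ⟨fun ⟨⟨r, hr⟩⟩ => h1 ⟨⟨e'.hom ≫ r ≫ e.hom, ?_⟩⟩, fun ⟨⟨r, hr⟩⟩ =>
    h2 ⟨⟨e'.hom ≫ r ≫ e.hom, ?_⟩⟩, fun Z g k hgk => ?_⟩
  · rw [← cancel_epi e.hom, ← cancel_mono e.inv]
    simpa using hr
  · rw [← cancel_epi e'.inv, ← cancel_mono e'.hom]
    simpa using hr
  · rcases h3 Z (e.inv ≫ g) (k ≫ e'.inv) (by
      rw [Category.assoc, reassoc_of% hgk]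
      simp) with ⟨⟨r, hr⟩⟩ | ⟨⟨r, hr⟩⟩
    · refine .inl ⟨⟨r ≫ e.inv, ?_⟩⟩
      rw [← cancel_epi e.inv, ← cancel_mono e.hom]
      simpa using hr
    · refine .inr ⟨⟨e'.inv ≫ r, ?_⟩⟩
      rw [← cancel_epi e'.hom, ← cancel_mono e'.inv]
      simpa using hr

variable {C : Type*} [Category* C] [Preadditive C]

lemma IsIndecomposable.of_iso {X Y : C} (h : IsIndecomposable X) (e : X ≅ Y) :
    IsIndecomposable Y :=
  ⟨fun hY => h.1 (hY.of_iso e), fun A B b hb e' => h.2 A B b hb (e' ≪≫ e.symm)⟩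

lemma IsIndecomposable.isZero_or {Z X Y : C} (h : IsIndecomposable Z) (hZ : IsDirectSum Z X Y) :
    IsZero X ∨ IsZero Y := by
  obtain ⟨i, p, j, q, h1, h2, h3, h4, h5⟩ := hZ
  let b : BinaryBicone X Y :=
    { pt := Z, fst := p, snd := q, inl := i, inr := j, inl_fst := h1, inl_snd := h3,
      inr_fst := h4, inr_snd := h2 }
  exact h.2 X Y b (isBinaryBilimitOfTotal b h5) (Iso.refl _)

lemma IsDirectSum.iso_of_isZero_left {Z X Y : C} (h : IsDirectSum Z X Y) (hX : IsZero X) :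
    Nonempty (Y ≅ Z) := by
  obtain ⟨i, p, j, q, -, h2, -, -, h5⟩ := h
  rw [hX.eq_of_tgt p 0, zero_comp, zero_add] at h5
  exact ⟨⟨j, q, h2, h5⟩⟩

lemma IsDirectSum.iso_of_isZero_right {Z X Y : C} (h : IsDirectSum Z X Y) (hY : IsZero Y) :
    Nonempty (X ≅ Z) := by
  obtain ⟨i, p, j, q, h1, -, -, -, h5⟩ := h
  rw [hY.eq_of_tgt q 0, zero_comp, add_zero] at h5
  exact ⟨⟨i, p, h1, h5⟩⟩

lemma FinSum.exists_iso_of_isIndecomposable {P : C → Prop} {Z : C} (h : FinSum P Z)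
    (hZ : IsIndecomposable Z) : ∃ X, P X ∧ Nonempty (X ≅ Z) := by
  induction h with
  | of hX e => exact ⟨_, hX, ⟨e⟩⟩
  | zero h => exact absurd h hZ.1
  | sum h _ _ hX hY =>
    rcases hZ.isZero_or h with h0 | h0
    · obtain ⟨e⟩ := h.iso_of_isZero_left h0
      obtain ⟨X, hX, ⟨e'⟩⟩ := hY (hZ.of_iso e.symm)
      exact ⟨X, hX, ⟨e' ≪≫ e⟩⟩
    · obtain ⟨e⟩ := h.iso_of_isZero_right h0
      obtain ⟨X, hX, ⟨e'⟩⟩ := hX (hZ.of_iso e.symm)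
      exact ⟨X, hX, ⟨e' ≪≫ e⟩⟩

/-- If a morphism factors through a finite direct sum, and its composites through the summands
vanish, then it is zero. -/
lemma FinSum.comp_ne_zero {P : C → Prop} {Z : C} (h : FinSum P Z) {X Y : C} (g : X ⟶ Z)
    (k : Z ⟶ Y) (hgk : g ≫ k ≠ 0) :
    ∃ (W : C) (i : W ⟶ Z) (p : Z ⟶ W), P W ∧ i ≫ p = 𝟙 W ∧ (g ≫ p) ≫ i ≫ k ≠ 0 := by
  induction h with
  | of hX e =>
    exact ⟨_, e.hom, e.inv, hX, e.hom_inv_id, by simpa using hgk⟩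
  | zero h =>
    rw [h.eq_of_tgt g 0, zero_comp] at hgk
    exact absurd rfl hgk
  | @sum Z A B h _ _ hA hB =>
    obtain ⟨i, p, j, q, h1, h2, -, -, h5⟩ := h
    have h6 : (g ≫ p) ≫ i ≫ k + (g ≫ q) ≫ j ≫ k = g ≫ k := by
      calc _ = g ≫ (p ≫ i + q ≫ j) ≫ k := by simp
        _ = _ := by rw [h5, Category.id_comp]
    by_cases h0 : (g ≫ p) ≫ i ≫ k = 0
    · rw [h0, zero_add] at h6
      obtain ⟨W, i', p', hW, h7, h8⟩ := hB (g ≫ q) (j ≫ k) (h6 ▸ hgk)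
      exact ⟨W, i' ≫ j, q ≫ p', hW, by simp [reassoc_of% h2, h7], by simpa using h8⟩
    · obtain ⟨W, i', p', hW, h7, h8⟩ := hA (g ≫ p) (i ≫ k) h0
      exact ⟨W, i' ≫ i, p ≫ p', hW, by simp [reassoc_of% h1, h7], by simpa using h8⟩

/-- A complete list `M` of indecomposable objects, a description `H` of the pairs with nonzero
morphisms, all of them proportional, and the relation `Cov` of being neighbours for `H`. -/
structure IsHomPoset {R : Type*} (M : R → C) (H Cov : R → R → Prop) : Prop where
  homZero : ∀ α β, ¬H α β → HomZero (M α) (M β)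
  homLine : ∀ α β, H α β → HomLine (M α) (M β)
  refl : ∀ α, H α α
  antisymm : ∀ α β, H α β → H β α → α = β
  comp : ∀ α γ, H α γ → α ≠ γ → ¬Cov α γ → ∃ β, β ≠ α ∧ β ≠ γ ∧ CompNonzero (M α) (M β) (M γ)
  hom_of_cov : ∀ α γ, Cov α γ → H α γ
  ne_of_cov : ∀ α γ, Cov α γ → α ≠ γ
  eq_or_eq_of_cov : ∀ α β γ, Cov α γ → H α β → H β γ → β = α ∨ β = γ
  finSum : ∀ Z, FinSum (fun X => ∃ α, X = M α) Z

namespace IsHomPoset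

variable {R : Type*} {M : R → C} {H Cov : R → R → Prop} (h : IsHomPoset M H Cov)

include h

lemma hom_of_ne_zero {α β : R} {f : M α ⟶ M β} (hf : f ≠ 0) : H α β := by
  by_contra hH
  exact hf (h.homZero α β hH f)

lemma id_ne_zero (α : R) : 𝟙 (M α) ≠ 0 := by
  obtain ⟨⟨f, hf⟩, -⟩ := h.homLine α α (h.refl α)
  intro h0
  exact hf (by rw [← Category.id_comp f, h0, zero_comp])

lemma isIso_of_ne_zero {α : R} {f : M α ⟶ M α} (hf : f ≠ 0) : IsIso f := by
  obtain ⟨e, rfl⟩ := (h.homLine α α (h.refl α)).2 (𝟙 _) f (h.id_ne_zero α) hf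
  infer_instance

lemma eq_of_comp_eq_id {α β : R} {f : M α ⟶ M β} {g : M β ⟶ M α} (hfg : f ≫ g = 𝟙 _) : α = β := by
  refine h.antisymm _ _ (h.hom_of_ne_zero (f := f) fun h0 => ?_)
    (h.hom_of_ne_zero (f := g) fun h0 => ?_)
  · rw [h0, zero_comp] at hfg
    exact h.id_ne_zero α hfg.symm
  · rw [h0, comp_zero] at hfg
    exact h.id_ne_zero α hfg.symm

/-- Nonzero endomorphisms are invertible, so the idempotent of a direct sum decomposition is zero or
the identity. -/
lemma isIndecomposable (α : R) : IsIndecomposable (M α) := by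
  refine ⟨fun h0 => h.id_ne_zero α ((IsZero.iff_id_eq_zero _).1 h0), fun Y Z b _ e => ?_⟩
  by_cases h0 : e.inv ≫ b.fst ≫ b.inl ≫ e.hom = 0
  · left
    rw [IsZero.iff_id_eq_zero]
    have h1 : b.fst ≫ b.inl = 0 := by
      rw [← cancel_epi e.inv, ← cancel_mono e.hom]
      simpa using h0
    calc 𝟙 Y = b.inl ≫ (b.fst ≫ b.inl) ≫ b.fst := by simp
      _ = 0 := by rw [h1, zero_comp, comp_zero]
  · right
    rw [IsZero.iff_id_eq_zero]
    have h1 := h.isIso_of_ne_zero h0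
    have h2 : e.inv ≫ b.fst ≫ b.inl ≫ e.hom = 𝟙 _ := by
      rw [← cancel_mono (e.inv ≫ b.fst ≫ b.inl ≫ e.hom)]
      simp
    have h3 : b.fst ≫ b.inl = 𝟙 _ := by
      rw [← cancel_epi e.inv, ← cancel_mono e.hom]
      simpa using h2
    rw [← b.inr_snd, ← Category.comp_id b.inr, ← h3]
    simp

lemma exists_iso {X : C} (hX : IsIndecomposable X) : ∃ α, Nonempty (M α ≅ X) := by
  obtain ⟨_, ⟨α, rfl⟩, e⟩ := (h.finSum X).exists_iso_of_isIndecomposable hX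
  exact ⟨α, e⟩

/-- An irreducible morphism is nonzero, so up to an automorphism it equals any other nonzero
morphism between the same objects. If these are not neighbours, it factors through a third `M β`,
and neither factor splits, because no `M α` is a retract of another one. Conversely, if a nonzero
morphism between neighbours is factored through a direct sum, then its composite through some
summand is nonzero; that summand is one of the two ends, and the component between equal objects is
invertible. -/
lemma exists_irreducible_iff (α γ : R) :
    (∃ f : M α ⟶ M γ, IsIrreducibleHom f) ↔ Cov α γ := by
  constructor
  · rintro ⟨f, h1, h2, h3⟩
    have hf : f ≠ 0 := by
      rintro rfl
      -- The zero morphism factors as zero followed by zero, and neither factor splits.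
      rcases h3 (M α) 0 0 zero_comp with ⟨⟨r, hr⟩⟩ | ⟨⟨r, hr⟩⟩
      · rw [zero_comp] at hr
        exact h.id_ne_zero α hr.symm
      · rw [comp_zero] at hr
        exact h.id_ne_zero γ hr.symm
    have hH := h.hom_of_ne_zero hf
    by_contra hcov
    by_cases hαγ : α = γ
    · subst hαγ
      have := h.isIso_of_ne_zero hf
      exact h1 inferInstance
    · obtain ⟨β, hβα, hβγ, g, k, hgk⟩ := h.comp α γ hH hαγ hcov
      obtain ⟨e, he⟩ := (h.homLine α γ hH).2 _ f hgk hf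
      rcases h3 (M β) (e.hom ≫ g) k (by rw [he, Category.assoc]) with ⟨⟨r, hr⟩⟩ | ⟨⟨r, hr⟩⟩
      · exact hβα (h.eq_of_comp_eq_id hr).symm
      · exact hβγ (h.eq_of_comp_eq_id hr).symm
  · intro hcov
    obtain ⟨⟨f, hf⟩, -⟩ := h.homLine α γ (h.hom_of_cov α γ hcov)
    have hne := h.ne_of_cov α γ hcov
    refine ⟨f, fun ⟨⟨r, hr⟩⟩ => hne (h.eq_of_comp_eq_id hr),
      fun ⟨⟨r, hr⟩⟩ => hne (h.eq_of_comp_eq_id hr).symm, fun Z g k hgk => ?_⟩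
    obtain ⟨_, i, p, ⟨β, rfl⟩, hip, hne⟩ := (h.finSum Z).comp_ne_zero g k (hgk ▸ hf)
    have h1 : g ≫ p ≠ 0 := fun h0 => hne (by rw [h0, zero_comp])
    have h2 : i ≫ k ≠ 0 := fun h0 => hne (by rw [h0, comp_zero])
    rcases h.eq_or_eq_of_cov α β γ hcov (h.hom_of_ne_zero h1) (h.hom_of_ne_zero h2) with rfl | rfl
    · have := h.isIso_of_ne_zero h1
      exact .inl ⟨⟨p ≫ inv (g ≫ p), by rw [← Category.assoc, IsIso.hom_inv_id]⟩⟩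
    · have := h.isIso_of_ne_zero h2
      exact .inr ⟨⟨inv (i ≫ k) ≫ i, by rw [Category.assoc, IsIso.inv_hom_id]⟩⟩

lemma bijective_mk : Function.Bijective (fun α => ARVertex.mk (M α) (h.isIndecomposable α)) := by
  constructor
  · intro α β hαβ
    obtain ⟨e⟩ := Quotient.exact hαβ
    exact h.eq_of_comp_eq_id (α := α) (β := β) e.hom_inv_id
  · intro x
    induction x using Quotient.inductionOn with
    | h X =>
      obtain ⟨α, e⟩ := h.exists_iso X.2
      exact ⟨α, Quotient.sound e⟩

lemma arArrow_iff (α γ : R) : ARArrow (ARVertex.mk (M α) (h.isIndecomposable α))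
    (ARVertex.mk (M γ) (h.isIndecomposable γ)) ↔ Cov α γ := by
  rw [← h.exists_irreducible_iff]
  constructor
  · rintro ⟨X, Y, hX, hY, hXα, hYγ, f, hf⟩
    obtain ⟨e⟩ := Quotient.exact hXα
    obtain ⟨e'⟩ := Quotient.exact hYγ
    exact ⟨_, hf.of_iso (X' := M α) (Y' := M γ) e.symm e'⟩
  · rintro ⟨f, hf⟩
    exact ⟨_, _, _, _, rfl, rfl, f, hf⟩

end IsHomPoset

end AuslanderReiten

/-! ### Words in adjacent transpositions -/

section Words

variable {N : ℕ}

/-- The left one of the two points at a vertex. -/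
def leftPt (i : Fin (N - 1)) : Fin N := ⟨i, by omega⟩

/-- The right one of the two points at a vertex. -/
def rightPt (i : Fin (N - 1)) : Fin N := ⟨i + 1, by omega⟩

lemma leftPt_lt_rightPt (i : Fin (N - 1)) : leftPt i < rightPt i := by
  simp [leftPt, rightPt, Fin.lt_def]

/-- The permutation given by a word in adjacent transpositions. -/
def wordPerm (w : List (Fin (N - 1))) : Equiv.Perm (Fin N) :=
  (w.map fun i => Equiv.swap (leftPt i) (rightPt i)).prod

@[simp]
lemma wordPerm_nil : wordPerm ([] : List (Fin (N - 1))) = 1 := rfl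

@[simp]
lemma wordPerm_cons (i : Fin (N - 1)) (w : List (Fin (N - 1))) :
    wordPerm (i :: w) = Equiv.swap (leftPt i) (rightPt i) * wordPerm w := by
  simp [wordPerm]

@[simp]
lemma wordPerm_append (v w : List (Fin (N - 1))) :
    wordPerm (v ++ w) = wordPerm v * wordPerm w := by
  simp [wordPerm]

/-- An adjacent transposition reverses the order of no other pair. -/
lemma eq_of_swap_lt {i : Fin (N - 1)} {x y : Fin N} (h : x < y)
    (h' : Equiv.swap (leftPt i) (rightPt i) y < Equiv.swap (leftPt i) (rightPt i) x) :
    x = leftPt i ∧ y = rightPt i := by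
  simp only [Equiv.swap_apply_def, leftPt, rightPt, Fin.lt_def, Fin.ext_iff] at *
  split_ifs at h' <;> simp_all <;> omega

/-- The exchange property. -/
lemma exists_shorter_word (v : List (Fin (N - 1))) (i : Fin (N - 1))
    (h : wordPerm v (rightPt i) < wordPerm v (leftPt i)) :
    ∃ v', v'.length + 1 = v.length ∧ wordPerm v' = wordPerm (v ++ [i]) := by
  induction v with
  | nil => exact absurd h (leftPt_lt_rightPt i).not_gt
  | cons k u ih =>
    rcases lt_or_ge (wordPerm u (rightPt i)) (wordPerm u (leftPt i)) with h' | h'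
    · obtain ⟨u', h1, h2⟩ := ih h'
      exact ⟨k :: u', by simp [h1], by simp [h2]⟩
    · have hne : wordPerm u (leftPt i) ≠ wordPerm u (rightPt i) :=
        (wordPerm u).injective.ne (leftPt_lt_rightPt i).ne
      rw [wordPerm_cons] at h
      obtain ⟨h1, h2⟩ := eq_of_swap_lt (lt_of_le_of_ne h' hne) h
      -- Only the first letter `k` reverses the pair, so `k` followed by `u` is the same permutation
      -- as `u` followed by `i`; appending `i` cancels `k`.
      refine ⟨u, rfl, ?_⟩
      have h3 : Equiv.swap (leftPt k) (rightPt k) * wordPerm u =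
          wordPerm u * Equiv.swap (leftPt i) (rightPt i) := by
        rw [Equiv.mul_swap_eq_swap_mul, h1, h2]
      simp only [wordPerm_append, wordPerm_cons, wordPerm_nil, mul_one]
      rw [mul_assoc, ← h3]
      simp

/-- No shorter word gives the same permutation. -/
def IsShortest (w : List (Fin (N - 1))) : Prop :=
  ∀ w', wordPerm w' = wordPerm w → w.length ≤ w'.length

lemma IsShortest.of_append_left {v w : List (Fin (N - 1))} (h : IsShortest (v ++ w)) :
    IsShortest v := fun v' hv => by
  have := h (v' ++ w) (by simp [hv])
  simpa using this

lemma IsShortest.of_append_right {v w : List (Fin (N - 1))} (h : IsShortest (v ++ w)) :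
    IsShortest w := fun w' hw => by
  have := h (v ++ w') (by simp [hw])
  simpa using this

lemma IsShortest.lt {v : List (Fin (N - 1))} {i : Fin (N - 1)} (h : IsShortest (v ++ [i])) :
    wordPerm v (leftPt i) < wordPerm v (rightPt i) := by
  by_contra hlt
  have hne : wordPerm v (leftPt i) ≠ wordPerm v (rightPt i) :=
    (wordPerm v).injective.ne (leftPt_lt_rightPt i).ne
  obtain ⟨v', h1, h2⟩ := exists_shorter_word v i (lt_of_le_of_ne (not_lt.1 hlt) hne.symm)
  have := h v' h2
  simp at this
  omega

/-- Any word for the new permutation reverses the pair at `i`, so the exchange property turns it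
into a word for the old permutation that is shorter by one. -/
lemma IsShortest.append_singleton {w : List (Fin (N - 1))} (h : IsShortest w) {i : Fin (N - 1)}
    (hi : wordPerm w (leftPt i) < wordPerm w (rightPt i)) : IsShortest (w ++ [i]) := by
  intro v hv
  have h1 : wordPerm (v ++ [i]) = wordPerm w := by
    simp [hv, mul_assoc]
  obtain ⟨v', h2, h3⟩ := exists_shorter_word v i (by simpa [hv] using hi)
  have := h v' (h3.trans h1)
  simp
  omega

/-- If one pair of points were met at two letters, then the word `v` between them would send the
points of `k` to those of `i` in reversed order, although `v ++ [k]` is shortest. -/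
lemma IsShortest.append_eq {u v : List (Fin (N - 1))} {i k : Fin (N - 1)}
    (h : IsShortest (u ++ i :: v ++ [k]))
    (h1 : wordPerm u (leftPt i) = wordPerm (u ++ i :: v) (leftPt k))
    (h2 : wordPerm u (rightPt i) = wordPerm (u ++ i :: v) (rightPt k)) : False := by
  have h3 : IsShortest (v ++ [k]) := by
    rw [List.append_assoc, List.cons_append] at h
    exact (h.of_append_right (v := u)).of_append_right (v := [i])
  have h4 := h3.lt
  simp only [wordPerm_append, wordPerm_cons, Equiv.Perm.mul_apply, EmbeddingLike.apply_eq_iff_eq]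
    at h1 h2
  rw [eq_comm, Equiv.swap_apply_eq_iff, Equiv.swap_apply_left] at h1
  rw [eq_comm, Equiv.swap_apply_eq_iff, Equiv.swap_apply_right] at h2
  rw [h1, h2] at h4
  exact h4.not_gt (leftPt_lt_rightPt i)

/-- A pair of points whose order is reversed is reversed at some letter of the word. -/
lemma exists_split {w : List (Fin (N - 1))} {a b : Fin N} (hab : a < b)
    (h : (wordPerm w)⁻¹ b < (wordPerm w)⁻¹ a) :
    ∃ u i v, w = u ++ i :: v ∧ wordPerm u (leftPt i) = a ∧ wordPerm u (rightPt i) = b := by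
  induction w using List.reverseRecOn with
  | nil => exact absurd h hab.not_gt
  | append_singleton u i ih =>
    rcases lt_or_ge ((wordPerm u)⁻¹ b) ((wordPerm u)⁻¹ a) with h' | h'
    · obtain ⟨u', k, v, h1, h2⟩ := ih h'
      exact ⟨u', k, v ++ [i], by rw [h1, List.append_assoc]; rfl, h2⟩
    · have hne : (wordPerm u)⁻¹ a ≠ (wordPerm u)⁻¹ b := (wordPerm u)⁻¹.injective.ne hab.ne
      obtain ⟨h1, h2⟩ := eq_of_swap_lt (i := i) (lt_of_le_of_ne h' hne) (by simpa using h)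
      refine ⟨u, i, [], rfl, ?_, ?_⟩
      · rw [← h1]; simp
      · rw [← h2]; simp

/-- A longest reduced word cannot be prolonged by any letter, so it reverses all adjacent pairs,
hence all pairs. -/
lemma exists_split_of_longest {w : List (Fin (N - 1))} (h : IsShortest w)
    (h' : ∀ w' : List (Fin (N - 1)), IsShortest w' → w'.length ≤ w.length) {a b : Fin N} (hab : a < b) :
    ∃ u i v, w = u ++ i :: v ∧ wordPerm u (leftPt i) = a ∧ wordPerm u (rightPt i) = b := by
  have hdesc : ∀ i : Fin (N - 1), wordPerm w (rightPt i) < wordPerm w (leftPt i) := by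
    intro i
    by_contra hlt
    have hne : wordPerm w (leftPt i) ≠ wordPerm w (rightPt i) :=
      (wordPerm w).injective.ne (leftPt_lt_rightPt i).ne
    have := h' _ (h.append_singleton (lt_of_le_of_ne (not_lt.1 hlt) hne))
    simp at this
  have hanti : ∀ (k : ℕ) (x y : Fin N), y.val = x.val + k + 1 → wordPerm w y < wordPerm w x := by
    intro k
    induction k with
    | zero =>
      intro x y hxy
      have := hdesc ⟨x, by omega⟩
      rwa [show rightPt ⟨x.val, by omega⟩ = y from Fin.ext hxy.symm,
        show leftPt ⟨x.val, by omega⟩ = x from rfl] at this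
    | succ k ih =>
      intro x y hxy
      have h1 := ih x ⟨x + k + 1, by omega⟩ rfl
      have h2 := hdesc ⟨x + k + 1, by omega⟩
      rw [show rightPt ⟨x.val + k + 1, by omega⟩ = y from Fin.ext (by simp [rightPt]; omega)] at h2
      exact h2.trans h1
  refine exists_split hab ?_
  by_contra hlt
  rcases eq_or_lt_of_le (not_lt.1 hlt) with h1 | h1
  · exact hab.ne ((wordPerm w)⁻¹.injective h1)
  · have := hanti (((wordPerm w)⁻¹ b).val - ((wordPerm w)⁻¹ a).val - 1) _ _
      (show ((wordPerm w)⁻¹ b).val = ((wordPerm w)⁻¹ a).val + _ + 1 by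
        have := Fin.lt_def.1 h1
        omega)
    simp only [Equiv.Perm.inv_def, Equiv.apply_symm_apply] at this
    exact this.not_gt hab

end Words

/-! ### The roots -/

section Roots

variable {n m : ℕ} (σ : Fin (n + m) ≃ Fin n ⊕ Fin m)

/-- The `a`-th one of the `ε`'s and `δ`'s. -/
def unitVec (a : Fin (n + m)) : Lattice n m := basisVec (σ a)

lemma unitVec_apply (a b : Fin (n + m)) : unitVec σ a (σ b) = if b = a then 1 else 0 := by
  simp [unitVec, basisVec, Pi.single_apply]

lemma unitVec_dotProduct (a b : Fin (n + m)) :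
    unitVec σ a ⬝ᵥ unitVec σ b = if a = b then 1 else 0 := by
  simp [unitVec, basisVec, Pi.single_apply, eq_comm]

lemma unitVec_injective : Function.Injective (unitVec σ) := by
  intro a b h
  have h1 := congrFun h (σ b)
  rw [unitVec_apply, unitVec_apply, if_pos rfl] at h1
  by_contra hne
  rw [if_neg (Ne.symm hne)] at h1
  exact zero_ne_one h1

lemma unitVec_sub_inj {a b c d : Fin (n + m)} (hab : a ≠ b) (hcd : c ≠ d) :
    unitVec σ a - unitVec σ b = unitVec σ c - unitVec σ d ↔ a = c ∧ b = d := by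
  refine ⟨fun h => ?_, by rintro ⟨rfl, rfl⟩; rfl⟩
  have h1 := fun x => congrFun h (σ x)
  simp only [Pi.sub_apply, unitVec_apply] at h1
  constructor
  · by_contra hne
    have := h1 a
    rw [if_pos rfl, if_neg hab, if_neg hne] at this
    split_ifs at this <;> omega
  · by_contra hne
    have := h1 b
    rw [if_pos rfl, if_neg hab.symm, if_neg hne] at this
    split_ifs at this <;> omega

lemma mem_roots_iff {v : Lattice n m} :
    v ∈ roots n m ↔ ∃ a b, a ≠ b ∧ v = unitVec σ a - unitVec σ b := by
  constructor
  · have key : ∀ x y : Fin n ⊕ Fin m, x ≠ y → ∃ a b, a ≠ b ∧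
        basisVec x - basisVec y = unitVec σ a - unitVec σ b := fun x y h =>
      ⟨σ.symm x, σ.symm y, σ.symm.injective.ne h, by simp [unitVec]⟩
    rintro ((⟨i, j, h, rfl⟩ | ⟨i, j, h, rfl⟩) | ⟨i, j, rfl | rfl⟩)
    · exact key _ _ (by simpa using h)
    · exact key _ _ (by simpa using h)
    · exact key _ _ (by simp)
    · rw [neg_sub]
      exact key _ _ (by simp)
  · rintro ⟨a, b, h, rfl⟩
    have h' := σ.injective.ne h
    unfold unitVec
    generalize σ a = x at *
    generalize σ b = y at *
    rcases x with i | i <;> rcases y with j | j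
    · exact .inl (.inl ⟨i, j, by simpa using h', rfl⟩)
    · exact .inr ⟨i, j, .inl rfl⟩
    · exact .inr ⟨j, i, .inr (neg_sub _ _).symm⟩
    · exact .inl (.inr ⟨i, j, by simpa using h', rfl⟩)

/-- The parity of a basis vector. -/
def pointParity (a : Fin (n + m)) : ZMod 2 := Sum.elim (fun _ => 0) (fun _ => 1) (σ a)

lemma mem_oddRoots_iff {a b : Fin (n + m)} (hab : a ≠ b) :
    unitVec σ a - unitVec σ b ∈ oddRoots n m ↔ pointParity σ a + pointParity σ b = 1 := by
  constructor
  · have key : ∀ x y : Fin n ⊕ Fin m, x ≠ y →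
        unitVec σ a - unitVec σ b = basisVec x - basisVec y → σ a = x ∧ σ b = y := by
      intro x y hxy h
      have h1 := (unitVec_sub_inj σ hab (σ.symm.injective.ne hxy)).1 (h.trans (by simp [unitVec]))
      exact ⟨by simp [h1.1], by simp [h1.2]⟩
    rintro ⟨i, j, h | h⟩
    · obtain ⟨h1, h2⟩ := key _ _ (by simp) h
      simp [pointParity, h1, h2]
    · rw [neg_sub] at h
      obtain ⟨h1, h2⟩ := key _ _ (by simp) h
      simp [pointParity, h1, h2]
  · intro h
    unfold pointParity at h
    unfold unitVec
    generalize σ a = x at *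
    generalize σ b = y at *
    rcases x with i | i <;> rcases y with j | j
    · simp at h
    · exact ⟨i, j, .inl rfl⟩
    · exact ⟨j, i, .inr (neg_sub _ _).symm⟩
    · have h1 : ¬(1 : ZMod 2) + 1 = 1 := by decide
      exact absurd h h1

lemma mem_evenRoots_iff {a b : Fin (n + m)} (hab : a ≠ b) :
    unitVec σ a - unitVec σ b ∈ evenRoots n m ↔ pointParity σ a + pointParity σ b = 0 := by
  constructor
  · have key : ∀ x y : Fin n ⊕ Fin m, x ≠ y →
        unitVec σ a - unitVec σ b = basisVec x - basisVec y → σ a = x ∧ σ b = y := by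
      intro x y hxy h
      have h1 := (unitVec_sub_inj σ hab (σ.symm.injective.ne hxy)).1 (h.trans (by simp [unitVec]))
      exact ⟨by simp [h1.1], by simp [h1.2]⟩
    rintro (⟨i, j, hij, h⟩ | ⟨i, j, hij, h⟩)
    · obtain ⟨h1, h2⟩ := key _ _ (by simpa using hij) h
      simp [pointParity, h1, h2]
    · obtain ⟨h1, h2⟩ := key _ _ (by simpa using hij) h
      simp only [pointParity, h1, h2, Sum.elim_inr]
      decide
  · intro h
    rcases (mem_roots_iff σ).2 ⟨a, b, hab, rfl⟩ with h' | h'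
    · exact h'
    · rw [mem_oddRoots_iff σ hab, h] at h'
      exact absurd h' zero_ne_one

lemma simpleRoot_eq (i : Fin (n + m - 1)) :
    simpleRoot σ i = unitVec σ (leftPt i) - unitVec σ (rightPt i) := rfl

lemma simpleReflection_unitVec (i : Fin (n + m - 1)) (a : Fin (n + m)) :
    simpleReflection σ i (unitVec σ a) =
      unitVec σ (Equiv.swap (leftPt i) (rightPt i) a) := by
  have hne := (leftPt_lt_rightPt i).ne
  change unitVec σ a - (unitVec σ a ⬝ᵥ simpleRoot σ i) • simpleRoot σ i = _
  rw [simpleRoot_eq, dotProduct_sub, unitVec_dotProduct, unitVec_dotProduct]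
  by_cases h1 : a = leftPt i
  · subst h1
    simp [hne]
  · by_cases h2 : a = rightPt i
    · subst h2
      simp [hne.symm]
    · rw [Equiv.swap_apply_of_ne_of_ne h1 h2]
      simp [h1, h2]

lemma wordProd_unitVec (w : List (Fin (n + m - 1))) (a : Fin (n + m)) :
    wordProd σ w (unitVec σ a) = unitVec σ (wordPerm w a) := by
  induction w with
  | nil => rfl
  | cons i w ih =>
    have : wordProd σ (i :: w) = simpleReflection σ i * wordProd σ w := by simp [wordProd]
    rw [this, Module.End.mul_apply, ih, simpleReflection_unitVec]
    simp

lemma wordProd_eq_iff {w w' : List (Fin (n + m - 1))} :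
    wordProd σ w' = wordProd σ w ↔ wordPerm w' = wordPerm w := by
  constructor
  · intro h
    refine Equiv.ext fun a => unitVec_injective σ ?_
    rw [← wordProd_unitVec, ← wordProd_unitVec, h]
  · intro h
    refine LinearMap.pi_ext' fun x => LinearMap.ext_ring ?_
    have hx : LinearMap.single ℤ (fun _ : Fin n ⊕ Fin m => ℤ) x 1 = unitVec σ (σ.symm x) := by
      simp [unitVec, basisVec]
    rw [LinearMap.comp_apply, LinearMap.comp_apply, hx, wordProd_unitVec, wordProd_unitVec, h]

lemma isReducedWord_iff {w : List (Fin (n + m - 1))} : IsReducedWord σ w ↔ IsShortest w := by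
  simp only [IsReducedWord, IsShortest, wordProd_eq_iff]

lemma gammaRoot_eq (w : List (Fin (n + m - 1))) (j : Fin w.length) : gammaRoot σ w j =
    unitVec σ (wordPerm (w.take j) (leftPt (w.get j))) -
      unitVec σ (wordPerm (w.take j) (rightPt (w.get j))) := by
  rw [gammaRoot, simpleRoot_eq, map_sub, wordProd_unitVec, wordProd_unitVec]

lemma isPositiveRoot_iff {a b : Fin (n + m)} (hab : a ≠ b) :
    IsPositiveRoot σ (unitVec σ a - unitVec σ b) ↔ a < b := by
  constructor
  · rintro ⟨-, c, hc⟩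
    -- The height: it takes the value `1` at every simple root.
    let ht : Lattice n m →ₗ[ℤ] ℤ :=
      { toFun := fun v => ∑ x, (-(x.val : ℤ)) * v (σ x)
        map_add' := fun v w => by simp [mul_add, Finset.sum_add_distrib]
        map_smul' := fun r v => by simp [Finset.mul_sum, mul_left_comm] }
    have h1 : ∀ x, ht (unitVec σ x) = -(x.val : ℤ) := fun x => by
      change ∑ y, (-(y.val : ℤ)) * unitVec σ x (σ y) = _
      simp [unitVec_apply]
    have h2 := congrArg ht hc
    rw [map_sub, h1, h1, map_sum] at h2
    have h3 : 0 ≤ ∑ i, ht (c i • simpleRoot σ i) := Finset.sum_nonneg fun i _ => by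
      rw [map_nsmul, simpleRoot_eq, map_sub, h1, h1]
      simp [leftPt, rightPt]
    rw [← h2] at h3
    exact lt_of_le_of_ne (Fin.le_def.2 (by omega)) hab
  · intro h
    refine ⟨(mem_roots_iff σ).2 ⟨a, b, hab, rfl⟩, ?_⟩
    obtain ⟨k, hk⟩ : ∃ k, b.val = a.val + k + 1 := ⟨b.val - a.val - 1, by
      have := Fin.lt_def.1 h
      omega⟩
    clear h hab
    induction k generalizing b with
    | zero =>
      refine ⟨Pi.single ⟨a, by omega⟩ 1, ?_⟩
      rw [Finset.sum_eq_single ⟨a.val, by omega⟩ (fun j _ hj => by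
        rw [Pi.single_eq_of_ne hj, zero_smul]) (fun h => absurd (Finset.mem_univ _) h),
        Pi.single_eq_same, one_smul, simpleRoot_eq]
      rw [show rightPt ⟨a.val, by omega⟩ = b from Fin.ext hk.symm]
      rfl
    | succ k ih =>
      obtain ⟨c, hc⟩ := ih (b := ⟨a + k + 1, by omega⟩) rfl
      refine ⟨c + Pi.single ⟨a + k + 1, by omega⟩ 1, ?_⟩
      simp only [Pi.add_apply, add_smul, Finset.sum_add_distrib]
      rw [← hc, Finset.sum_eq_single ⟨a.val + k + 1, by omega⟩ (fun j _ hj => by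
        rw [Pi.single_eq_of_ne hj, zero_smul]) (fun h => absurd (Finset.mem_univ _) h),
        Pi.single_eq_same, one_smul, simpleRoot_eq]
      rw [show rightPt ⟨a.val + k + 1, by omega⟩ = b from Fin.ext (by simp [rightPt]; omega)]
      change _ = _ + (unitVec σ ⟨a + k + 1, _⟩ - _)
      abel

lemma dynkinGraph_adj (i j : Fin (n + m - 1)) :
    (dynkinGraph σ).Adj i j ↔ i.val + 1 = j.val ∨ j.val + 1 = i.val := by
  change i ≠ j ∧ simpleRoot σ i ⬝ᵥ simpleRoot σ j ≠ 0 ↔ _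
  rw [simpleRoot_eq, simpleRoot_eq, sub_dotProduct, dotProduct_sub, dotProduct_sub,
    unitVec_dotProduct, unitVec_dotProduct, unitVec_dotProduct, unitVec_dotProduct]
  simp only [leftPt, rightPt, Fin.ext_iff, Ne]
  split_ifs <;> simp <;> omega

/-- In this form the colours telescope over an interval, so that the parity of an interval module
depends on its ends only. -/
lemma dynkinQuiver_colour (Ω : QuiverOrientation (dynkinGraph σ)) (i : Fin (n + m - 1)) :
    (dynkinQuiver σ Ω).colour i = pointParity σ (leftPt i) + pointParity σ (rightPt i) := by
  classical
  have h : (dynkinQuiver σ Ω).colour i = if simpleRoot σ i ∈ oddRoots n m then 1 else 0 := rfl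
  rw [h, simpleRoot_eq, mem_oddRoots_iff σ (leftPt_lt_rightPt i).ne]
  generalize pointParity σ (leftPt i) + pointParity σ (rightPt i) = x
  fin_cases x
  · exact if_neg zero_ne_one
  · exact if_pos rfl

end Roots

variable {K : Type u} [Field K]

lemma SVect.finrank_pi {ι : Type} [Fintype ι] (A : ι → SVect K) :
    Module.finrank K (SVect.pi A) = ∑ i, Module.finrank K (A i) :=
  Module.finrank_pi_fintype K (M := fun i => ↥(A i))

lemma SVect.finrank_coker {A B : SVect K} (f : A →ₗ[K] B) (hf : IsHomogeneous 0 f)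
    (h : Function.Injective f) :
    Module.finrank K (coker f hf) + Module.finrank K A = Module.finrank K B := by
  rw [← LinearMap.finrank_range_of_inj h]
  exact Submodule.finrank_quotient_add_finrank _

lemma SVect.single_apply_self {ι : Type} [Finite ι] (A : ι → SVect K) (i : ι) (x : A i) :
    SVect.single A i x i = x := by
  classical
  change Pi.single (M := fun i => ↥(A i)) i x i = x
  exact Pi.single_eq_same _ _

lemma SVect.single_apply_of_ne {ι : Type} [Finite ι] (A : ι → SVect K) {i j : ι} (h : j ≠ i)
    (x : A i) : SVect.single A i x j = 0 := by
  classical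
  change Pi.single (M := fun i => ↥(A i)) i x j = 0
  exact Pi.single_eq_of_ne h _

/-! ### Reflection functors: gradings, dimensions, injectivity -/

section Reflections

variable {V : Type} {Γ : SimpleGraph V}

/-- The space at a vertex is concentrated in the parity of the vertex. -/
def SRep.IsColoured {D : ColouredQuiver Γ} (X : SRep K D) : Prop :=
  ∀ j q, q ≠ D.colour j → (X.obj j).gr q = ⊥

lemma SRep.IsColoured.isPure {D : ColouredQuiver Γ} {X : SRep K D} (h : X.IsColoured) :
    X.IsPure := by
  intro j
  by_cases h0 : (0 : ZMod 2) = D.colour j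
  · exact .inr (h j 1 (by rw [← h0]; exact one_ne_zero))
  · exact .inl (h j 0 h0)

open Classical in
lemma SRep.IsColoured.parity_obj {D : ColouredQuiver Γ} {X : SRep K D} (h : X.IsColoured) (j : V) :
    (X.obj j).parity = if Module.finrank K (X.obj j) = 0 then 0 else D.colour j := by
  rw [SVect.parity]
  by_cases h1 : (X.obj j).gr 1 = ⊥
  · rw [if_pos h1]
    split_ifs with h2
    · rfl
    · by_contra h0
      have h3 := (X.obj j).isCompl.sup_eq_top
      rw [h j 0 h0, h1, bot_sup_eq] at h3
      exact h2 (by rw [← finrank_top K, ← h3, finrank_bot])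
  · rw [if_neg h1, if_neg, not_not.1 fun h2 => h1 (h j 1 h2)]
    intro h2
    have := Module.finrank_zero_iff.1 h2
    exact h1 (Subsingleton.elim _ _)

lemma SRep.isColoured_simple (D : ColouredQuiver Γ) (i : V) :
    (SRep.simple K D i (D.colour i)).IsColoured := by
  classical
  intro j q hq
  change (if j = i then SVect.line K (D.colour i) else SVect.zero K).gr q = ⊥
  by_cases h : j = i
  · subst h
    rw [if_pos rfl]
    exact if_neg hq
  · rw [if_neg h]
    rfl

lemma SRep.finrank_simple_self (D : ColouredQuiver Γ) (i : V) (p : ZMod 2) :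
    Module.finrank K ((SRep.simple K D i p).obj i) = 1 := by
  classical
  have h : (SRep.simple K D i p).obj i = SVect.line K p := if_pos rfl
  rw [h]
  exact Module.finrank_self K

lemma SRep.finrank_simple_of_ne (D : ColouredQuiver Γ) {i j : V} (hj : j ≠ i) (p : ZMod 2) :
    Module.finrank K ((SRep.simple K D i p).obj j) = 0 := by
  classical
  have h : (SRep.simple K D i p).obj j = SVect.zero K := if_neg hj
  rw [h]
  have : Subsingleton (SVect.zero K) := inferInstanceAs (Subsingleton PUnit)
  exact Module.finrank_zero_of_subsingleton

variable [Finite V]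

/-- At `i`, the shift by `p'(i) + p'(k)` carries the summand `X(k)` from the parity of `k` to that
of `i`. At a neighbour of `i`, the shift by `p(i)` is exactly the change of the colour of this
vertex. -/
lemma SRep.IsColoured.reflection {D : ColouredQuiver Γ} {i : V} {X : SRep K (D.reflect i)}
    (h : X.IsColoured) : (SRep.reflection i X).IsColoured := by
  classical
  intro j q hq
  change (X.reflectObj j).gr q = ⊥
  by_cases hj : j = i
  · subst hj
    rw [X.reflectObj_self]
    have hpi : (SVect.pi X.summand).gr q = ⊥ := by
      rw [eq_bot_iff]
      intro x hx
      refine (Submodule.mem_bot K).2 (funext fun k => ?_)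
      have h1 : x k ∈ (X.obj k).gr
          (q + ((D.reflect j).colour j + (D.reflect j).colour k)) := hx k trivial
      have h2 : (X.obj k).gr (q + ((D.reflect j).colour j + (D.reflect j).colour k)) = ⊥ := by
        refine h k _ fun h3 => hq ?_
        have h4 : (D.reflect j).colour j = D.colour j := if_neg Γ.irrefl
        rw [h4, ← add_assoc, add_eq_right] at h3
        rw [← add_zero q, ← CharTwo.add_self_eq_zero (D.colour j), ← add_assoc, h3, zero_add]
      rw [h2] at h1
      exact (Submodule.mem_bot K).1 h1
    change ((SVect.pi X.summand).gr q).map _ = ⊥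
    rw [hpi, Submodule.map_bot]
  · rw [eq_bot_iff]
    intro x hx
    rw [← X.reflectEquiv_mem hj, h, Submodule.mem_bot] at hx
    · exact (Submodule.mem_bot K).2 ((X.reflectEquiv hj).map_eq_zero_iff.1 hx)
    · intro h1
      apply hq
      have h2 : (D.reflect i).colour j = D.colour j + if Γ.Adj i j then D.colour i else 0 := by
        change (if Γ.Adj i j then _ else _) = _
        split_ifs <;> simp
      exact add_right_cancel (h1.trans h2)

lemma SRep.isColoured_ofWord (w : List V) (D : ColouredQuiver Γ) (i : V) :
    (SRep.ofWord K D w i).IsColoured := by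
  induction w generalizing D with
  | nil => exact SRep.isColoured_simple D i
  | cons k w ih => exact (ih (D.reflect k)).reflection

lemma SRep.finrank_reflection_of_ne {D : ColouredQuiver Γ} {i : V} (X : SRep K (D.reflect i))
    {j : V} (hj : j ≠ i) :
    Module.finrank K ((SRep.reflection i X).obj j) = Module.finrank K (X.obj j) :=
  (X.reflectEquiv hj).finrank_eq

/-- This is the simple reflection of the dimension vector at `i`; injectivity ensures that the
cokernel has the expected dimension. -/
lemma SRep.finrank_reflection_self [Fintype V] {D : ColouredQuiver Γ} {i : V} [DecidableRel Γ.Adj]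
    (X : SRep K (D.reflect i)) (hi : D.IsSink i) (h : Function.Injective X.outMap) :
    Module.finrank K ((SRep.reflection i X).obj i) + Module.finrank K (X.obj i) =
      ∑ k, if Γ.Adj i k then Module.finrank K (X.obj k) else 0 := by
  classical
  have hadj : ∀ k, (D.reflect i).arrow i k ↔ Γ.Adj i k := fun k => by
    rw [D.adj_iff]
    simp [ColouredQuiver.reflect, hi k]
  have e1 : Module.finrank K ((SRep.reflection i X).obj i) =
      Module.finrank K (SVect.coker X.outMap X.outMap_even) := by
    change Module.finrank K (X.reflectObj i) = _
    rw [X.reflectObj_self]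
  rw [e1, SVect.finrank_coker _ _ h, SVect.finrank_pi, ← Finset.sum_filter]
  change ∑ k : {k // (D.reflect i).arrow i k}, Module.finrank K (X.obj k) = _
  exact (Finset.sum_subtype (p := fun k => (D.reflect i).arrow i k) _ (fun k => by simp [hadj])
    fun k => Module.finrank K (X.obj k)).symm

lemma SRep.reflection_map_injective_of_ne {D : ColouredQuiver Γ} {i j k : V}
    (X : SRep K (D.reflect i)) (a : D.arrow j k) (hj : j ≠ i) (hk : k ≠ i)
    (h : Function.Injective (X.map (ColouredQuiver.arrow_reflect_of_ne a hj hk))) :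
    Function.Injective ((SRep.reflection i X).map a) := by
  classical
  have e : (SRep.reflection i X).map a = (X.reflectEquiv hk).symm.toLinearMap ∘ₗ
      X.map (ColouredQuiver.arrow_reflect_of_ne a hj hk) ∘ₗ (X.reflectEquiv hj).toLinearMap :=
    (dif_neg hk).trans (dif_neg hj)
  rw [e]
  exact (X.reflectEquiv hk).symm.injective.comp (h.comp (X.reflectEquiv hj).injective)

/-- A vector of `X(j)` that dies in the cokernel comes from some `y` in `X(i)` whose components at
the other neighbours vanish; the hypothesis then gives `y = 0`. -/
lemma SRep.reflection_map_injective {D : ColouredQuiver Γ} {i j : V}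
    (X : SRep K (D.reflect i)) (a : D.arrow j i)
    (h : ∀ y : X.obj i, (∀ k (c : (D.reflect i).arrow i k), k ≠ j → X.map c y = 0) → y = 0) :
    Function.Injective ((SRep.reflection i X).map a) := by
  classical
  have hj := ColouredQuiver.ne_of_arrow a
  rw [injective_iff_map_eq_zero]
  intro x hx
  have e : (SRep.reflection i X).map a =
      (SVect.castEquiv (X.reflectObj_self :
        X.reflectObj i = SVect.coker X.outMap X.outMap_even)).symm.toLinearMap ∘ₗ
      SVect.quot X.outMap X.outMap_even ∘ₗ
      SVect.single X.summand ⟨j, ColouredQuiver.arrow_reflect_self a rfl⟩ ∘ₗ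
      (SVect.shiftEquiv _ (X.obj j)).symm.toLinearMap ∘ₗ
      (X.reflectEquiv hj).toLinearMap := dif_pos rfl
  rw [e] at hx
  have hx' : SVect.quot X.outMap X.outMap_even
      (SVect.single X.summand ⟨j, ColouredQuiver.arrow_reflect_self a rfl⟩
        ((SVect.shiftEquiv _ (X.obj j)).symm (X.reflectEquiv hj x))) = 0 :=
    (LinearEquiv.map_eq_zero_iff (SVect.castEquiv (X.reflectObj_self :
      X.reflectObj i = SVect.coker X.outMap X.outMap_even)).symm).1 hx
  obtain ⟨y, hy⟩ := (Submodule.Quotient.mk_eq_zero _).1 hx'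
  have hy0 : y = 0 := by
    refine h y fun k c hkj => ?_
    have := congrFun hy ⟨k, c⟩
    exact this.trans (SVect.single_apply_of_ne X.summand
      (fun h => hkj (congrArg Subtype.val h)) _)
  have h1 := congrFun hy ⟨j, ColouredQuiver.arrow_reflect_self a rfl⟩
  rw [hy0, map_zero] at h1
  have h2 := h1.trans (SVect.single_apply_self X.summand _ _)
  exact (X.reflectEquiv hj).map_eq_zero_iff.1 ((LinearEquiv.map_eq_zero_iff _).1 h2.symm)

end Reflections

/-! ### Reflection functors on interval modules -/

section Line

open SRep

variable {N : ℕ} {Γ : SimpleGraph (Fin (N - 1))}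
  (hΓ : ∀ i j : Fin (N - 1), Γ.Adj i j ↔ i.val + 1 = j.val ∨ j.val + 1 = i.val)

lemma sum_fin_ite_eq {ℓ : ℕ} (c : ℕ) (g : ℕ → ℕ) :
    ∑ k : Fin ℓ, (if k.val = c then g k else 0) = if c < ℓ then g c else 0 := by
  by_cases h : c < ℓ
  · rw [if_pos h, Finset.sum_eq_single (⟨c, h⟩ : Fin ℓ) (fun k _ hk =>
      if_neg fun h' => hk (Fin.ext h')) (fun h' => absurd (Finset.mem_univ _) h'), if_pos rfl]
  · rw [if_neg h]
    exact Finset.sum_eq_zero fun k _ => if_neg (by omega)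

lemma val_swap (i : Fin (N - 1)) (x : Fin N) :
    (Equiv.swap (leftPt i) (rightPt i) x).val =
      if x.val = i.val then i.val + 1 else if x.val = i.val + 1 then i.val else x.val := by
  simp only [Equiv.swap_apply_def, Fin.ext_iff, leftPt, rightPt]
  split_ifs <;> rfl

include hΓ in
open Classical in
-- The two terms belong to the neighbours `i + 1` and `i - 1`; the second one is written without
-- subtraction, which makes it vanish for `i = 0`.
lemma sum_adj {a b : ℕ} (hb : b ≤ N - 1) (i : Fin (N - 1)) :
    (∑ k : Fin (N - 1), if Γ.Adj i k then (if a ≤ k.val ∧ k.val < b then 1 else 0) else 0) =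
      (if a ≤ i.val + 1 ∧ i.val + 1 < b then 1 else 0) +
        if a + 1 ≤ i.val ∧ i.val < b + 1 then 1 else 0 := by
  have h1 : ∀ k : Fin (N - 1), (if Γ.Adj i k then (if a ≤ k.val ∧ k.val < b then 1 else 0) else 0) =
      (if k.val = i.val + 1 then (fun x => if a ≤ x ∧ x < b then 1 else 0) k.val else 0) +
      (if k.val = i.val - 1 then (fun x => if a ≤ x ∧ x < b ∧ 0 < i.val then 1 else 0) k.val
        else 0) := by
    intro k
    simp only [hΓ]
    split_ifs <;> omega
  rw [Finset.sum_congr rfl fun k _ => h1 k, Finset.sum_add_distrib]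
  refine (congrArg₂ (· + ·) (sum_fin_ite_eq _ fun x => if a ≤ x ∧ x < b then 1 else 0)
    (sum_fin_ite_eq _ fun x => if a ≤ x ∧ x < b ∧ 0 < i.val then 1 else 0)).trans ?_
  have := i.isLt
  split_ifs <;> omega

include hΓ in
-- Reflecting the dimension vector of an interval exchanges the points `i` and `i + 1` among its
-- ends. The hypothesis `hxy` excludes only the simple module at `i`, so if `i` is in the support,
-- then so is one of its neighbours, and the map out of `i` is injective.
lemma isIntervalLike_reflection {D : ColouredQuiver Γ} {i : Fin (N - 1)} (hi : D.IsSink i)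
    {X : SRep K (D.reflect i)} {x y : Fin N} (hX : IsIntervalLike X x y)
    (hxy : Equiv.swap (leftPt i) (rightPt i) x < Equiv.swap (leftPt i) (rightPt i) y) :
    IsIntervalLike (SRep.reflection i X) (Equiv.swap (leftPt i) (rightPt i) x)
      (Equiv.swap (leftPt i) (rightPt i) y) := by
  classical
  rw [Fin.lt_def] at hxy
  have hlt := hX.lt
  have hle := hX.le
  rw [val_swap, val_swap] at hxy ⊢
  have hxN := x.isLt
  have hyN := y.isLt
  have hiN := i.isLt
  generalize x.val = a at *
  generalize y.val = b at *
  have harr : ∀ k, Γ.Adj i k → (D.reflect i).arrow i k := fun k hk => by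
    have := (D.adj_iff i k).1 hk
    simpa [ColouredQuiver.reflect, hi k] using this
  have hzero : ∀ j : Fin (N - 1), ¬(a ≤ j.val ∧ j.val < b) → ∀ v : X.obj j, v = 0 := by
    intro j hj v
    have h1 := hX.finrank_eq j
    rw [if_neg hj, Module.finrank_zero_iff] at h1
    exact Subsingleton.elim _ _
  -- A vector at `i` can be tested along one arrow; the neighbour `k` has to be in the support only
  -- if `i` is.
  have hdet : ∀ k : Fin (N - 1), Γ.Adj i k → ((a ≤ i.val ∧ i.val < b) → (a ≤ k.val ∧ k.val < b)) →
      ∀ v : X.obj i, (∀ c : (D.reflect i).arrow i k, X.map c v = 0) → v = 0 := by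
    intro k hk hik v hv
    by_cases h1 : a ≤ i.val ∧ i.val < b
    · exact (injective_iff_map_eq_zero _).1 (hX.injective i k (harr k hk) h1 (hik h1)) v (hv _)
    · exact hzero i h1 v
  have hinj : Function.Injective X.outMap := by
    rw [injective_iff_map_eq_zero]
    intro v hv
    have hv' : ∀ k (c : (D.reflect i).arrow i k), X.map c v = 0 := fun k c => congrFun hv ⟨k, c⟩
    by_cases h1 : a ≤ i.val ∧ i.val < b
    · by_cases h2 : i.val + 1 < b
      · exact hdet ⟨i + 1, by omega⟩ ((hΓ _ _).2 (.inl rfl)) (fun _ => ⟨by simp; omega, h2⟩) v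
          (hv' _)
      · have h3 : a < i.val := by
          split_ifs at hxy <;> omega
        exact hdet ⟨i - 1, by omega⟩ ((hΓ _ _).2 (.inr (by simp; omega)))
          (fun _ => ⟨by simp; omega, by simp; omega⟩) v (hv' _)
    · exact hzero i h1 v
  refine ⟨hxy, ?_, ?_, ?_⟩
  · split_ifs <;> omega
  · intro j
    by_cases hj : j = i
    · subst hj
      have h1 := X.finrank_reflection_self hi hinj
      rw [Finset.sum_congr rfl fun k _ => by rw [hX.finrank_eq k], sum_adj hΓ hle,
        hX.finrank_eq] at h1
      split_ifs at hxy h1 ⊢ <;> omega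
    · rw [X.finrank_reflection_of_ne hj, hX.finrank_eq]
      have hj' : j.val ≠ i.val := fun h => hj (Fin.ext h)
      congr 1
      split_ifs at hxy ⊢ <;> simp only [eq_iff_iff] <;> omega
  · intro j k c hj hk
    have hji : j ≠ i := by
      rintro rfl
      exact hi k c
    have hj' : j.val ≠ i.val := fun h => hji (Fin.ext h)
    by_cases hki : k = i
    · subst hki
      -- The sink is called `k` here. The new support contains both `k` and `j`; therefore, if the
      -- old support contains `k`, it also contains the neighbour of `k` other than `j`.
      refine X.reflection_map_injective c fun v hv => ?_
      rcases (hΓ _ _).1 ((D.adj_iff j k).2 (.inl c)) with h1 | h1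
      · by_cases h2 : k.val + 1 < N - 1
        · refine hdet ⟨k + 1, h2⟩ ((hΓ _ _).2 (.inl rfl)) ?_ v
            (fun c => hv _ c (by simp [Fin.ext_iff]; omega))
          simp only
          split_ifs at hxy hj hk <;> omega
        · refine hzero k ?_ v
          split_ifs at hxy hj hk <;> omega
      · by_cases h2 : 0 < k.val
        · refine hdet ⟨k - 1, by omega⟩ ((hΓ _ _).2 (.inr (by simp; omega))) ?_ v
            (fun c => hv _ c (by simp [Fin.ext_iff]; omega))
          simp only
          split_ifs at hxy hj hk <;> omega
        · refine hzero k ?_ v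
          split_ifs at hxy hj hk <;> omega
    · have hk' : k.val ≠ i.val := fun h => hki (Fin.ext h)
      refine X.reflection_map_injective_of_ne c hji hki (hX.injective _ _ _ ?_ ?_) <;>
      split_ifs at hxy hj hk <;> omega

include hΓ in
-- Every suffix of a reduced word is reduced, so the two ends never change their order on the way;
-- this is the condition for each single reflection.
lemma isIntervalLike_ofWord {w : List (Fin (N - 1))} {i : Fin (N - 1)} {D : ColouredQuiver Γ}
    (h : IsShortest (w ++ [i])) (hD : IsAdapted D w) :
    IsIntervalLike (SRep.ofWord K D w i) (wordPerm w (leftPt i)) (wordPerm w (rightPt i)) := by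
  classical
  induction w generalizing D with
  | nil =>
    change IsIntervalLike (SRep.simple K D i (D.colour i)) i.val (i.val + 1)
    refine ⟨i.val.lt_succ_self, i.isLt, fun j => ?_, fun j k c hj hk => ?_⟩
    · by_cases hj : j = i
      · subst hj
        rw [SRep.finrank_simple_self, if_pos (by omega)]
      · have hj' : j.val ≠ i.val := fun h => hj (Fin.ext h)
        rw [SRep.finrank_simple_of_ne D hj, if_neg (by omega)]
    · exact absurd (Fin.ext (by omega)) (ColouredQuiver.ne_of_arrow c)
  | cons k w ih =>
    have hlt := h.lt
    rw [wordPerm_cons, Equiv.Perm.mul_apply, Equiv.Perm.mul_apply] at hlt ⊢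
    exact isIntervalLike_reflection hΓ hD.1 (ih (h.of_append_right (v := [k])) hD.2) hlt

/-- The sum of the colours over the support telescopes, since the inner points occur twice. -/
lemma SRep.IsIntervalLike.parity_eq {D : ColouredQuiver Γ} {X : SRep K D} {x y : Fin N}
    (h : IsIntervalLike X x y) (hX : X.IsColoured) (P : Fin N → ZMod 2)
    (hP : ∀ i, D.colour i = P (leftPt i) + P (rightPt i)) :
    X.parity = P x + P y := by
  classical
  have h1 : X.parity = ∑ j : Fin (N - 1),
      if x.val ≤ j.val ∧ j.val < y.val then P (leftPt j) + P (rightPt j) else 0 := by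
    refine Finset.sum_congr rfl fun j _ => ?_
    rw [hX.parity_obj, h.finrank_eq, ← hP]
    split_ifs <;> simp_all
  rw [h1]
  have hlt := h.lt
  clear h h1 hX hP
  obtain ⟨k, hk⟩ : ∃ k, y.val = x.val + k + 1 := ⟨y.val - x.val - 1, by omega⟩
  clear hlt
  induction k generalizing y with
  | zero =>
    have hy := y.isLt
    rw [Finset.sum_eq_single (⟨x, by omega⟩ : Fin (N - 1))
      (fun j _ hj => if_neg fun h' => hj (Fin.ext (by simp; omega)))
      (fun h' => absurd (Finset.mem_univ _) h'), if_pos (by simp; omega)]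
    rw [show rightPt ⟨x.val, by omega⟩ = y from Fin.ext hk.symm]
    rfl
  | succ k ih =>
    have hy := y.isLt
    have h2 := ih (y := ⟨x + k + 1, by omega⟩) rfl
    have h3 : ∀ j : Fin (N - 1),
        (if x.val ≤ j.val ∧ j.val < y.val then P (leftPt j) + P (rightPt j) else 0) =
        (if x.val ≤ j.val ∧ j.val < x + k + 1 then P (leftPt j) + P (rightPt j) else 0) +
        if j = ⟨x + k + 1, by omega⟩ then P (leftPt j) + P (rightPt j) else 0 := by
      intro j
      simp only [Fin.ext_iff]
      split_ifs <;> first | omega | simp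
    rw [Finset.sum_congr rfl fun j _ => h3 j, Finset.sum_add_distrib, h2,
      Finset.sum_ite_eq' Finset.univ, if_pos (Finset.mem_univ _)]
    rw [show rightPt ⟨x.val + k + 1, by omega⟩ = y from Fin.ext (by simp [rightPt]; omega)]
    change _ + _ + (P ⟨x + k + 1, _⟩ + _) = _
    rw [add_add_add_comm, ← add_assoc, add_right_comm, add_assoc (P x)]
    generalize P x = p, P y = q, P ⟨x.val + k + 1, _⟩ = r
    revert p q r
    decide

end Line

/-! ### Arcs of a circle -/

section Arcs

variable {N : ℕ}

/-- The end point of the arc of length `i + 1` that starts at the point `p` of the circle. -/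
def arcEnd (x : Fin N × Fin (N - 1)) : Fin N :=
  ⟨if x.1.val + x.2.val + 1 < N then x.1 + x.2 + 1 else x.1 + x.2 + 1 - N, by
    have := x.1.isLt
    have := x.2.isLt
    split_ifs <;> omega⟩

lemma arcEnd_cases (x : Fin N × Fin (N - 1)) :
    ((arcEnd x).val = x.1 + x.2 + 1 ∨ (arcEnd x).val + N = x.1 + x.2 + 1) ∧
      (arcEnd x).val < N ∧ x.1.val < N ∧ x.2.val < N - 1 := by
  refine ⟨?_, (arcEnd x).isLt, x.1.isLt, x.2.isLt⟩
  simp only [arcEnd]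
  split_ifs <;> omega

lemma arcEnd_ne (x : Fin N × Fin (N - 1)) : x.1 ≠ arcEnd x := fun h => by
  have := arcEnd_cases x
  have := Fin.ext_iff.1 h
  omega

lemma exists_arc {a b : Fin N} (h : a ≠ b) : ∃ i, arcEnd (a, i) = b := by
  have h' : a.val ≠ b.val := fun h' => h (Fin.ext h')
  have ha := a.isLt
  have hb := b.isLt
  by_cases hlt : a.val < b.val
  · refine ⟨⟨b - a - 1, by omega⟩, Fin.ext ?_⟩
    have := arcEnd_cases (a, (⟨b - a - 1, by omega⟩ : Fin (N - 1)))
    simp only at this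
    omega
  · refine ⟨⟨b + N - a - 1, by omega⟩, Fin.ext ?_⟩
    have := arcEnd_cases (a, (⟨b + N - a - 1, by omega⟩ : Fin (N - 1)))
    simp only at this
    omega

lemma arc_ext {x y : Fin N × Fin (N - 1)} (h : x.1 = y.1) (h' : arcEnd x = arcEnd y) : x = y := by
  refine Prod.ext h (Fin.ext ?_)
  have := arcEnd_cases x
  have := arcEnd_cases y
  have := Fin.ext_iff.1 h
  have := Fin.ext_iff.1 h'
  omega

/-- The first arc contains the starting point of the second one, whose end point is not before the
end point of the first one. -/
def ArcHom (x y : Fin N × Fin (N - 1)) : Prop := Cyc x.1 y.1 (arcEnd x) (arcEnd y)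

/-- One of the two ends of the arc moves by one step. -/
def ArcCov (x y : Fin N × Fin (N - 1)) : Prop :=
  (y.1 = x.1 ∧ y.2.val = x.2 + 1) ∨
    ((y.1.val = x.1 + 1 ∨ (x.1.val + 1 = N ∧ y.1.val = 0)) ∧ y.2.val + 1 = x.2)

lemma arcHom_refl (x : Fin N × Fin (N - 1)) : ArcHom x x := by
  have := arcEnd_cases x
  unfold ArcHom Cyc
  omega

lemma arcHom_antisymm (x y : Fin N × Fin (N - 1)) (h : ArcHom x y) (h' : ArcHom y x) : x = y := by
  have := arcEnd_cases x
  have := arcEnd_cases y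
  unfold ArcHom Cyc at h h'
  exact Prod.ext (Fin.ext (by omega)) (Fin.ext (by omega))

lemma arcHom_of_arcCov (x y : Fin N × Fin (N - 1)) (h : ArcCov x y) : ArcHom x y := by
  have := arcEnd_cases x
  have := arcEnd_cases y
  unfold ArcCov at h
  rw [Fin.ext_iff] at h
  unfold ArcHom Cyc
  omega

lemma ne_of_arcCov (x y : Fin N × Fin (N - 1)) (h : ArcCov x y) : x ≠ y := by
  rintro rfl
  unfold ArcCov at h
  omega

lemma eq_or_eq_of_arcCov (x y z : Fin N × Fin (N - 1)) (h : ArcCov x z) (h1 : ArcHom x y)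
    (h2 : ArcHom y z) : y = x ∨ y = z := by
  have := arcEnd_cases x
  have := arcEnd_cases y
  have := arcEnd_cases z
  unfold ArcCov at h
  rw [Fin.ext_iff] at h
  unfold ArcHom Cyc at h1 h2
  simp only [Prod.ext_iff, Fin.ext_iff]
  omega

/-- If the two arcs start at the same point, then the end of `x` can advance by one step without
passing the end of `z`. Otherwise the start of `x` can advance, as the arc then has length at least
two. -/
lemma exists_between (x z : Fin N × Fin (N - 1)) (h : ArcHom x z) (hne : x ≠ z)
    (hc : ¬ArcCov x z) : ∃ y, y ≠ x ∧ y ≠ z ∧ ArcHom x y ∧ ArcHom y z := by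
  have hx := arcEnd_cases x
  have hz := arcEnd_cases z
  by_cases h1 : x.1 = z.1
  · have h2 : x.2.val ≠ z.2.val := fun h2 => hne (Prod.ext h1 (Fin.ext h2))
    have h1' := Fin.ext_iff.1 h1
    have hlt : x.2.val < z.2.val := by
      unfold ArcHom Cyc at h
      omega
    let y : Fin N × Fin (N - 1) := (x.1, ⟨x.2 + 1, by omega⟩)
    have e1 : y.1.val = x.1 := rfl
    have e2 : y.2.val = x.2 + 1 := rfl
    have hcy : ArcCov x y := .inl ⟨rfl, rfl⟩
    refine ⟨y, (ne_of_arcCov x y hcy).symm, fun h => hc (h ▸ hcy), arcHom_of_arcCov x y hcy, ?_⟩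
    have hy := arcEnd_cases y
    unfold ArcHom Cyc at h ⊢
    omega
  · have h1' : x.1.val ≠ z.1.val := fun h => h1 (Fin.ext h)
    have hlt : 0 < x.2.val := by
      unfold ArcHom Cyc at h
      omega
    let y : Fin N × Fin (N - 1) :=
      (⟨if x.1.val + 1 = N then 0 else x.1 + 1, by split_ifs <;> omega⟩, ⟨x.2 - 1, by omega⟩)
    have e1 : y.1.val = x.1 + 1 ∨ (x.1.val + 1 = N ∧ y.1.val = 0) := by
      simp only [y]
      split_ifs <;> omega
    have e2 : y.2.val + 1 = x.2 := Nat.sub_add_cancel hlt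
    have hcy : ArcCov x y := .inr ⟨e1, e2⟩
    refine ⟨y, (ne_of_arcCov x y hcy).symm, fun h => hc (h ▸ hcy), arcHom_of_arcCov x y hcy, ?_⟩
    have hy := arcEnd_cases y
    unfold ArcHom Cyc at h ⊢
    omega

end Arcs

/-! ### The points in cyclic order and the objects attached to arcs -/

section Rank

variable {N : ℕ} {Γ : SimpleGraph (Fin (N - 1))}

lemma angle_injective (D : ColouredQuiver Γ) :
    Function.Injective (fun p : Fin N => angle D p) := by
  intro p q h
  have := angle_cases D p
  have := angle_cases D q
  simp only at h
  exact Fin.ext (by omega)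

/-- The points in the order of their positions on the circle. -/
def circlePoint (D : ColouredQuiver Γ) : Equiv.Perm (Fin N) :=
  Tuple.sort (fun p : Fin N => angle D p)

lemma angle_circlePoint_strictMono (D : ColouredQuiver Γ) :
    StrictMono (fun p : Fin N => angle D (circlePoint D p)) :=
  (Tuple.monotone_sort (fun p : Fin N => angle D p)).strictMono_of_injective
    ((angle_injective D).comp (circlePoint D).injective)

lemma cyc_angle_iff (D : ColouredQuiver Γ) (x y z w : Fin N) :
    Cyc (angle D (circlePoint D x)) (angle D (circlePoint D y)) (angle D (circlePoint D z))
      (angle D (circlePoint D w)) ↔ Cyc x y z w := by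
  have h1 : ∀ p q : Fin N, angle D (circlePoint D p) < angle D (circlePoint D q) ↔ p.val < q.val :=
    fun p q => (angle_circlePoint_strictMono D).lt_iff_lt
  have h2 : ∀ p q : Fin N, angle D (circlePoint D p) ≤ angle D (circlePoint D q) ↔ p.val ≤ q.val :=
    fun p q => (angle_circlePoint_strictMono D).le_iff_le
  simp only [Cyc, h1, h2]

variable (K : Type u) [Field K]

/-- The object of the root category attached to an arc. -/
def arcObject (D : ColouredQuiver Γ) (x : Fin N × Fin (N - 1)) : RootCategory K D :=
  SRep.rootPair K D (circlePoint D x.1) (circlePoint D (arcEnd x))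

/-- Once the points are numbered by their positions on the circle, the orientation no longer occurs
in the description of `Hom`, and everything is a statement on arcs. -/
lemma isHomPoset_arcObject
    (hΓ : ∀ i j : Fin (N - 1), Γ.Adj i j ↔ i.val + 1 = j.val ∨ j.val + 1 = i.val)
    (D : ColouredQuiver Γ) : IsHomPoset (arcObject K D) ArcHom ArcCov := by
  have hle : ∀ p : Fin N, p.val ≤ N - 1 := fun p => by omega
  have hne : ∀ x : Fin N × Fin (N - 1),
      (circlePoint D x.1).val ≠ (circlePoint D (arcEnd x)).val := fun x h =>
    arcEnd_ne x ((circlePoint D).injective (Fin.ext h))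
  refine ⟨fun x y h => ?_, fun x y h => ?_, arcHom_refl, arcHom_antisymm, fun x z h h' h'' => ?_,
    arcHom_of_arcCov, ne_of_arcCov, eq_or_eq_of_arcCov, fun Z => ?_⟩
  · exact SRep.homZero_rootPair hΓ (hne x) (hne y) (hle _) (hle _) (hle _) (hle _)
      ((cyc_angle_iff D _ _ _ _).not.2 h)
  · exact SRep.homLine_rootPair hΓ (hne x) (hne y) (hle _) (hle _) (hle _) (hle _)
      ((cyc_angle_iff D _ _ _ _).2 h)
  · obtain ⟨y, h1, h2, h3, h4⟩ := exists_between x z h h' h''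
    exact ⟨y, h1, h2, SRep.compNonzero_rootPair hΓ (hne x) (hne y) (hne z) (hle _) (hle _) (hle _)
      (hle _) (hle _) (hle _) ((cyc_angle_iff D _ _ _ _).2 h3) ((cyc_angle_iff D _ _ _ _).2 h4)
      ((cyc_angle_iff D _ _ _ _).2 h)⟩
  · refine FinSum.map (𝟭 _) ?_ (SRep.finSum_rootPair hΓ Z)
    rintro X ⟨a, b, hab, ha, hb, rfl⟩
    obtain ⟨i, hi⟩ := exists_arc (a := (circlePoint D).symm ⟨a, by omega⟩)
      (b := (circlePoint D).symm ⟨b, by omega⟩) (by simpa using hab)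
    exact FinSum.of ⟨((circlePoint D).symm ⟨a, by omega⟩, i), rfl⟩
      (eqToIso (by simp [arcObject, hi]))

end Rank

/-! ### The periodic quiver and the mesh relations -/

section GammaHat

variable {N : ℕ} {Γ : SimpleGraph (Fin (N - 1))}
  (hΓ : ∀ i j : Fin (N - 1), Γ.Adj i j ↔ i.val + 1 = j.val ∨ j.val + 1 = i.val)
  (ϖ : Γ.Coloring (ZMod 2))

include hΓ in
-- A colouring of a line by two colours alternates, so it is determined by its value at the first
-- vertex, which the constant absorbs.
lemma exists_coloring_eq : ∃ c : ℕ, ∀ i, ((c + i.val + 1 : ℕ) : ZMod 2) + ϖ i = 0 := by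
  by_cases hN : 0 < N - 1
  · refine ⟨(ϖ ⟨0, hN⟩ + 1).val, ?_⟩
    have key : ∀ (k : ℕ) (hk : k < N - 1),
        (((ϖ ⟨0, hN⟩ + 1).val + k + 1 : ℕ) : ZMod 2) + ϖ ⟨k, hk⟩ = 0 := by
      intro k
      induction k with
      | zero =>
        intro hk
        push_cast
        rw [ZMod.natCast_zmod_val]
        generalize ϖ ⟨0, hN⟩ = x
        revert x
        decide
      | succ k ih =>
        intro hk
        have h1 := ih (by omega)
        have h2 : ϖ ⟨k, by omega⟩ ≠ ϖ ⟨k + 1, hk⟩ :=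
          ϖ.valid ((hΓ _ _).2 (.inl rfl))
        push_cast at h1 ⊢
        generalize ϖ ⟨k, _⟩ = x at *
        generalize ϖ ⟨k + 1, _⟩ = y at *
        generalize (((ϖ ⟨0, hN⟩ + 1).val : ℕ) : ZMod 2) = z at *
        generalize (k : ZMod 2) = t at *
        revert x y z t
        decide
    exact fun i => key i i.isLt
  · exact ⟨0, fun i => absurd i.isLt (by omega)⟩

/-- The vertex of the periodic quiver attached to an arc. -/
def arcVertex {c : ℕ} (hc : ∀ i, ((c + i.val + 1 : ℕ) : ZMod 2) + ϖ i = 0)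
    (x : Fin N × Fin (N - 1)) : GammaHat ϖ N :=
  ⟨(x.2, ((2 * x.1.val + (c + x.2.val + 1) : ℕ) : ZMod (2 * N))), by
    rw [map_natCast, Nat.cast_add, (ZMod.natCast_eq_zero_iff _ _).2 (dvd_mul_right 2 _), zero_add]
    exact hc x.2⟩

variable {ϖ} {c : ℕ} (hc : ∀ i, ((c + i.val + 1 : ℕ) : ZMod 2) + ϖ i = 0)

lemma cast_two_mul_inj {a b : ℕ} (ha : a < N) (hb : b < N) {d : ℕ} :
    ((2 * a + d : ℕ) : ZMod (2 * N)) = ((2 * b + d : ℕ) : ZMod (2 * N)) ↔ a = b := by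
  refine ⟨fun h => ?_, fun h => h ▸ rfl⟩
  rw [Nat.cast_add, Nat.cast_add, add_left_inj, ZMod.natCast_eq_natCast_iff', Nat.mod_eq_of_lt,
    Nat.mod_eq_of_lt] at h <;> omega

/-- For fixed `i` the parity condition leaves `N` residues modulo `2 * N`, namely `2p + (c + i +
1)`, one for each starting point `p`. -/
lemma arcVertex_bijective : Function.Bijective (arcVertex ϖ hc) := by
  constructor
  · intro x y h
    have h1 := congrArg (fun z => z.1.1) h
    have h2 := congrArg (fun z => z.1.2) h
    simp only [arcVertex] at h1 h2
    rw [h1, cast_two_mul_inj x.1.isLt y.1.isLt] at h2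
    exact Prod.ext (Fin.ext h2) h1
  · rintro ⟨⟨i, k⟩, hk⟩
    have hN : 0 < N := by
      have := i.isLt
      omega
    have : NeZero (2 * N) := ⟨by omega⟩
    obtain ⟨t, ht, rfl⟩ : ∃ t < 2 * N, k = ((t + (c + i.val + 1) : ℕ) : ZMod (2 * N)) := by
      refine ⟨(k - ((c + i.val + 1 : ℕ) : ZMod (2 * N))).val, ZMod.val_lt _, ?_⟩
      rw [Nat.cast_add, ZMod.natCast_zmod_val, sub_add_cancel]
    have h2 : (t : ZMod 2) = 0 := by
      simp only [map_natCast] at hk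
      rw [Nat.cast_add, add_assoc, hc i, add_zero] at hk
      exact hk
    rw [ZMod.natCast_eq_zero_iff] at h2
    obtain ⟨a, rfl⟩ := h2
    exact ⟨(⟨a, by omega⟩, i), rfl⟩

/-- The arcs are the vertices of the periodic quiver. -/
def arcEquiv : Fin N × Fin (N - 1) ≃ GammaHat ϖ N := Equiv.ofBijective _ (arcVertex_bijective hc)

lemma cast_step {a b d : ℕ} (ha : a < N) (hb : b < N) :
    ((2 * b + d : ℕ) : ZMod (2 * N)) = ((2 * a + 2 + d : ℕ) : ZMod (2 * N)) ↔
      b = a + 1 ∨ (a + 1 = N ∧ b = 0) := by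
  rw [Nat.cast_add, Nat.cast_add (2 * a + 2), add_left_inj, ZMod.natCast_eq_natCast_iff',
    Nat.mod_eq_of_lt (by omega : 2 * b < 2 * N)]
  by_cases h : a + 1 = N
  · rw [show 2 * a + 2 = 2 * N by omega, Nat.mod_self]
    omega
  · rw [Nat.mod_eq_of_lt (by omega : 2 * a + 2 < 2 * N)]
    omega

include hΓ in
-- Up to `c`, the second coordinate is the sum of the start `p` and the unreduced end `p + i + 1`,
-- so it grows by one when either end moves by one step. When the start passes from `N - 1` to `0`,
-- the difference `2 * N` vanishes.
lemma arrow_arcEquiv_iff (x y : Fin N × Fin (N - 1)) :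
    GammaHat.Arrow (arcEquiv hc x) (arcEquiv hc y) ↔ ArcCov x y := by
  change Γ.Adj x.2 y.2 ∧ ((2 * y.1.val + (c + y.2.val + 1) : ℕ) : ZMod (2 * N)) =
    ((2 * x.1.val + (c + x.2.val + 1) : ℕ) : ZMod (2 * N)) + 1 ↔ _
  rw [hΓ, or_and_right, ArcCov]
  refine or_congr ?_ ?_
  · rw [and_comm, eq_comm (a := y.2.val)]
    refine and_congr_left fun h => ?_
    rw [← h, ← Nat.cast_succ, show (2 * x.1.val + (c + x.2.val + 1)).succ =
      2 * x.1.val + (c + (x.2.val + 1) + 1) by omega, cast_two_mul_inj y.1.isLt x.1.isLt,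
      Fin.ext_iff]
  · rw [and_comm]
    refine and_congr_left fun h => ?_
    rw [← h, ← Nat.cast_succ, show (2 * x.1.val + (c + (y.2.val + 1) + 1)).succ =
      2 * x.1.val + 2 + (c + y.2.val + 1) by omega, cast_step x.1.isLt y.1.isLt]

include hΓ in
/-- Every function on the points of the circle gives a function on the arcs that satisfies the
mesh relations. -/
lemma mesh_relation {A : Type*} [AddCommGroup A] (f : Fin N → A) {x y : GammaHat ϖ N}
    (hxy : y.1 = (x.1.1, x.1.2 + 2)) (ρ : GammaHat ϖ N → A)
    (hρ : ∀ z, ρ (arcEquiv hc z) = f z.1 - f (arcEnd z)) :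
    ρ x + ρ y = ∑ᶠ (z : GammaHat ϖ N) (_ : GammaHat.Arrow x z), ρ z := by
  classical
  obtain ⟨x, rfl⟩ := (arcEquiv hc).surjective x
  obtain ⟨y, rfl⟩ := (arcEquiv hc).surjective y
  have h1 : y.2 = x.2 := congrArg Prod.fst hxy
  have h2 := congrArg Prod.snd hxy
  change ((2 * y.1.val + (c + y.2.val + 1) : ℕ) : ZMod (2 * N)) =
    ((2 * x.1.val + (c + x.2.val + 1) : ℕ) : ZMod (2 * N)) + 2 at h2
  rw [h1, show (2 : ZMod (2 * N)) = ((2 : ℕ) : ZMod (2 * N)) from Nat.cast_two.symm,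
    ← Nat.cast_add, show 2 * x.1.val + (c + x.2.val + 1) + 2 =
    2 * x.1.val + 2 + (c + x.2.val + 1) by omega, cast_step x.1.isLt y.1.isLt] at h2
  have hx := arcEnd_cases x
  have hy := arcEnd_cases y
  have h1' := Fin.ext_iff.1 h1
  -- The arrows out of `x`: in `S` the end advances, in `T` the start. At the extreme vertices of
  -- the line one of these sets is empty.
  let S : Finset (Fin N × Fin (N - 1)) := Finset.univ.filter fun z => z.1 = x.1 ∧ z.2.val = x.2 + 1
  let T : Finset (Fin N × Fin (N - 1)) := Finset.univ.filter fun z => z.1 = y.1 ∧ z.2.val + 1 = x.2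
  have hcov : ∀ z, ArcCov x z ↔ z ∈ S ∪ T := by
    intro z
    simp only [S, T, Finset.mem_union, Finset.mem_filter, Finset.mem_univ, true_and, ArcCov,
      Fin.ext_iff]
    have := z.1.isLt
    omega
  have hdisj : Disjoint S T := by
    rw [Finset.disjoint_left]
    intro z hS hT
    simp only [S, T, Finset.mem_filter] at hS hT
    omega
  have hsum : ∑ᶠ (z : GammaHat ϖ N) (_ : GammaHat.Arrow (arcEquiv hc x) z), ρ z =
      ∑ z ∈ S ∪ T, (f z.1 - f (arcEnd z)) := by
    rw [← finsum_comp_equiv (arcEquiv hc)]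
    simp only [arrow_arcEquiv_iff hΓ, hcov, hρ]
    exact finsum_mem_coe_finset _ _
  -- The arc in `S` starts like `x` and ends like `y`. If there is none, then `y` ends at the start
  -- of `x`, and the right-hand side is zero as well.
  have hS : ∑ z ∈ S, (f z.1 - f (arcEnd z)) = f x.1 - f (arcEnd y) := by
    by_cases h : x.2.val + 1 < N - 1
    · rw [Finset.sum_eq_single (x.1, (⟨x.2 + 1, h⟩ : Fin (N - 1)))]
      · have hz := arcEnd_cases (x.1, (⟨x.2 + 1, h⟩ : Fin (N - 1)))
        simp only at hz
        congr 2
        exact Fin.ext (by omega)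
      · intro z hz hne
        simp only [S, Finset.mem_filter] at hz
        have hz2 : z.2 = ⟨x.2 + 1, h⟩ := Fin.ext hz.2.2
        exact (hne (Prod.ext hz.2.1 hz2)).elim
      · intro hz
        simp [S] at hz
    · have hS0 : S = ∅ := Finset.filter_eq_empty_iff.2 fun z _ hz => by
        have := z.2.isLt
        omega
      have : arcEnd y = x.1 := Fin.ext (by omega)
      rw [hS0, this, Finset.sum_empty, sub_self]
  -- The arc in `T` starts like `y` and ends like `x`. If there is none, then `x` has length one and
  -- ends at the start of `y`.
  have hT : ∑ z ∈ T, (f z.1 - f (arcEnd z)) = f y.1 - f (arcEnd x) := by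
    by_cases h : 0 < x.2.val
    · rw [Finset.sum_eq_single (y.1, (⟨x.2 - 1, by omega⟩ : Fin (N - 1)))]
      · have hz := arcEnd_cases (y.1, (⟨x.2 - 1, by omega⟩ : Fin (N - 1)))
        simp only at hz
        congr 2
        exact Fin.ext (by omega)
      · intro z hz hne
        simp only [T, Finset.mem_filter] at hz
        have hz2 : z.2 = ⟨x.2 - 1, by omega⟩ := Fin.ext (Nat.eq_sub_of_add_eq hz.2.2)
        exact (hne (Prod.ext hz.2.1 hz2)).elim
      · intro hz
        simp [T] at hz
        omega
    · have hT0 : T = ∅ := Finset.filter_eq_empty_iff.2 fun z _ hz => by omega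
      have : arcEnd x = y.1 := Fin.ext (by omega)
      rw [hT0, this, Finset.sum_empty, sub_self]
  rw [hsum, Finset.sum_union hdisj, hS, hT, hρ, hρ]
  abel

end GammaHat

lemma IsAdapted.of_append {V : Type} {Γ : SimpleGraph V} {D : ColouredQuiver Γ} {v w : List V}
    (h : IsAdapted D (v ++ w)) : IsAdapted D v := by
  induction v generalizing D with
  | nil => trivial
  | cons i v ih => exact ⟨h.1, ih h.2⟩

/-! ### Positive roots, reduced words and the objects of roots -/

section Positive

variable {n m : ℕ} {σ : Fin (n + m) ≃ Fin n ⊕ Fin m} {w : List (Fin (n + m - 1))}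

lemma isShortest_take (hw : IsReducedWord σ w) (j : Fin w.length) :
    IsShortest (w.take j ++ [w.get j]) := by
  have h1 := (isReducedWord_iff σ).1 hw
  rw [← List.take_append_drop (j + 1) w] at h1
  have h2 := h1.of_append_left
  rwa [List.take_succ_eq_append_getElem j.isLt] at h2

lemma take_eq_append_cons {j k : ℕ} (hjk : j < k) (hk : k < w.length) :
    w.take k = w.take j ++ w[j] :: (w.drop (j + 1)).take (k - j - 1) := by
  obtain ⟨d, rfl⟩ : ∃ d, k = j + (d + 1) := ⟨k - j - 1, by omega⟩
  rw [List.take_add, List.drop_eq_getElem_cons (by omega), List.take_succ_cons]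
  congr 3
  omega

lemma gammaRoot_injective (hw : IsReducedWord σ w) : Function.Injective (gammaRoot σ w) := by
  have key : ∀ j k : Fin w.length, j < k → gammaRoot σ w j ≠ gammaRoot σ w k := by
    intro j k hjk h
    have hne := fun i : Fin (n + m - 1) => (leftPt_lt_rightPt i).ne
    rw [gammaRoot_eq, gammaRoot_eq, unitVec_sub_inj σ ((wordPerm _).injective.ne (hne _))
      ((wordPerm _).injective.ne (hne _))] at h
    have h1 := isShortest_take hw k
    have h2 := take_eq_append_cons hjk k.isLt
    rw [h2] at h1 h
    exact h1.append_eq h.1 h.2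
  intro j k h
  rcases lt_trichotomy j k with h' | h' | h'
  · exact absurd h (key _ _ h')
  · exact h'
  · exact absurd h.symm (key _ _ h')

/-- The longest element reverses every pair `a < b`, hence meets it at some letter; a reduced word
meets it only once. -/
lemma existsUnique_gammaRoot (hw : IsReducedLongestWord σ w) {α : Lattice n m}
    (hα : IsPositiveRoot σ α) : ∃! j, gammaRoot σ w j = α := by
  obtain ⟨a, b, hab, rfl⟩ := (mem_roots_iff σ).1 hα.1
  rw [isPositiveRoot_iff σ hab] at hα
  obtain ⟨u, i, v, h, h1, h2⟩ := exists_split_of_longest ((isReducedWord_iff σ).1 hw.1)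
    (fun w' h' => hw.2 w' ((isReducedWord_iff σ).2 h')) hα
  have hlt : u.length < w.length := by simp [h]
  have hγ : gammaRoot σ w ⟨u.length, hlt⟩ = unitVec σ a - unitVec σ b := by
    have e1 : w.take u.length = u := by simp [h]
    have e2 : w.get ⟨u.length, hlt⟩ = i := by simp [h]
    rw [gammaRoot_eq, e2]
    simp only [e1, h1, h2]
  exact ⟨_, hγ, fun k hk => gammaRoot_injective hw.1 (hk.trans hγ.symm)⟩

variable (K : Type u) [Field K] {Ω : QuiverOrientation (dynkinGraph σ)}

/-- The index chosen in the definition belongs to `α` or to `-α`. As the root at any letter of a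
reduced word is positive, it is `e_a - e_b` with `a < b` in both cases. -/
lemma isIntervalLike_superRep (hw : IsReducedLongestWord σ w)
    (hΩ : IsAdapted (dynkinQuiver σ Ω) w) {a b : Fin (n + m)} (hab : a < b) {α : Lattice n m}
    (hα : α = unitVec σ a - unitVec σ b ∨ α = unitVec σ b - unitVec σ a) :
    (superRep K Ω w α).IsColoured ∧ SRep.IsIntervalLike (superRep K Ω w α) a b := by
  have hex : ∃ j, gammaRoot σ w j = α ∨ gammaRoot σ w j = -α := by
    obtain ⟨j, hj, -⟩ := existsUnique_gammaRoot hw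
      (⟨(mem_roots_iff σ).2 ⟨a, b, hab.ne, rfl⟩, ((isPositiveRoot_iff σ hab.ne).2 hab).2⟩ :
        IsPositiveRoot σ (unitVec σ a - unitVec σ b))
    refine ⟨j, ?_⟩
    rcases hα with rfl | rfl
    · exact .inl hj
    · exact .inr (hj.trans (neg_sub _ _).symm)
  have hsR : superRep K Ω w α = SRep.ofWord K (dynkinQuiver σ Ω) (w.take hex.choose)
      (w.get hex.choose) := dif_pos hex
  have hj := hex.choose_spec
  rw [hsR]
  generalize hex.choose = j at hj
  refine ⟨SRep.isColoured_ofWord _ _ _, ?_⟩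
  have hs := isShortest_take hw.1 j
  have hI := isIntervalLike_ofWord (K := K) (dynkinGraph_adj σ) hs
    (IsAdapted.of_append (w := w.drop j) ((List.take_append_drop j w).symm ▸ hΩ))
  have hlt := hs.lt
  rw [gammaRoot_eq] at hj
  have hcase : wordPerm (w.take j) (leftPt (w.get j)) = a ∧
      wordPerm (w.take j) (rightPt (w.get j)) = b := by
    have h1 : unitVec σ (wordPerm (w.take j) (leftPt (w.get j))) -
        unitVec σ (wordPerm (w.take j) (rightPt (w.get j))) = unitVec σ a - unitVec σ b ∨
        unitVec σ (wordPerm (w.take j) (leftPt (w.get j))) -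
        unitVec σ (wordPerm (w.take j) (rightPt (w.get j))) = unitVec σ b - unitVec σ a := by
      rcases hα with rfl | rfl
      · rwa [neg_sub] at hj
      · rw [neg_sub] at hj
        exact hj.symm
    rw [unitVec_sub_inj σ hlt.ne hab.ne, unitVec_sub_inj σ hlt.ne hab.ne'] at h1
    rcases h1 with h1 | h1
    · exact h1
    · rw [h1.1, h1.2] at hlt
      exact absurd hlt hab.not_gt
  rwa [hcase.1, hcase.2] at hI

lemma isColoured_superRep (hw : IsReducedLongestWord σ w)
    (hΩ : IsAdapted (dynkinQuiver σ Ω) w) {a b : Fin (n + m)} (hab : a ≠ b) :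
    (superRep K Ω w (unitVec σ a - unitVec σ b)).IsColoured := by
  rcases lt_or_gt_of_ne hab with h | h
  · exact (isIntervalLike_superRep K hw hΩ h (.inl rfl)).1
  · exact (isIntervalLike_superRep K hw hΩ h (.inr rfl)).1

lemma parity_superRep (hw : IsReducedLongestWord σ w)
    (hΩ : IsAdapted (dynkinQuiver σ Ω) w) {a b : Fin (n + m)} (hab : a ≠ b) :
    (superRep K Ω w (unitVec σ a - unitVec σ b)).parity = pointParity σ a + pointParity σ b := by
  rcases lt_or_gt_of_ne hab with h | h
  · obtain ⟨h1, h2⟩ := isIntervalLike_superRep K hw hΩ h (.inl rfl)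
    exact h2.parity_eq h1 (pointParity σ) (dynkinQuiver_colour σ Ω)
  · obtain ⟨h1, h2⟩ := isIntervalLike_superRep K hw hΩ h (.inr rfl)
    exact (h2.parity_eq h1 (pointParity σ) (dynkinQuiver_colour σ Ω)).trans (add_comm _ _)

lemma nonempty_stalk_iso {V : Type} {Γ : SimpleGraph V} {D : ColouredQuiver Γ} {X Y : SRep K D}
    (e : X ≅ Y) : Nonempty (stalk X ≅ stalk Y) :=
  ⟨(ObjectProperty.lift _ (DerivedCategory.singleFunctor (SRep K D) 0)
    (fun X => (stalk X).property)).mapIso e⟩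

lemma nonempty_rootObject_iso (hw : IsReducedLongestWord σ w)
    (hΩ : IsAdapted (dynkinQuiver σ Ω) w) {a b : Fin (n + m)} (hab : a ≠ b) :
    Nonempty (rootObject K Ω w (unitVec σ a - unitVec σ b) ≅
      SRep.rootPair K (dynkinQuiver σ Ω) a b) := by
  rcases lt_or_gt_of_ne hab with h | h
  · obtain ⟨e⟩ := (isIntervalLike_superRep K hw hΩ h (.inl rfl)).2.nonempty_iso (dynkinGraph_adj σ)
    obtain ⟨e⟩ := nonempty_stalk_iso K e
    rw [rootObject, if_pos ((isPositiveRoot_iff σ hab).2 h), SRep.rootPair,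
      if_pos (Fin.lt_def.1 h)]
    exact ⟨(Orbit.proj _).mapIso e⟩
  · obtain ⟨e⟩ := (isIntervalLike_superRep K hw hΩ h (.inr rfl)).2.nonempty_iso (dynkinGraph_adj σ)
    obtain ⟨e⟩ := nonempty_stalk_iso K e
    rw [rootObject, if_neg ((isPositiveRoot_iff σ hab).not.2 h.not_gt), SRep.rootPair,
      if_neg (Fin.lt_def.not.1 h.not_gt)]
    exact ⟨(Orbit.proj _).mapIso ((shiftFunctor _ (1 : ℤ)).mapIso e)⟩

variable (σ) in
/-- The root attached to an arc. -/
def arcRoot (Ω : QuiverOrientation (dynkinGraph σ)) (x : Fin (n + m) × Fin (n + m - 1)) :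
    roots n m :=
  ⟨unitVec σ (circlePoint (dynkinQuiver σ Ω) x.1) -
    unitVec σ (circlePoint (dynkinQuiver σ Ω) (arcEnd x)),
    (mem_roots_iff σ).2 ⟨_, _, (circlePoint _).injective.ne (arcEnd_ne x), rfl⟩⟩

lemma arcRoot_bijective (Ω : QuiverOrientation (dynkinGraph σ)) :
    Function.Bijective (arcRoot σ Ω) := by
  constructor
  · intro x y h
    have h1 := (unitVec_sub_inj σ ((circlePoint _).injective.ne (arcEnd_ne x))
      ((circlePoint _).injective.ne (arcEnd_ne y))).1 (congrArg Subtype.val h)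
    exact arc_ext ((circlePoint _).injective h1.1) ((circlePoint _).injective h1.2)
  · rintro ⟨α, hα⟩
    obtain ⟨a, b, hab, rfl⟩ := (mem_roots_iff σ).1 hα
    obtain ⟨i, hi⟩ := exists_arc (a := (circlePoint (dynkinQuiver σ Ω)).symm a)
      (b := (circlePoint (dynkinQuiver σ Ω)).symm b) (by simpa using hab)
    exact ⟨((circlePoint (dynkinQuiver σ Ω)).symm a, i), Subtype.ext (by simp [arcRoot, hi])⟩

end Positive

end

end SuperQuiver

theorem mainTheorem3 (K : Type u) [Field K] (n m : ℕ)
    (σ : Fin (n + m) ≃ Fin n ⊕ Fin m)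
    (Ω : QuiverOrientation (dynkinGraph σ))
    (w : List (Fin (n + m - 1)))
    (hw : IsReducedLongestWord σ w)
    (hΩ : IsAdapted (dynkinQuiver σ Ω) w)
    (ϖ : (dynkinGraph σ).Coloring (ZMod 2)) :
    (∀ α ∈ roots n m, IsPositiveRoot σ α ∨ IsPositiveRoot σ (-α)) ∧
    (∀ α, IsPositiveRoot σ α → ∃! j, gammaRoot σ w j = α) ∧
    (∀ α ∈ roots n m, (superRep K Ω w α).IsPure) ∧
    ∃ (hX : ∀ α : roots n m, IsIndecomposable (rootObject K Ω w α.1))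
      (Ψ : ARArrow (C := RootCategory K (dynkinQuiver σ Ω)) ≃r
        GammaHat.Arrow (ϖ := ϖ) (h := n + m))
      (Φ : roots n m ≃ GammaHat ϖ (n + m))
      (colour : GammaHat ϖ (n + m) → ZMod 2),
      (∀ α, Φ α = Ψ (ARVertex.mk (rootObject K Ω w α.1) (hX α))) ∧
      (∀ α, colour (Φ α) = (superRep K Ω w α.1).parity) ∧
      (∀ α : roots n m, (α.1 ∈ evenRoots n m ↔ colour (Φ α) = 0) ∧
        (α.1 ∈ oddRoots n m ↔ colour (Φ α) = 1)) ∧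
      (∀ x y : GammaHat ϖ (n + m), y.1 = (x.1.1, x.1.2 + 2) →
        (Φ.symm x).1 + (Φ.symm y).1 =
          ∑ᶠ (z : GammaHat ϖ (n + m)) (_ : GammaHat.Arrow x z), (Φ.symm z).1) := by
  have hΓ := dynkinGraph_adj σ
  have hP := isHomPoset_arcObject K hΓ (dynkinQuiver σ Ω)
  obtain ⟨c, hc⟩ := exists_coloring_eq hΓ ϖ
  -- All identifications pass through arcs: `R` leads to the roots, `E` to the Auslander–Reiten
  -- quiver and `arcEquiv` to the periodic quiver.
  let R := Equiv.ofBijective _ (arcRoot_bijective (σ := σ) Ω)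
  have hiso : ∀ x, Nonempty (rootObject K Ω w (R x).1 ≅ arcObject K (dynkinQuiver σ Ω) x) :=
    fun x => nonempty_rootObject_iso K hw hΩ ((circlePoint _).injective.ne (arcEnd_ne x))
  have hX : ∀ α : roots n m, IsIndecomposable (rootObject K Ω w α.1) := by
    intro α
    obtain ⟨x, rfl⟩ := R.surjective α
    obtain ⟨e⟩ := hiso x
    exact (hP.isIndecomposable x).of_iso e.symm
  let E := Equiv.ofBijective _ hP.bijective_mk
  let Φ : roots n m ≃ GammaHat ϖ (n + m) := R.symm.trans (arcEquiv hc)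
  have hpar : ∀ x, (superRep K Ω w (R x).1).parity =
      pointParity σ (circlePoint (dynkinQuiver σ Ω) x.1) +
        pointParity σ (circlePoint (dynkinQuiver σ Ω) (arcEnd x)) :=
    fun x => parity_superRep K hw hΩ ((circlePoint _).injective.ne (arcEnd_ne x))
  refine ⟨fun α hα => ?_, fun α => existsUnique_gammaRoot hw, fun α hα => ?_, hX,
    ⟨E.symm.trans (arcEquiv hc), fun {x y} => ?_⟩, Φ,
    fun x => (superRep K Ω w (Φ.symm x).1).parity, fun α => ?_, fun α => ?_, fun α => ?_,
    fun x y hxy => ?_⟩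
  · obtain ⟨a, b, hab, rfl⟩ := (mem_roots_iff σ).1 hα
    rw [neg_sub, isPositiveRoot_iff σ hab, isPositiveRoot_iff σ hab.symm]
    exact lt_or_gt_of_ne hab
  · obtain ⟨a, b, hab, rfl⟩ := (mem_roots_iff σ).1 hα
    exact (isColoured_superRep K hw hΩ hab).isPure
  · obtain ⟨x, rfl⟩ := E.surjective x
    obtain ⟨y, rfl⟩ := E.surjective y
    simp only [Equiv.trans_apply, Equiv.symm_apply_apply]
    rw [arrow_arcEquiv_iff hΓ]
    exact (hP.arArrow_iff x y).symm
  · obtain ⟨x, rfl⟩ := R.surjective α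
    -- The object of the root of an arc is isomorphic to the object of the arc, so the two
    -- identifications with the periodic quiver agree.
    have h1 : ARVertex.mk (rootObject K Ω w (R x).1) (hX (R x)) = E x := Quotient.sound (hiso x)
    change Φ (R x) = arcEquiv hc (E.symm _)
    rw [h1]
    simp [Φ]
  · simp only [Equiv.symm_apply_apply]
  · simp only [Equiv.symm_apply_apply]
    obtain ⟨x, rfl⟩ := R.surjective α
    have hne := (circlePoint (dynkinQuiver σ Ω)).injective.ne (arcEnd_ne x)
    rw [hpar]
    exact ⟨mem_evenRoots_iff σ hne, mem_oddRoots_iff σ hne⟩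
  · refine mesh_relation hΓ hc (fun p => unitVec σ (circlePoint (dynkinQuiver σ Ω) p)) hxy
      (fun z => (Φ.symm z).1) fun z => ?_
    simp only [Φ, Equiv.symm_trans_apply, Equiv.symm_apply_apply, Equiv.symm_symm]
    rfl
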